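/- Let $M$ be a smooth manifold with a regular foliation $\mathcal V$ of leaf dimension $k$, let $\mathbb V=T\mathcal V$ with annihilator $\mathbb V^0\subset T^*M$, and let $\Pi$ be a $\mathcal V$-coupling Poisson structure: a Poisson bivector field on $M$ such that $\mathbb H:=\Pi^\sharp(\mathbb V^0)$ is a normal bundle of $\mathcal V$, $TM=\mathbb H\oplus\mathbb V$. Here $\langle\beta,\Pi^\sharp\alpha\rangle=\Pi(\alpha,\beta)$. Let $\gamma:TM\to\mathbb V$ be the projection along $\mathbb H$, and let $A_{p,q}$ denote the bidegree components of multivector fields and forms with respect to $TM=\mathbb H\oplus\mathbb V$, where $p$ counts the $\mathbb H$- (resp. $\mathbb V^0$-) factors. Put $\Pi_H=\Pi_{2,0}$, $P=\Pi_{0,2}$, let $2l=\operatorname{rank}\mathbb H$, and let the coupling form $\sigma\in\Gamma(\wedge^2\mathbb V^0)$ be given by $\sigma^\flat|_{\mathbb H}=-(\Pi_H^\sharp|_{\mathbb V^0})^{-1}$. Insertions follow the convention $\mathbf i_{X\wedge Y}=\mathbf i_X\circ\mathbf i_Y$, and $R^\gamma(X,Y)=\gamma[(\mathrm{Id}-\gamma)X,(\mathrm{Id}-\gamma)Y]$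 is the curvature of $\gamma$. Assume that $\mathcal V$ is orientable and fix a leaf-wise volume form, that is, a nowhere vanishing $\tau\in\Gamma(\wedge^{k}\mathbb V^*)$. Let $\tau_\gamma=\tau\circ\wedge^k\gamma$ be its extension to $M$ which vanishes on $\mathbb H$. Then $\Omega:=\sigma^l\wedge\tau_\gamma$ is a volume form on $M$, and the following objects exist and are unique: * the modular vector field $Z=Z^\Omega_\Pi$ of $(M,\Pi,\Omega)$, given by $L_{\Pi^\sharp df}\Omega=Z(f)\,\Omega$ for all $f\in C^\infty(M)$; * the divergence form $\theta^\gamma_\tau\in\Gamma(\mathbb V^0)$, given by $(d\tau_\gamma)_{1,k}=\theta^\gamma_\tau\wedge\tau_\gamma$; * the foliated modular vector field $Z^\tau_P\in\Gamma(\mathbb V)$, given by $\mathbf i_{Z^\tau_P}\tau=-d_{\mathcal V}\mathbf i_P\tau$, with $d_{\mathcal V}$ the foliated exterior derivative; * the one-form $\Lambda\in\Gamma(\mathbb H^0)$, $\mathbb H^0$ the annihilator of $\mathbb H$, given by $(d\sigma^l)_{2l,1}=\Lambda\wedge\sigma^l$. The components of $Z$ relative to $TM=\mathbb H\oplus\mathbb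 V$ are $$Z_{1,0}=-\Pi^\sharp(\theta^\gamma_\tau),\qquad Z_{0,1}=Z^\tau_P ,$$ and moreover $\mathbf i_{\Pi_H}R^\gamma=P^\sharp\Lambda$. -/

import Mathlib

open scoped Manifold ContDiff

noncomputable section

namespace CouplingPoisson

/-! ### Linear algebra on a finite-dimensional real vector space `W` -/

section LinearAlgebra

variable {W : Type*} [AddCommGroup W] [Module ℝ W]

/-- `∧^k W^*`: alternating `k`-linear forms on `W`. -/
abbrev AltForm (W : Type*) [AddCommGroup W] [Module ℝ W] (k : ℕ) : Type _ :=
  W [⋀^Fin k]→ₗ[ℝ] ℝ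

/-- `∧² W`, as the space of alternating bilinear forms on the dual space; the bivector `X ∧ Y` is
`(α, β) ↦ α X * β Y - α Y * β X`. -/
abbrev Bivector (W : Type*) [AddCommGroup W] [Module ℝ W] : Type _ :=
  (Module.Dual ℝ W) [⋀^Fin 2]→ₗ[ℝ] ℝ

theorem map_snd_add (B : Bivector W) (α β β' : Module.Dual ℝ W) :
    B ![α, β + β'] = B ![α, β] + B ![α, β'] := by
  have e : ∀ c, Function.update ![α, β] 1 c = ![α, c] := fun c => by
    funext i; fin_cases i <;> rfl
  have h := B.map_update_add ![α, β] 1 β β'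
  rwa [e, e, e] at h

theorem map_snd_smul (B : Bivector W) (c : ℝ) (α β : Module.Dual ℝ W) :
    B ![α, c • β] = c • B ![α, β] := by
  have e : ∀ c, Function.update ![α, β] 1 c = ![α, c] := fun c => by
    funext i; fin_cases i <;> rfl
  have h := B.map_update_smul ![α, β] 1 c β
  rwa [e, e] at h

/-- The linear map `B^♯ : W^* → W` with `⟨β, B^♯ α⟩ = B(α, β)`. -/
def sharp [FiniteDimensional ℝ W] (B : Bivector W) : Module.Dual ℝ W →ₗ[ℝ] W :=
  (Module.evalEquiv ℝ W).symm.toLinearMap ∘ₗ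
    LinearMap.mk₂ ℝ (fun α β => B ![α, β])
      (fun α α' β => by simpa using B.map_vecCons_add ![β] α α')
      (fun c α β => by simpa using B.map_vecCons_smul ![β] c α)
      (fun α β β' => map_snd_add B α β β')
      (fun c α β => map_snd_smul B c α β)

theorem apply_sharp [FiniteDimensional ℝ W] (B : Bivector W) (α β : Module.Dual ℝ W) :
    β (sharp B α) = B ![α, β] := by
  simp [sharp]

theorem injOn_of_finrank_map {U : Type*} [AddCommGroup U] [Module ℝ U] [FiniteDimensional ℝ U]
    (f : U →ₗ[ℝ] W) (A : Submodule ℝ U)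
    (h : Module.finrank ℝ (A.map f) = Module.finrank ℝ A) : Set.InjOn f (A : Set U) := by
  have h3 := (f.domRestrict A).finrank_range_add_finrank_ker
  rw [LinearMap.range_domRestrict] at h3
  have h5 := LinearMap.ker_eq_bot.1 (Submodule.finrank_eq_zero.1
    (show Module.finrank ℝ (LinearMap.ker (f.domRestrict A)) = 0 by omega))
  intro α hα β hβ hab
  exact congrArg Subtype.val (@h5 ⟨α, hα⟩ ⟨β, hβ⟩ hab)

/-- If `B^♯(V⁰)` is a complement of `V`, then `B^♯` is injective on `V⁰`. -/
theorem sharp_injOn [FiniteDimensional ℝ W] (B : Bivector W) (V : Submodule ℝ W)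
    (hV : IsCompl (V.dualAnnihilator.map (sharp B)) V) :
    Set.InjOn (sharp B) (V.dualAnnihilator : Set (Module.Dual ℝ W)) := by
  have h1 := Subspace.finrank_add_finrank_dualAnnihilator_eq V
  have h2 := Submodule.finrank_add_eq_of_isCompl hV
  exact injOn_of_finrank_map _ _ (by omega)

/-- The contraction of a bivector `B` with a bilinear `F : W × W → N`: the insertion `i_B F` with
the convention `i_{X ∧ Y} = i_X ∘ i_Y`, that is `i_{X ∧ Y} F = F(Y, X)` for skew-symmetric `F`.
In a basis, `B = (1/2) ∑ B(e^i, e^j) e_i ∧ e_j`. -/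
def contract [FiniteDimensional ℝ W] {N : Type*} [AddCommGroup N] [Module ℝ N]
    (B : Bivector W) (F : W → W → N) : N :=
  (1 / 2 : ℝ) • ∑ i, ∑ j,
    B ![(Module.finBasis ℝ W).coord i, (Module.finBasis ℝ W).coord j] •
      F (Module.finBasis ℝ W j) (Module.finBasis ℝ W i)

/-- The wedge product of alternating forms (sum over shuffles, without normalizing factor). -/
def wedge {p q : ℕ} (a : AltForm W p) (b : AltForm W q) : AltForm W (p + q) :=
  ((LinearMap.mul' ℝ ℝ).compAlternatingMap (a.domCoprod b)).domDomCongr finSumFinEquiv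

/-- The wedge product `α ∧ η` of a covector and a `k`-form, in degree `k + 1`. -/
def wedgeCovector {k : ℕ} (α : Module.Dual ℝ W) (η : AltForm W k) : AltForm W (k + 1) :=
  (wedge (AlternatingMap.ofSubsingleton ℝ W ℝ (0 : Fin 1) α) η).domDomCongr
    (finCongr (Nat.add_comm 1 k))

/-- The wedge power `s ∧ ⋯ ∧ s` (`l` factors) of a two-form. -/
def wedgePow (s : AltForm W 2) : (l : ℕ) → AltForm W (2 * l)
  | 0 => AlternatingMap.constOfIsEmpty ℝ W (Fin 0) (1 : ℝ)
  | l + 1 => wedge (wedgePow s l) s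

/-- The two-form defined by an alternating bilinear map. -/
def formOfBilin (s : W →ₗ[ℝ] W →ₗ[ℝ] ℝ) (hs : s.IsAlt) : AltForm W 2 where
  toFun v := s (v 0) (v 1)
  map_update_add' v i x y := by
    fin_cases i <;> simp [Function.update]
  map_update_smul' v i c x := by
    fin_cases i <;> simp [Function.update]
  map_eq_zero_of_eq' v i j hv hij := by
    fin_cases i <;> fin_cases j <;> simp_all
    · exact hs _
    · exact hs _

/-- Given a splitting with projections `h, g` (`h + g = id`), the component of the `m`-form `η`
having `p` slots along the image of `h` and `m - p` slots along the image of `g`: the sum, over all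
choices of `p` slots, of `η` with `h` applied in these slots and `g` in the others. -/
def splitComponent (h g : W →ₗ[ℝ] W) (p : ℕ) {m : ℕ} (η : AltForm W m) : AltForm W m where
  toMultilinearMap := ∑ S ∈ Finset.powersetCard p (Finset.univ : Finset (Fin m)),
    η.toMultilinearMap.compLinearMap (fun i => if i ∈ S then h else g)
  map_eq_zero_of_eq' v i j hv hij := by
    classical
    simp only [MultilinearMap.toFun_eq_coe, sum_apply,
      MultilinearMap.compLinearMap_apply, AlternatingMap.coe_multilinearMap]
    refine Finset.sum_involution (fun S _ => S.map (Equiv.swap i j).toEmbedding) ?_ ?_ ?_ ?_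
    · intro S _
      have key : (fun a => (if a ∈ S.map (Equiv.swap i j).toEmbedding then h else g) (v a)) =
          (fun a => (if a ∈ S then h else g) (v a)) ∘ Equiv.swap i j := by
        funext a
        have hva : v (Equiv.swap i j a) = v a := Equiv.apply_swap_eq_self hv a
        have hm : (a ∈ S.map (Equiv.swap i j).toEmbedding) ↔ Equiv.swap i j a ∈ S := by
          rw [Finset.mem_map_equiv, Equiv.symm_swap]
        simp only [Function.comp_apply, hm, hva]
      rw [key, AlternatingMap.map_swap _ _ hij, add_neg_cancel]
    · intro S _ hne hS
      apply hne
      refine η.map_eq_zero_of_eq _ ?_ hij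
      have hm : i ∈ S ↔ j ∈ S := by
        conv_lhs => rw [← hS]
        rw [Finset.mem_map_equiv, Equiv.symm_swap, Equiv.swap_apply_left]
      simp only [hm, hv]
    · intro S hS
      simpa [Finset.mem_powersetCard] using hS
    · intro S _
      ext a
      simp [Finset.mem_map_equiv, Equiv.symm_swap]

theorem continuous_altForm {W : Type*} [NormedAddCommGroup W] [NormedSpace ℝ W]
    [FiniteDimensional ℝ W] {k : ℕ} (η : AltForm W k) : Continuous η := by
  classical
  let b := Module.finBasis ℝ W
  have h : ∀ v, η v = ∑ r : Fin k → Fin (Module.finrank ℝ W),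
      (∏ i, b.repr (v i) (r i)) * η (fun i => b (r i)) := by
    intro v
    conv_lhs => rw [show v = fun i => ∑ j, b.repr (v i) j • b j from
      funext fun i => (b.sum_repr (v i)).symm]
    rw [← AlternatingMap.coe_multilinearMap, MultilinearMap.map_sum]
    simp [MultilinearMap.map_smul_univ]
  rw [show (η : (Fin k → W) → ℝ) = _ from funext h]
  refine continuous_finsetSum _ fun r _ => Continuous.mul ?_ continuous_const
  refine continuous_finsetProd _ fun i _ => ?_
  exact ((b.coord (r i)).continuous_of_finiteDimensional).comp (continuous_apply i)

/-- An alternating form on a finite-dimensional normed space, as a continuous alternating map. -/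
def toContinuousForm {W : Type*} [NormedAddCommGroup W] [NormedSpace ℝ W]
    [FiniteDimensional ℝ W] {k : ℕ} (η : AltForm W k) : W [⋀^Fin k]→L[ℝ] ℝ :=
  { η with cont := continuous_altForm η }

end LinearAlgebra

/-! ### Calculus on a smooth manifold `M` modelled on `E` -/

section Calculus

variable {E : Type*} [NormedAddCommGroup E] [NormedSpace ℝ E] [FiniteDimensional ℝ E]
  {M : Type*} [TopologicalSpace M] [ChartedSpace E M] [IsManifold 𝓘(ℝ, E) ∞ M]

instance instFiniteDimensionalTangentSpace (x : M) :
    FiniteDimensional ℝ (TangentSpace 𝓘(ℝ, E) x) :=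
  inferInstanceAs (FiniteDimensional ℝ E)

/-- (Not necessarily smooth) vector fields. -/
abbrev VField (E M : Type*) [NormedAddCommGroup E] [NormedSpace ℝ E] [TopologicalSpace M]
    [ChartedSpace E M] : Type _ :=
  (x : M) → TangentSpace 𝓘(ℝ, E) x

/-- (Not necessarily smooth) one-forms, as fields of covectors. -/
abbrev CovectorField (E M : Type*) [NormedAddCommGroup E] [NormedSpace ℝ E] [TopologicalSpace M]
    [ChartedSpace E M] : Type _ :=
  (x : M) → Module.Dual ℝ (TangentSpace 𝓘(ℝ, E) x)

/-- (Not necessarily smooth) differential forms of degree `k`. -/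
abbrev DForm (E M : Type*) [NormedAddCommGroup E] [NormedSpace ℝ E] [TopologicalSpace M]
    [ChartedSpace E M] (k : ℕ) : Type _ :=
  (x : M) → AltForm (TangentSpace 𝓘(ℝ, E) x) k

/-- (Not necessarily smooth) bivector fields. -/
abbrev BivectorField (E M : Type*) [NormedAddCommGroup E] [NormedSpace ℝ E] [TopologicalSpace M]
    [ChartedSpace E M] : Type _ :=
  (x : M) → Bivector (TangentSpace 𝓘(ℝ, E) x)

/-- Smooth real functions on `M`. -/
def IsSmoothFun (E : Type*) {M : Type*} [NormedAddCommGroup E] [NormedSpace ℝ E]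
    [TopologicalSpace M] [ChartedSpace E M] (f : M → ℝ) : Prop :=
  ContMDiff 𝓘(ℝ, E) 𝓘(ℝ, ℝ) ∞ f

/-- Smooth vector fields: smooth sections of the tangent bundle. -/
def IsSmoothVField (X : VField E M) : Prop :=
  ContMDiff 𝓘(ℝ, E) 𝓘(ℝ, E).tangent ∞ fun x => (⟨x, X x⟩ : TangentBundle 𝓘(ℝ, E) M)

/-- A one-form is smooth if its values on smooth vector fields are smooth. -/
def IsSmoothCovectorField (α : CovectorField E M) : Prop :=
  ∀ X : VField E M, IsSmoothVField X → IsSmoothFun E fun x => α x (X x)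

/-- A `k`-form is smooth if its values on smooth vector fields are smooth. -/
def IsSmoothForm {k : ℕ} (η : DForm E M k) : Prop :=
  ∀ X : Fin k → VField E M, (∀ i, IsSmoothVField (X i)) →
    IsSmoothFun E fun x => η x fun i => X i x

/-- A bivector field is smooth if its values on smooth one-forms are smooth. -/
def IsSmoothBivectorField (B : BivectorField E M) : Prop :=
  ∀ α β : CovectorField E M, IsSmoothCovectorField α → IsSmoothCovectorField β →
    IsSmoothFun E fun x => B x ![α x, β x]

/-- The differential `df` of a function. -/
def differential (E : Type*) {M : Type*} [NormedAddCommGroup E] [NormedSpace ℝ E]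
    [TopologicalSpace M] [ChartedSpace E M] (f : M → ℝ) : CovectorField E M :=
  fun x => (mvfderiv 𝓘(ℝ, E) f x).toLinearMap

/-- The representation on `E` of a form `η` on `M` in the chart around `x`: its pullback by the
inverse of the chart. -/
def chartForm {k : ℕ} (η : DForm E M k) (x : M) (y : E) : E [⋀^Fin k]→L[ℝ] ℝ :=
  toContinuousForm ((η ((extChartAt 𝓘(ℝ, E) x).symm y)).compLinearMap
    (mfderiv 𝓘(ℝ, E) 𝓘(ℝ, E) (extChartAt 𝓘(ℝ, E) x).symm y).toLinearMap)

/-- The exterior derivative of a form on `M`, computed at `x` in the chart around `x`. -/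
def extD {k : ℕ} (η : DForm E M k) : DForm E M (k + 1) := fun x =>
  (extDeriv (chartForm η x) (extChartAt 𝓘(ℝ, E) x x)).toAlternatingMap.compLinearMap
    (mfderiv 𝓘(ℝ, E) 𝓘(ℝ, E) (extChartAt 𝓘(ℝ, E) x) x).toLinearMap

/-- The function `(L_X η)(Y_1, …, Y_k) = X(η(Y_1, …, Y_k)) - ∑ η(Y_1, …, [X, Y_i], …, Y_k)`. -/
def lieDerivApply {k : ℕ} (X : VField E M) (η : DForm E M k) (Y : Fin k → VField E M) (x : M) : ℝ :=
  differential E (fun y => η y fun i => Y i y) x (X x) -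
    ∑ i, η x (Function.update (fun j => Y j x) i (VectorField.mlieBracket 𝓘(ℝ, E) X (Y i) x))

/-- `g = div^Ω(X)`, that is, `L_X Ω = g Ω`. -/
def IsDivergence {k : ℕ} (Ω : DForm E M k) (X : VField E M) (g : M → ℝ) : Prop :=
  ∀ Y : Fin k → VField E M, (∀ i, IsSmoothVField (Y i)) →
    ∀ x, lieDerivApply X Ω Y x = g x * Ω x fun i => Y i x

/-- Volume forms: smooth nowhere vanishing forms of top degree. -/
def IsVolumeForm {k : ℕ} (Ω : DForm E M k) : Prop :=
  IsSmoothForm Ω ∧ ∀ x : M, k = Module.finrank ℝ (TangentSpace 𝓘(ℝ, E) x) ∧ Ω x ≠ 0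

/-- The bracket `{f, g} = B(df, dg)` of a bivector field `B`. -/
def poissonBracket (B : BivectorField E M) (f g : M → ℝ) : M → ℝ :=
  fun x => B x ![differential E f x, differential E g x]

/-- The Hamiltonian vector field `B^♯ df`. -/
def hamiltonian (B : BivectorField E M) (f : M → ℝ) : VField E M :=
  fun x => sharp (B x) (differential E f x)

/-- Poisson bivector fields: smooth bivector fields whose bracket satisfies the Jacobi identity. -/
structure IsPoisson (B : BivectorField E M) : Prop where
  smooth : IsSmoothBivectorField B
  jacobi : ∀ f g h : M → ℝ, IsSmoothFun E f → IsSmoothFun E g → IsSmoothFun E h → ∀ x,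
    poissonBracket B f (poissonBracket B g h) x + poissonBracket B g (poissonBracket B h f) x +
      poissonBracket B h (poissonBracket B f g) x = 0

/-- `Z` is the modular vector field of the Poisson bivector field `B` with respect to `Ω`:
`Z(f) = div^Ω(B^♯ df)` for every smooth function `f`. -/
def IsModularVectorField {n : ℕ} (B : BivectorField E M) (Ω : DForm E M n) (Z : VField E M) :
    Prop :=
  IsSmoothVField Z ∧
    ∀ f : M → ℝ, IsSmoothFun E f →
      IsDivergence Ω (hamiltonian B f) fun x => differential E f x (Z x)

end Calculus

/-! ### Regular foliations and leaf-wise objects -/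

/-- A regular foliation with leaves of dimension `k`, given by its tangent distribution: a smooth
distribution of constant rank `k` which is involutive (equivalently, by the Frobenius theorem,
integrable). -/
structure RegularFoliation (E M : Type*) [NormedAddCommGroup E] [NormedSpace ℝ E]
    [TopologicalSpace M] [ChartedSpace E M] [IsManifold 𝓘(ℝ, E) ∞ M] (k : ℕ) where
  /-- The tangent space of the leaf through `x`. -/
  tangent : (x : M) → Submodule ℝ (TangentSpace 𝓘(ℝ, E) x)
  finrank_eq : ∀ x, Module.finrank ℝ (tangent x) = k
  smooth : ∀ x, ∀ v ∈ tangent x, ∃ X : VField E M,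
    IsSmoothVField X ∧ (∀ y, X y ∈ tangent y) ∧ X x = v
  involutive : ∀ X Y : VField E M, IsSmoothVField X → IsSmoothVField Y →
    (∀ y, X y ∈ tangent y) → (∀ y, Y y ∈ tangent y) →
      ∀ x, VectorField.mlieBracket 𝓘(ℝ, E) X Y x ∈ tangent x

namespace RegularFoliation

variable {E : Type*} [NormedAddCommGroup E] [NormedSpace ℝ E] [FiniteDimensional ℝ E]
  {M : Type*} [TopologicalSpace M] [ChartedSpace E M] [IsManifold 𝓘(ℝ, E) ∞ M] {k : ℕ}

/-- `Γ(𝕍)`: smooth vector fields tangent to the foliation. -/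
structure Section (F : RegularFoliation E M k) where
  /-- The value at a point. -/
  val : (x : M) → F.tangent x
  smooth : IsSmoothVField (E := E) fun x => (val x : TangentSpace 𝓘(ℝ, E) x)

/-- The Lie bracket of two vector fields tangent to the foliation. -/
def bracket (F : RegularFoliation E M k) (X Y : F.Section) (x : M) : F.tangent x :=
  ⟨VectorField.mlieBracket 𝓘(ℝ, E) (fun y => (X.val y : TangentSpace 𝓘(ℝ, E) y))
      (fun y => (Y.val y : TangentSpace 𝓘(ℝ, E) y)) x,
    F.involutive _ _ X.smooth Y.smooth (fun y => (X.val y).2) (fun y => (Y.val y).2) x⟩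

/-- (Not necessarily smooth) foliated forms: fields of elements of `∧^p 𝕍^*`. -/
abbrev LeafForm (F : RegularFoliation E M k) (p : ℕ) : Type _ :=
  (x : M) → AltForm (F.tangent x) p

/-- A foliated form is smooth if its values on smooth sections of `𝕍` are smooth. -/
def IsSmoothLeafForm (F : RegularFoliation E M k) {p : ℕ} (μ : F.LeafForm p) : Prop :=
  ∀ Y : Fin p → F.Section, IsSmoothFun E fun x => μ x fun i => (Y i).val x

/-- Leaf-wise volume forms: nowhere vanishing elements of `Γ(∧^top 𝕍^*)`. -/
def IsLeafwiseVolume (F : RegularFoliation E M k) (τ : F.LeafForm k) : Prop :=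
  F.IsSmoothLeafForm τ ∧ ∀ x, τ x ≠ 0

/-- The value `(d_𝒱 μ)(Y_0, …, Y_p)` of the foliated exterior derivative (the differential of the
Lie algebroid `𝕍`), by the invariant formula
`∑_i (-1)^i Y_i(μ(Y_0, …, Ŷ_i, …, Y_p))
  + ∑_{i<j} (-1)^{i+j} μ([Y_i, Y_j], Y_0, …, Ŷ_i, …, Ŷ_j, …, Y_p)`.
In the second sum `[Y_i, Y_j]` is written in the slot of `Y_i`, which accounts for the sign
`(-1)^j` instead of `(-1)^{i+j}`. -/
def leafD (F : RegularFoliation E M k) {p : ℕ} (μ : F.LeafForm p) (Y : Fin (p + 1) → F.Section)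
    (x : M) : ℝ :=
  (∑ i : Fin (p + 1), (-1 : ℝ) ^ (i : ℕ) *
      differential E (fun y => μ y fun a => (Y (i.succAbove a)).val y) x ((Y i).val x)) +
    ∑ j : Fin (p + 1), ∑ i ∈ Finset.univ.filter (fun i => i < j), (-1 : ℝ) ^ (j : ℕ) *
      μ x fun a : Fin p =>
        if j.succAbove a = i then F.bracket (Y i) (Y j) x else (Y (j.succAbove a)).val x

/-- The foliated form `i_P μ`, for a leaf-tangent bivector field `P`. -/
def insertBivector (F : RegularFoliation E M k) {p : ℕ} (P : (x : M) → Bivector (F.tangent x))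
    (μ : F.LeafForm (p + 2)) : F.LeafForm p :=
  fun x => contract (P x) fun u v => ((μ x).curryLeft u).curryLeft v

/-- The equality `i_W τ = - d_𝒱 (i_P τ)` of foliated forms of degree `p - 1`, for a leaf-tangent
vector field `W`, a leaf-tangent bivector field `P` and a foliated form `τ` of degree `p`; forms of
negative degree are zero. -/
def ModularEquation (F : RegularFoliation E M k) (P : (x : M) → Bivector (F.tangent x))
    (W : F.Section) : (p : ℕ) → F.LeafForm p → Prop
  | 0, _ => True
  | 1, τ => ∀ x, (τ x).curryLeft (W.val x) = 0
  | _ + 2, τ => ∀ Y : Fin _ → F.Section, ∀ x,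
      (τ x).curryLeft (W.val x) (fun i => (Y i).val x) = - F.leafD (F.insertBivector P τ) Y x

/-- `W` is the modular vector field `Z_P^τ` of the Poisson foliation given by `P`, with respect to
the leaf-wise volume form `τ`. -/
def IsFoliatedModularVectorField (F : RegularFoliation E M k)
    (P : (x : M) → Bivector (F.tangent x)) (τ : F.LeafForm k) (W : F.Section) : Prop :=
  F.ModularEquation P W k τ

end RegularFoliation

/-! ### Coupling Poisson structures and their geometric data -/

/-- A coupling Poisson structure on a foliated manifold: a Poisson bivector field `Π` such that
`ℍ = Π^♯(𝕍⁰)` is a normal bundle of the foliation, `TM = ℍ ⊕ 𝕍`. -/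
structure CouplingStructure {E M : Type*} [NormedAddCommGroup E] [NormedSpace ℝ E]
    [FiniteDimensional ℝ E] [TopologicalSpace M] [ChartedSpace E M] [IsManifold 𝓘(ℝ, E) ∞ M] {k : ℕ}
    (F : RegularFoliation E M k) where
  /-- The Poisson bivector field. -/
  bivector : BivectorField E M
  isPoisson : IsPoisson bivector
  isCompl : ∀ x, IsCompl ((F.tangent x).dualAnnihilator.map (sharp (bivector x))) (F.tangent x)

namespace CouplingStructure

variable {E : Type*} [NormedAddCommGroup E] [NormedSpace ℝ E] [FiniteDimensional ℝ E]
  {M : Type*} [TopologicalSpace M] [ChartedSpace E M] [IsManifold 𝓘(ℝ, E) ∞ M]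
  {k : ℕ} {F : RegularFoliation E M k}

/-- The normal bundle `ℍ = Π^♯(𝕍⁰)`. -/
def horizontal (C : CouplingStructure F) (x : M) : Submodule ℝ (TangentSpace 𝓘(ℝ, E) x) :=
  (F.tangent x).dualAnnihilator.map (sharp (C.bivector x))

/-- The connection form `γ`: the projection `TM → 𝕍` along `ℍ`. -/
def conn (C : CouplingStructure F) (x : M) : TangentSpace 𝓘(ℝ, E) x →ₗ[ℝ] F.tangent x :=
  (F.tangent x).projectionOnto (C.horizontal x) (C.isCompl x).symm

/-- The projection `TM → 𝕍 ⊆ TM` along `ℍ`. -/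
def verProj (C : CouplingStructure F) (x : M) :
    TangentSpace 𝓘(ℝ, E) x →ₗ[ℝ] TangentSpace 𝓘(ℝ, E) x :=
  (F.tangent x).subtype ∘ₗ C.conn x

/-- The projection `Id - γ : TM → ℍ ⊆ TM` along `𝕍`. -/
def horProj (C : CouplingStructure F) (x : M) :
    TangentSpace 𝓘(ℝ, E) x →ₗ[ℝ] TangentSpace 𝓘(ℝ, E) x :=
  LinearMap.id - C.verProj x

/-- The horizontal component `Π_H = Π_{2,0}`, as a bivector field on `M`. -/
def horBivector (C : CouplingStructure F) : BivectorField E M :=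
  fun x => (C.bivector x).compLinearMap (C.horProj x).dualMap

/-- The leaf-tangent component `P = Π_{0,2}`, as a section of `∧² 𝕍`. -/
def verBivector (C : CouplingStructure F) (x : M) : Bivector (F.tangent x) :=
  (C.bivector x).compLinearMap (C.conn x).dualMap

theorem horProj_of_mem (C : CouplingStructure F) {x : M} {v : TangentSpace 𝓘(ℝ, E) x}
    (hv : v ∈ C.horizontal x) : C.horProj x v = v := by
  have h0 : C.conn x v = 0 := (Submodule.projectionOnto_apply_eq_zero_iff _).2 hv
  simp [horProj, verProj, h0]

theorem horProj_mem (C : CouplingStructure F) (x : M) (v : TangentSpace 𝓘(ℝ, E) x) :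
    C.horProj x v ∈ C.horizontal x := by
  refine (Submodule.projectionOnto_apply_eq_zero_iff (C.isCompl x).symm).1 ?_
  change C.conn x _ = 0
  have h : C.conn x (C.conn x v : TangentSpace 𝓘(ℝ, E) x) = C.conn x v :=
    Submodule.projectionOnto_apply_left _ _
  simp [horProj, verProj, h]

theorem apply_horProj_of_mem (C : CouplingStructure F) {x : M}
    {α : Module.Dual ℝ (TangentSpace 𝓘(ℝ, E) x)} (hα : α ∈ (F.tangent x).dualAnnihilator)
    (v : TangentSpace 𝓘(ℝ, E) x) : α (C.horProj x v) = α v := by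
  have h : α (C.conn x v : TangentSpace 𝓘(ℝ, E) x) = 0 :=
    (Submodule.mem_dualAnnihilator α).1 hα _ (C.conn x v).2
  simp [horProj, verProj, h]

/-- On `𝕍⁰` the maps `Π_H^♯` and `Π^♯` coincide. -/
theorem sharp_horBivector_of_mem (C : CouplingStructure F) {x : M}
    {α : Module.Dual ℝ (TangentSpace 𝓘(ℝ, E) x)} (hα : α ∈ (F.tangent x).dualAnnihilator) :
    sharp (C.horBivector x) α = sharp (C.bivector x) α := by
  apply (Module.evalEquiv ℝ (TangentSpace 𝓘(ℝ, E) x)).injective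
  ext β
  simp only [Module.evalEquiv_apply, Module.Dual.eval_apply]
  have hα' : (C.horProj x).dualMap α = α := by
    ext v; exact C.apply_horProj_of_mem hα v
  have h1 : β (sharp (C.horBivector x) α) =
      (C.horProj x).dualMap β (sharp (C.bivector x) α) := by
    rw [apply_sharp, apply_sharp]
    simp only [horBivector, AlternatingMap.compLinearMap_apply]
    congr 1
    funext i
    fin_cases i
    · exact hα'
    · rfl
  rw [h1]
  exact congrArg β (C.horProj_of_mem (Submodule.mem_map_of_mem hα))

/-- The map `Π_H^♯|_{𝕍⁰} : 𝕍⁰ → ℍ`. -/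
def horSharp (C : CouplingStructure F) (x : M) :
    (F.tangent x).dualAnnihilator →ₗ[ℝ] C.horizontal x :=
  ((sharp (C.horBivector x)).domRestrict (F.tangent x).dualAnnihilator).codRestrict
    (C.horizontal x) fun α => by
      rw [LinearMap.domRestrict_apply, C.sharp_horBivector_of_mem α.2]
      exact Submodule.mem_map_of_mem α.2

theorem bijective_horSharp (C : CouplingStructure F) (x : M) :
    Function.Bijective (C.horSharp x) := by
  refine ⟨?_, ?_⟩
  · rintro ⟨α, hα⟩ ⟨β, hβ⟩ h
    have h1 : sharp (C.bivector x) α = sharp (C.bivector x) β := by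
      rw [← C.sharp_horBivector_of_mem hα, ← C.sharp_horBivector_of_mem hβ]
      exact congrArg Subtype.val h
    exact Subtype.ext (sharp_injOn _ _ (C.isCompl x) hα hβ h1)
  · rintro ⟨v, hv⟩
    obtain ⟨α, hα, rfl⟩ := hv
    exact ⟨⟨α, hα⟩, Subtype.ext (C.sharp_horBivector_of_mem hα)⟩

/-- The isomorphism `Π_H^♯|_{𝕍⁰} : 𝕍⁰ → ℍ`. -/
def sharpEquiv (C : CouplingStructure F) (x : M) :
    (F.tangent x).dualAnnihilator ≃ₗ[ℝ] C.horizontal x :=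
  LinearEquiv.ofBijective (C.horSharp x) (C.bijective_horSharp x)

theorem coe_sharpEquiv (C : CouplingStructure F) (x : M) (α : (F.tangent x).dualAnnihilator) :
    (C.sharpEquiv x α : TangentSpace 𝓘(ℝ, E) x) = sharp (C.horBivector x) α := rfl

/-- The bundle map `σ^♭ : TM → T^*M`, `u ↦ i_u σ`: it vanishes on `𝕍` and is
`-(Π_H^♯|_{𝕍⁰})⁻¹ : ℍ → 𝕍⁰` on `ℍ`. -/
def couplingFlat (C : CouplingStructure F) (x : M) :
    TangentSpace 𝓘(ℝ, E) x →ₗ[ℝ] TangentSpace 𝓘(ℝ, E) x →ₗ[ℝ] ℝ :=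
  -((F.tangent x).dualAnnihilator.subtype ∘ₗ (C.sharpEquiv x).symm.toLinearMap ∘ₗ
    (C.horProj x).codRestrict (C.horizontal x) (C.horProj_mem x))

theorem isAlt_couplingFlat (C : CouplingStructure F) (x : M) : (C.couplingFlat x).IsAlt := by
  intro u
  set w : C.horizontal x := ⟨C.horProj x u, C.horProj_mem x u⟩ with hw
  set α := (C.sharpEquiv x).symm w with hα
  have h1 : C.couplingFlat x u u = -(α : Module.Dual ℝ (TangentSpace 𝓘(ℝ, E) x)) u := rfl
  have h2 : C.horProj x u = sharp (C.horBivector x) α := by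
    rw [← coe_sharpEquiv, hα, LinearEquiv.apply_symm_apply]
  rw [h1, ← C.apply_horProj_of_mem α.2, h2, apply_sharp,
    AlternatingMap.map_eq_zero_of_eq _ _ (i := 0) (j := 1) rfl (by decide), neg_zero]

/-- The coupling form `σ ∈ Γ(∧² 𝕍⁰)`, defined by `σ^♭|_ℍ = -(Π_H^♯|_{𝕍⁰})⁻¹`. -/
def couplingForm (C : CouplingStructure F) : DForm E M 2 :=
  fun x => formOfBilin (C.couplingFlat x) (C.isAlt_couplingFlat x)

/-- The number `l`, where `2 l = rank ℍ = dim M - k` (the rank of `ℍ` is even). -/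
def halfRank (_C : CouplingStructure F) : ℕ := (Module.finrank ℝ E - k) / 2

/-- The transversal volume element `σ^l = σ ∧ ⋯ ∧ σ`. -/
def transversalForm (C : CouplingStructure F) : DForm E M (2 * C.halfRank) :=
  fun x => wedgePow (C.couplingForm x) C.halfRank

/-- The form `μ_γ` on `M` which vanishes on `ℍ` and restricts to the foliated form `μ` on `𝕍`. -/
def extendForm (C : CouplingStructure F) {p : ℕ} (μ : F.LeafForm p) : DForm E M p :=
  fun x => (μ x).compLinearMap (C.conn x)

/-- The volume form `Ω = σ^l ∧ τ_γ`. -/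
def volume (C : CouplingStructure F) (τ : F.LeafForm k) : DForm E M (2 * C.halfRank + k) :=
  fun x => wedge (C.transversalForm x) (C.extendForm τ x)

/-- The component of bidegree `(p, m - p)` of an `m`-form with respect to `TM = ℍ ⊕ 𝕍`. -/
def bidegree (C : CouplingStructure F) (p : ℕ) {m : ℕ} (η : DForm E M m) : DForm E M m :=
  fun x => splitComponent (C.horProj x) (C.verProj x) p (η x)

/-- The divergence form `θ_τ^γ ∈ Γ(𝕍⁰)`, defined by `d_{1,0} τ_γ = θ ∧ τ_γ`. As `τ_γ` has bidegree
`(0, k)`, `d_{1,0} τ_γ` is the component of bidegree `(1, k)` of `d τ_γ`. -/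
structure IsDivergenceForm (C : CouplingStructure F) (τ : F.LeafForm k)
    (θ : CovectorField E M) : Prop where
  smooth : IsSmoothCovectorField θ
  apply_tangent : ∀ x, ∀ v ∈ F.tangent x, θ x v = 0
  eq : ∀ x, C.bidegree 1 (extD (C.extendForm τ)) x = wedgeCovector (θ x) (C.extendForm τ x)

/-- The one-form `Λ ∈ Γ(ℍ⁰)`, defined by `d_{0,1} σ^l = Λ ∧ σ^l`. As `σ^l` has bidegree `(2l, 0)`,
`d_{0,1} σ^l` is the component of bidegree `(2l, 1)` of `d σ^l`. -/
structure IsReebForm (C : CouplingStructure F) (Λ : CovectorField E M) : Prop where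
  smooth : IsSmoothCovectorField Λ
  apply_horizontal : ∀ x, ∀ v ∈ C.horizontal x, Λ x v = 0
  eq : ∀ x, C.bidegree (2 * C.halfRank) (extD C.transversalForm) x =
    wedgeCovector (Λ x) (C.transversalForm x)

/-- The curvature `R^γ(X, Y) = γ[(Id - γ) X, (Id - γ) Y]`, evaluated on two tangent vectors at `x`
by extending them to vector fields which are smooth near `x`. -/
def curvature (C : CouplingStructure F) (x : M)
    (u v : TangentSpace 𝓘(ℝ, E) x) : F.tangent x :=
  C.conn x (VectorField.mlieBracket 𝓘(ℝ, E)
    (fun y => C.horProj y (FiberBundle.extend E u y))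
    (fun y => C.horProj y (FiberBundle.extend E v y)) x)

end CouplingStructure

end CouplingPoisson

end

set_option linter.unusedSectionVars false

noncomputable section

namespace CouplingPoisson

/-! ### Wedge products as sums over permutations -/

section ExteriorAlgebra

variable {W : Type*} [AddCommGroup W] [Module ℝ W]

/-! Write `X_f = Π^♯ df`. On tuples consisting of horizontal fields and of sections of `𝕍`, the
Leibniz rule for `Ω = σ^l ∧ τ_γ` splits the divergence of `X_f` into a contribution of `σ^l` and one
of `τ_γ` (`lieDerivApply_volume`).

Both halves of the theorem rest on one consequence of the Jacobi identity. The identity is stated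
for functions, but its Koszul form is linear over functions, so it holds for arbitrary one-forms
(`IsPoisson.koszul_eq_zero`). Applied to conormal `α`, `β` and arbitrary `η`, it says that `L_{Π^♯
η} σ = -dη` on horizontal fields (`differential_couplingFlat`).

Components of `Z`. For `η = df` the right side vanishes, so `σ^l` contributes nothing to the
divergence of `X_f`. For `τ_γ`, split `df` into a conormal part `β` and the part `df ∘ γ`. The field
`Π^♯ β` is horizontal, is annihilated by `τ_γ`, and has divergence `θ(Π^♯ β) = θ(Π^♯ df) = -df(Π^♯
θ)`. The field `Π^♯(df ∘ γ)` is `P^♯` of the leafwise differential of `f`; its leafwise divergence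
is `W(f)` for a section `W` of `𝕍`. Hence `Z = -Π^♯ θ + W`.

It remains to see that `W` exists and equals `Z_P^τ`. For a local frame `v_j` of `𝕍` with dual
coframe `ε_j`, put `c_j = P^♯ ε_j`; then `P = (1/2) ∑ v_j ∧ c_j`. Because of the skew form of this
expression, the second derivatives of `f` in the divergence of `P^♯ df` combine into brackets, which
gives `W = (1/2) ∑ (div(c_j) v_j - div(v_j) c_j + [c_j, v_j])` (`leafDivergence_sharpSection`). By
Cartan's formula and the vanishing of `d τ_γ` on the leaves, this is the field occurring in `-d_𝒱
i_P τ` (`extD_insertField_insertField`).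

Curvature identity. Let `η` vanish on `ℍ` and equal `a ∘ γ` at `x`. On horizontal fields `dη(X, Y) =
-η([X, Y])`, so `L_{Π^♯ η} σ` is the two-form `A = a ∘ R^γ`. Write `A = σ(T ·, ·)`, where `T = -Π^♯
A^♭`. This `T` is self-adjoint for `σ`, so `A` is the effect on `σ` of the derivation `(1/2) T`, and
on the top power `σ^l` it acts as multiplication by `(1/2) tr T`. Since `Π^♯ η` is vertical, the
same factor is `Λ(Π^♯ η)`. But `(1/2) tr T` is minus the contraction of `A` with `Π_H`, and `Λ(Π^♯
η) = -a(P^♯ Λ)` by skew-symmetry (`contract_curvature`).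

The forms `θ` and `Λ` exist and are unique because an alternating form of top degree on `𝕍`,
respectively `ℍ`, is a multiple of `τ`, respectively `σ^l`. For `σ^l` this uses nondegeneracy of `σ`
on `ℍ`, which also forces the rank of `ℍ` to be even. -/

theorem wedge_apply {p q : ℕ} (a : AltForm W p) (b : AltForm W q) (v : Fin (p + q) → W) :
    wedge a b v = LinearMap.mul' ℝ ℝ (a.domCoprod b (v ∘ finSumFinEquiv)) := rfl

/-- Alternating `a ⊗ b` over all permutations counts every shuffle `p! q!` times. Sums over the
whole symmetric group can be reindexed freely, so the later wedge formulas are derived in this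
unnormalized form and the factorials are divided out. -/
theorem factorial_mul_wedge_apply {p q : ℕ} (a : AltForm W p) (b : AltForm W q)
    (v : Fin (p + q) → W) :
    ((p.factorial * q.factorial : ℕ) : ℝ) * wedge a b v =
      ∑ π : Equiv.Perm (Fin (p + q)), ((Equiv.Perm.sign π : ℤ) : ℝ) *
        (a (fun i => v (π (Fin.castAdd q i))) * b (fun i => v (π (Fin.natAdd p i)))) := by
  have h := congrArg (fun f => LinearMap.mul' ℝ ℝ (f (v ∘ finSumFinEquiv)))
    (MultilinearMap.domCoprod_alternization_eq a b)
  simp only [Fintype.card_fin, AlternatingMap.smul_apply, map_nsmul] at h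
  rw [wedge_apply, ← nsmul_eq_mul, ← h, MultilinearMap.alternatization_apply, map_sum]
  refine Fintype.sum_equiv finSumFinEquiv.permCongr _ _ fun π => ?_
  rcases Int.units_eq_one_or (Equiv.Perm.sign π) with h | h <;> simp [h]

/-- Only the trivial shuffle contributes to `a ∧ b` on `(u, w)` if `a` is killed by the `w j`. -/
theorem wedge_append_of_left {p q : ℕ} (a : AltForm W p) (b : AltForm W q) (u : Fin p → W)
    (w : Fin q → W) (h : ∀ (x : Fin p → W) i j, x i = w j → a x = 0) :
    wedge a b (Fin.append u w) = a u * b w := by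
  rw [wedge_apply, AlternatingMap.domCoprod_apply, sum_apply, map_sum]
  refine (Finset.sum_eq_single (Quotient.mk'' 1) ?_ ?_).trans ?_
  · intro σ _ hσ
    induction σ using Quotient.inductionOn' with
    | h σ =>
    -- A permutation preserving the left block is a product of block permutations and represents the
    -- trivial class. Any other class moves some left slot into the right block, so that `a`
    -- receives one of the `w j`.
    have : ¬ Set.MapsTo σ (Set.range (Sum.inl : Fin p → Fin p ⊕ Fin q)) (Set.range Sum.inl) := by
      intro hm
      apply hσ
      have := Equiv.Perm.mem_sumCongrHom_range_of_perm_mapsTo_inl hm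
      refine Quotient.sound' ?_
      rw [QuotientGroup.leftRel_apply]
      simpa using this
    simp only [Set.MapsTo, not_forall] at this
    obtain ⟨_, ⟨i, rfl⟩, hi⟩ := this
    obtain ⟨j, hj⟩ : ∃ j, σ (Sum.inl i) = Sum.inr j := by
      cases hx : σ (Sum.inl i) with
      | inl y => exact absurd ⟨y, hx.symm⟩ hi
      | inr y => exact ⟨y, rfl⟩
    simp only [AlternatingMap.domCoprod.summand_mk'', _root_.smul_apply,
      MultilinearMap.domDomCongr_apply, MultilinearMap.domCoprod_apply,
      AlternatingMap.coe_multilinearMap]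
    rw [h _ i j (by simp [hj])]
    simp
  · simp
  · simp [AlternatingMap.domCoprod.summand_mk'']

/-- Mirror image of `wedge_append_of_left`: a permutation that does not preserve the left block does
not preserve the right one either, so `b` receives one of the `u j`. -/
theorem wedge_append_of_right {p q : ℕ} (a : AltForm W p) (b : AltForm W q) (u : Fin p → W)
    (w : Fin q → W) (h : ∀ (x : Fin q → W) i j, x i = u j → b x = 0) :
    wedge a b (Fin.append u w) = a u * b w := by
  rw [wedge_apply, AlternatingMap.domCoprod_apply, sum_apply, map_sum]
  refine (Finset.sum_eq_single (Quotient.mk'' 1) ?_ ?_).trans ?_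
  · intro σ _ hσ
    induction σ using Quotient.inductionOn' with
    | h σ =>
    have : ¬ Set.MapsTo σ (Set.range (Sum.inl : Fin p → Fin p ⊕ Fin q)) (Set.range Sum.inl) := by
      intro hm
      apply hσ
      have := Equiv.Perm.mem_sumCongrHom_range_of_perm_mapsTo_inl hm
      refine Quotient.sound' ?_
      rw [QuotientGroup.leftRel_apply]
      simpa using this
    rw [Equiv.Perm.perm_mapsTo_inl_iff_mapsTo_inr] at this
    simp only [Set.MapsTo, not_forall] at this
    obtain ⟨_, ⟨i, rfl⟩, hi⟩ := this
    obtain ⟨j, hj⟩ : ∃ j, σ (Sum.inr i) = Sum.inl j := by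
      cases hx : σ (Sum.inr i) with
      | inr y => exact absurd ⟨y, hx.symm⟩ hi
      | inl y => exact ⟨y, rfl⟩
    simp only [AlternatingMap.domCoprod.summand_mk'', _root_.smul_apply,
      MultilinearMap.domDomCongr_apply, MultilinearMap.domCoprod_apply,
      AlternatingMap.coe_multilinearMap]
    rw [h _ i j (by simp [hj])]
    simp
  · simp
  · simp [AlternatingMap.domCoprod.summand_mk'']

/-- Expansion of a sum over the permutations of `Fin (n + 1)` along the value at `0`. -/
theorem sum_perm_succ {N : Type*} [AddCommMonoid N] {n : ℕ}
    (f : Equiv.Perm (Fin (n + 1)) → N) :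
    ∑ π, f π = ∑ p : Fin (n + 1), ∑ e : Equiv.Perm (Fin n),
      f (p.cycleRange⁻¹ * Equiv.Perm.decomposeFin.symm (0, e)) := by
  rw [← Finset.sum_product', Finset.univ_product_univ]
  symm
  refine Fintype.sum_bijective
    (fun x : Fin (n + 1) × Equiv.Perm (Fin n) =>
      x.1.cycleRange⁻¹ * Equiv.Perm.decomposeFin.symm (0, x.2)) ?_ _ _ fun _ => rfl
  -- The value at `0` of the product is `p`, which gives injectivity; surjectivity is the count `(n
  -- + 1)! = (n + 1) * n!`.
  rw [Fintype.bijective_iff_injective_and_card]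
  refine ⟨?_, ?_⟩
  · rintro ⟨p, e⟩ ⟨p', e'⟩ h
    have h0 := congrArg (fun σ : Equiv.Perm (Fin (n + 1)) => σ 0) h
    simp only [Equiv.Perm.mul_apply, Equiv.Perm.decomposeFin_symm_apply_zero] at h0
    have hp : p = p' := by
      have : ∀ q : Fin (n + 1), (q.cycleRange⁻¹ : Equiv.Perm _) 0 = q := fun q => by
        rw [Equiv.Perm.inv_eq_iff_eq]; simp
      rwa [this, this] at h0
    subst hp
    simpa using h
  · simp [Fintype.card_perm, Nat.factorial_succ]

/-- Alternatization along the first argument first. -/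
theorem sum_sign_mul_cons {W : Type*} {n : ℕ} (f : W → (Fin n → W) → ℝ) (v : Fin (n + 1) → W) :
    ∑ π : Equiv.Perm (Fin (n + 1)), ((Equiv.Perm.sign π : ℤ) : ℝ) *
        f (v (π 0)) (fun i => v (π i.succ)) =
      ∑ p : Fin (n + 1), (-1 : ℝ) ^ (p : ℕ) * ∑ e : Equiv.Perm (Fin n),
        ((Equiv.Perm.sign e : ℤ) : ℝ) * f (v p) (fun i => v (p.succAbove (e i))) := by
  rw [sum_perm_succ]
  refine Finset.sum_congr rfl fun p _ => ?_
  rw [Finset.mul_sum]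
  refine Finset.sum_congr rfl fun e _ => ?_
  have h1 : (p.cycleRange⁻¹ : Equiv.Perm _) 0 = p := by
    rw [Equiv.Perm.inv_eq_iff_eq]; simp
  have h2 : ∀ i : Fin n, (p.cycleRange⁻¹ : Equiv.Perm _) i.succ = p.succAbove i := fun i => by
    rw [Equiv.Perm.inv_eq_iff_eq]; simp
  simp [Equiv.Perm.mul_apply, h1, h2, mul_assoc, Equiv.Perm.decomposeFin.symm_sign]

theorem sum_sign_mul_apply {n : ℕ} (a : AltForm W n) (v : Fin n → W) :
    ∑ e : Equiv.Perm (Fin n), ((Equiv.Perm.sign e : ℤ) : ℝ) * a (fun i => v (e i)) =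
      n.factorial * a v := by
  have : ∀ e : Equiv.Perm (Fin n), ((Equiv.Perm.sign e : ℤ) : ℝ) * a (fun i => v (e i)) = a v := by
    intro e
    have := a.map_perm v e
    rw [show (fun i => v (e i)) = v ∘ e from rfl, this]
    rcases Int.units_eq_one_or (Equiv.Perm.sign e) with h | h <;> simp [h]
  simp [this, Fintype.card_perm]

/-- The wedge product of a covector and a form is given by the expansion along the covector. -/
theorem wedgeCovector_apply {k : ℕ} (α : Module.Dual ℝ W) (η : AltForm W k)
    (v : Fin (k + 1) → W) :
    wedgeCovector α η v = ∑ i : Fin (k + 1), (-1 : ℝ) ^ (i : ℕ) * (α (v i) * η (fun j => v (i.succAbove j))) := by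
  have h := factorial_mul_wedge_apply (AlternatingMap.ofSubsingleton ℝ W ℝ (0 : Fin 1) α) η
    (fun i => v (finCongr (Nat.add_comm 1 k) i))
  have hk : (k.factorial : ℝ) ≠ 0 := by exact_mod_cast k.factorial_ne_zero
  have h' : (k.factorial : ℝ) * wedgeCovector α η v =
      ∑ π : Equiv.Perm (Fin (k + 1)), ((Equiv.Perm.sign π : ℤ) : ℝ) *
        (α (v (π 0)) * η (fun i => v (π i.succ))) := by
    rw [wedgeCovector, AlternatingMap.domDomCongr_apply]
    simp only [Nat.factorial_one, one_mul] at h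
    rw [show (v ∘ finCongr (Nat.add_comm 1 k)) =
      fun i => v (finCongr (Nat.add_comm 1 k) i) from rfl, h]
    refine Fintype.sum_equiv (finCongr (Nat.add_comm 1 k)).permCongr _ _ fun π => ?_
    rw [Equiv.Perm.sign_permCongr]
    congr 2
    congr 1
    funext i
    simp only [Equiv.permCongr_apply]
    congr 3
    ext
    simp
    omega
  rw [sum_sign_mul_cons (fun x w => α x * η w)] at h'
  refine mul_left_cancel₀ hk (h'.trans ?_)
  rw [Finset.mul_sum]
  refine Finset.sum_congr rfl fun p _ => ?_
  have := sum_sign_mul_apply η (fun i => v (p.succAbove i))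
  have h2 : ∀ e : Equiv.Perm (Fin k), ((Equiv.Perm.sign e : ℤ) : ℝ) *
      (α (v p) * η (fun i => v (p.succAbove (e i)))) = α (v p) *
      (((Equiv.Perm.sign e : ℤ) : ℝ) * η (fun i => v (p.succAbove (e i)))) := fun e => by ring
  simp only [h2, ← Finset.mul_sum, this]
  ring

end ExteriorAlgebra

end CouplingPoisson

end

noncomputable section

namespace CouplingPoisson

/-! ### Powers of two-forms and nondegeneracy -/

section TwoForms

variable {W : Type*} [AddCommGroup W] [Module ℝ W]

/-- The permutation sum is expanded along the two arguments of `s`, one after the other. Each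
unordered pair of arguments occurs in both orders, hence the factor `1 / 2`. -/
theorem wedge_twoForm_apply {p : ℕ} (a : AltForm W p) (s : AltForm W 2) (v : Fin (p + 2) → W) :
    wedge a s v = (1 / 2 : ℝ) * ∑ i : Fin (p + 2), ∑ j : Fin (p + 1),
      (-1 : ℝ) ^ (i : ℕ) * (-1 : ℝ) ^ (j : ℕ) * (s ![v i, v (i.succAbove j)] *
        a (fun l => v (i.succAbove (j.succAbove l)))) := by
  have h := factorial_mul_wedge_apply a s v
  have hp : (p.factorial : ℝ) ≠ 0 := by exact_mod_cast p.factorial_ne_zero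
  have h' : (p.factorial : ℝ) * 2 * wedge a s v =
      ∑ π : Equiv.Perm (Fin (p + 1 + 1)), ((Equiv.Perm.sign π : ℤ) : ℝ) *
        (s ![v (π 0), v (π (Fin.succ 0))] * a (fun i => v (π i.succ.succ))) := by
    have e2 : ((p.factorial * Nat.factorial 2 : ℕ) : ℝ) = (p.factorial : ℝ) * 2 := by
      norm_num [Nat.factorial]
    rw [← e2, h]
    -- The slots of `s` are the last two. Two rotations bring them to the front, and a square of a
    -- permutation is even, so no sign appears.
    refine Fintype.sum_equiv (Equiv.mulRight ((finRotate (p + 1 + 1)) ^ 2)⁻¹) _ _ fun π => ?_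
    have hR : ∀ i, ((finRotate (p + 1 + 1)) ^ 2) i = i + 1 + 1 := fun i => by
      simp [pow_two]
    have hR' : ∀ i k, i + 1 + 1 = k → ((finRotate (p + 1 + 1)) ^ 2)⁻¹ k = i := fun i k hk => by
      rw [Equiv.Perm.inv_eq_iff_eq, hR, hk]
    have hs : Equiv.Perm.sign (π * ((finRotate (p + 1 + 1)) ^ 2)⁻¹) = Equiv.Perm.sign π := by
      rw [Equiv.Perm.sign_mul, Equiv.Perm.sign_inv, map_pow, Int.units_sq, mul_one]
    rw [Equiv.coe_mulRight, hs]
    congr 1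
    rw [mul_comm]
    have v0 : ((finRotate (p + 1 + 1)) ^ 2)⁻¹ 0 = Fin.natAdd p (0 : Fin 2) :=
      hR' _ _ (by ext; simp [Fin.val_add])
    have v1 : ((finRotate (p + 1 + 1)) ^ 2)⁻¹ (Fin.succ 0) = Fin.natAdd p (1 : Fin 2) :=
      hR' _ _ (by
        ext
        simp only [Fin.val_add, Fin.natAdd, Fin.val_one, Fin.val_succ, Fin.val_zero, Nat.mod_add_mod]
        rw [show p + 1 + 1 + 1 = 1 + (p + 1 + 1) by ring, Nat.add_mod_right, Nat.mod_eq_of_lt]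
        omega)
    have v2 : ∀ i : Fin p, ((finRotate (p + 1 + 1)) ^ 2)⁻¹ i.succ.succ = Fin.castAdd 2 i :=
      fun i => hR' _ _ (by
        ext
        simp only [Fin.val_add, Fin.val_castAdd, Fin.val_one, Fin.val_succ, Nat.mod_add_mod]
        rw [Nat.mod_eq_of_lt]
        omega)
    congr 1
    · congr 1
      funext i
      fin_cases i
      · simp [Equiv.Perm.mul_apply, v0]
      · simp only [Equiv.Perm.mul_apply, v1]
        rfl
    · simp only [Equiv.Perm.mul_apply, v2]
  rw [sum_sign_mul_cons (fun x w => s ![x, w 0] * a (fun i => w i.succ))] at h'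
  have h2 : ∀ i : Fin (p + 1 + 1), ∑ e : Equiv.Perm (Fin (p + 1)),
      ((Equiv.Perm.sign e : ℤ) : ℝ) * (s ![v i, v (i.succAbove (e 0))] *
        a (fun l => v (i.succAbove (e l.succ)))) =
      ∑ j : Fin (p + 1), (-1 : ℝ) ^ (j : ℕ) * (s ![v i, v (i.succAbove j)] *
        (p.factorial * a (fun l => v (i.succAbove (j.succAbove l))))) := by
    intro i
    rw [sum_sign_mul_cons (v := fun j => v (i.succAbove j)) (fun y w => s ![v i, y] * a w)]
    refine Finset.sum_congr rfl fun j _ => ?_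
    rw [← sum_sign_mul_apply a (fun l => v (i.succAbove (j.succAbove l))), Finset.mul_sum,
      Finset.mul_sum, Finset.mul_sum]
    exact Finset.sum_congr rfl fun e _ => by ring
  simp only [h2] at h'
  refine mul_left_cancel₀ (mul_ne_zero hp two_ne_zero) (h'.trans ?_)
  simp only [Finset.mul_sum]
  exact Finset.sum_congr rfl fun i _ => Finset.sum_congr rfl fun j _ => by ring

theorem twoForm_swap (s : AltForm W 2) (x y : W) : s ![x, y] = - s ![y, x] := by
  have h := s.map_swap ![y, x] (i := 0) (j := 1) (by decide)
  rw [← h]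
  congr 1
  funext i
  fin_cases i <;> simp

theorem twoForm_add (s : AltForm W 2) (x y z : W) : s ![x, y + z] = s ![x, y] + s ![x, z] := by
  rw [twoForm_swap, twoForm_swap s x y, twoForm_swap s x z, ← neg_add]
  congr 1
  simpa using s.map_vecCons_add ![x] y z

theorem twoForm_smul (s : AltForm W 2) (x : W) (c : ℝ) (y : W) :
    s ![x, c • y] = c * s ![x, y] := by
  rw [twoForm_swap, twoForm_swap s x y, mul_neg]
  congr 1
  simpa using s.map_vecCons_smul ![x] c y

/-- The linear form `s(x, ·)`. -/
def twoFormFlat (s : AltForm W 2) (x : W) : Module.Dual ℝ W where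
  toFun y := s ![x, y]
  map_add' := twoForm_add s x
  map_smul' := twoForm_smul s x

/-- Splitting off a hyperbolic pair from a power of a two-form. -/
theorem wedgePow_cons_cons (s : AltForm W 2) {e f : W} (hef : s ![e, f] = 1) (l : ℕ) :
    ∀ u : Fin (2 * l) → W, (∀ i, s ![e, u i] = 0) → (∀ i, s ![f, u i] = 0) →
      wedgePow s (l + 1) (Matrix.vecCons e (Matrix.vecCons f u)) = (l + 1) * wedgePow s l u := by
  have hfe : s ![f, e] = -1 := by rw [twoForm_swap, hef]
  induction l with
  | zero =>
    intro u _ _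
    refine (wedge_twoForm_apply (wedgePow s 0) s _).trans ?_
    simp [Fin.sum_univ_succ, hef, hfe, wedgePow]
    norm_num
  | succ l ih =>
    intro u hu hu'
    have hue : ∀ i, s ![u i, e] = 0 := fun i => by rw [twoForm_swap, hu, neg_zero]
    have huf : ∀ i, s ![u i, f] = 0 := fun i => by rw [twoForm_swap, hu', neg_zero]
    have key : wedgePow s (l + 1) u = (1 / 2 : ℝ) * ∑ i : Fin (2 * l + 2), ∑ j : Fin (2 * l + 1),
        (-1 : ℝ) ^ (i : ℕ) * (-1 : ℝ) ^ (j : ℕ) * (s ![u i, u (i.succAbove j)] *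
          wedgePow s l (fun l => u (i.succAbove (j.succAbove l)))) := by
      exact wedge_twoForm_apply _ _ _
    have split : ∀ g : Fin (2 * l + 2 + 1 + 1) → ℝ,
        ∑ i, g i = g 0 + (g (Fin.succ 0) + ∑ i : Fin (2 * l + 1 + 1), g i.succ.succ) := fun g => by
      rw [Fin.sum_univ_succ, Fin.sum_univ_succ]
    -- The expansion is sorted by the first argument of `s`. If it is `e` or `f`, the partner must
    -- be the other of the two, and `s^(l+1)` on `u` remains (`t0`, `t1`). If it belongs to `u`, so
    -- does its partner, and `ih` splits the pair off the other factor (`t2`). The total is `(1/2)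
    -- (2 + 2 (l + 1)) = l + 2` times `s^(l+1)` on `u`.
    have t0 : ∑ j : Fin (2 * l + 1 + 1 + 1), (-1 : ℝ) ^ ((0 : Fin (2 * l + 2 + 1 + 1)) : ℕ) *
        (-1 : ℝ) ^ (j : ℕ) *
        (s ![(Matrix.vecCons e (Matrix.vecCons f u)) 0,
          (Matrix.vecCons e (Matrix.vecCons f u)) (Fin.succAbove 0 j)] *
          wedgePow s (l + 1) (fun i =>
            (Matrix.vecCons e (Matrix.vecCons f u)) (Fin.succAbove 0 (j.succAbove i)))) =
        wedgePow s (l + 1) u := by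
      rw [Fin.sum_univ_succ]
      simp [hu, hef]
    have t1 : ∑ j : Fin (2 * l + 1 + 1 + 1),
        (-1 : ℝ) ^ ((Fin.succ 0 : Fin (2 * l + 2 + 1 + 1)) : ℕ) * (-1 : ℝ) ^ (j : ℕ) *
        (s ![(Matrix.vecCons e (Matrix.vecCons f u)) (Fin.succ 0),
          (Matrix.vecCons e (Matrix.vecCons f u)) (Fin.succAbove (Fin.succ 0) j)] *
          wedgePow s (l + 1) (fun i =>
            (Matrix.vecCons e (Matrix.vecCons f u))
              (Fin.succAbove (Fin.succ 0) (j.succAbove i)))) =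
        wedgePow s (l + 1) u := by
      rw [Fin.sum_univ_succ]
      have : ∀ i : Fin (2 * l + 1 + 1), Fin.succAbove (Fin.succ 0) i.succ = i.succ.succ := by
        intro i; simp
      simp [hu', hfe]
    have t2 : ∀ i : Fin (2 * l + 1 + 1), ∑ j : Fin (2 * l + 1 + 1 + 1),
        (-1 : ℝ) ^ ((i.succ.succ : Fin (2 * l + 2 + 1 + 1)) : ℕ) * (-1 : ℝ) ^ (j : ℕ) *
        (s ![(Matrix.vecCons e (Matrix.vecCons f u)) i.succ.succ,
          (Matrix.vecCons e (Matrix.vecCons f u)) (Fin.succAbove i.succ.succ j)] *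
          wedgePow s (l + 1) (fun r =>
            (Matrix.vecCons e (Matrix.vecCons f u))
              (Fin.succAbove i.succ.succ (j.succAbove r)))) =
        (l + 1) * ∑ j : Fin (2 * l + 1), (-1 : ℝ) ^ (i : ℕ) * (-1 : ℝ) ^ (j : ℕ) *
          (s ![u i, u (i.succAbove j)] *
          wedgePow s l (fun l => u (i.succAbove (j.succAbove l)))) := by
      intro i
      rw [Fin.sum_univ_succ, Fin.sum_univ_succ, Finset.mul_sum]
      have z0 : Fin.succAbove i.succ.succ (0 : Fin (2 * l + 1 + 1 + 1)) = 0 := rfl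
      have z1 : Fin.succAbove i.succ.succ (Fin.succ 0 : Fin (2 * l + 1 + 1 + 1)) = Fin.succ 0 := rfl
      simp only [z0, z1, Matrix.cons_val_succ, Matrix.cons_val_zero, hue, huf, zero_mul, mul_zero,
        zero_add]
      refine Finset.sum_congr rfl fun j _ => ?_
      have hc : (fun r : Fin (2 * l + 1 + 1) => (Matrix.vecCons e (Matrix.vecCons f u))
              (Fin.succAbove i.succ.succ (j.succ.succ.succAbove r))) =
            Matrix.vecCons e (Matrix.vecCons f fun r => u (i.succAbove (j.succAbove r))) := by
        funext r
        refine Fin.cases ?_ (fun r => ?_) r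
        · rfl
        refine Fin.cases ?_ (fun r => ?_) r
        · rfl
        simp
      have hd : (Matrix.vecCons e (Matrix.vecCons f u)) (Fin.succAbove i.succ.succ j.succ.succ) =
          u (i.succAbove j) := by simp
      rw [hd]
      refine (congrArg (fun r => _ * (_ * r)) ((congrArg (wedgePow s (l + 1)) hc).trans
        (ih _ (fun _ => hu _) (fun _ => hu' _)))).trans ?_
      simp only [Fin.val_succ, pow_succ]
      ring
    refine (wedge_twoForm_apply (wedgePow s (l + 1)) s _).trans ?_
    refine (congrArg (fun r => (1 / 2 : ℝ) * r) ((split _).trans (congrArg₂ (· + ·) t0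
      (congrArg₂ (· + ·) t1 (Finset.sum_congr rfl fun i _ => t2 i))))).trans ?_
    rw [← Finset.mul_sum]
    push_cast
    linear_combination (-(l + 1 : ℝ)) * key

/-- A two-form which is nondegenerate on `U` has `dim U` even and its top power nonzero on `U`. -/
theorem exists_wedgePow_ne_zero [FiniteDimensional ℝ W] (s : AltForm W 2) (n : ℕ) :
    ∀ U : Submodule ℝ W, Module.finrank ℝ U = n →
      (∀ u ∈ U, (∀ w ∈ U, s ![u, w] = 0) → u = 0) →
      ∃ l, n = 2 * l ∧ ∃ u : Fin (2 * l) → W, (∀ i, u i ∈ U) ∧ wedgePow s l u ≠ 0 := by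
  induction n using Nat.strong_induction_on with
  | _ n ih =>
    intro U hn hU
    rcases Nat.eq_zero_or_pos n with rfl | hpos
    · exact ⟨0, rfl, Fin.elim0, fun i => i.elim0, by simp [wedgePow]⟩
    obtain ⟨e, heU, he⟩ : ∃ e ∈ U, e ≠ 0 := by
      by_contra! h
      have : U = ⊥ := (Submodule.eq_bot_iff U).2 h
      rw [this, finrank_bot] at hn
      omega
    obtain ⟨f₀, hfU₀, hf₀⟩ : ∃ f ∈ U, s ![e, f] ≠ 0 := by
      by_contra! h
      exact he (hU e heU h)
    set f := (s ![e, f₀])⁻¹ • f₀ with hf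
    have hfU : f ∈ U := U.smul_mem _ hfU₀
    have hef : s ![e, f] = 1 := by rw [hf, twoForm_smul, inv_mul_cancel₀ hf₀]
    clear_value f
    have hfe : s ![f, e] = -1 := by rw [twoForm_swap, hef]
    have hee : s ![e, e] = 0 := s.map_eq_zero_of_eq _ (i := 0) (j := 1) rfl (by decide)
    have hff : s ![f, f] = 0 := s.map_eq_zero_of_eq _ (i := 0) (j := 1) rfl (by decide)
    -- The kernel of `T` is the `s`-orthogonal complement in `U` of the hyperbolic pair `e`, `f`; it
    -- has dimension `n - 2` and carries the induction.
    let T : U →ₗ[ℝ] ℝ × ℝ :=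
      ((twoFormFlat s e).prod (twoFormFlat s f)) ∘ₗ U.subtype
    have hT : ∀ u : U, T u = (s ![e, u], s ![f, u]) := fun _ => rfl
    have hsurj : LinearMap.range T = ⊤ := by
      rw [LinearMap.range_eq_top]
      rintro ⟨a, b⟩
      refine ⟨a • ⟨f, hfU⟩ + (-b) • ⟨e, heU⟩, ?_⟩
      rw [map_add, map_smul, map_smul, hT, hT]
      simp [hef, hfe, hee, hff]
    have hdim : Module.finrank ℝ (LinearMap.ker T) + 2 = n := by
      have := T.finrank_range_add_finrank_ker
      rw [hsurj, finrank_top] at this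
      simp at this
      omega
    set U' := (LinearMap.ker T).map U.subtype with hU'
    have hdim' : Module.finrank ℝ U' + 2 = n := by
      rw [hU', ← (Submodule.equivMapOfInjective _ U.subtype_injective _).finrank_eq]
      exact hdim
    have hmem : ∀ u, u ∈ U' ↔ u ∈ U ∧ s ![e, u] = 0 ∧ s ![f, u] = 0 := by
      intro u
      simp only [hU', Submodule.mem_map, LinearMap.mem_ker, Submodule.coe_subtype, Subtype.exists,
        hT, Prod.mk_eq_zero]
      constructor
      · rintro ⟨a, ha, h, rfl⟩
        exact ⟨ha, h⟩
      · rintro ⟨ha, h⟩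
        exact ⟨u, ha, h, rfl⟩
    obtain ⟨l, hl, u, huU, hu⟩ := ih (Module.finrank ℝ U') (by omega) U' rfl (by
      intro u hu huw
      obtain ⟨huU, hue, huf⟩ := (hmem u).1 hu
      refine hU u huU fun w hw => ?_
      -- The projection of `w` to the complement of the pair. As `u` is orthogonal to `e` and `f`,
      -- it pairs with `w` as with this projection, so nondegeneracy passes to `U'`.
      have hw' : w + (-s ![e, w]) • f + s ![f, w] • e ∈ U' := by
        refine (hmem _).2 ⟨U.add_mem (U.add_mem hw (U.smul_mem _ hfU)) (U.smul_mem _ heU), ?_, ?_⟩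
        · simp only [twoForm_add, twoForm_smul, hef, hee]; ring
        · simp only [twoForm_add, twoForm_smul, hff, hfe]; ring
      have := huw _ hw'
      rw [twoForm_add, twoForm_add, twoForm_smul, twoForm_smul, twoForm_swap s u f, huf,
        twoForm_swap s u e, hue] at this
      simpa using this)
    refine ⟨l + 1, by omega, Matrix.vecCons e (Matrix.vecCons f u), ?_, ?_⟩
    · intro i
      refine Fin.cases heU (fun i => ?_) i
      refine Fin.cases hfU (fun i => ?_) i
      exact ((hmem _).1 (huU i)).1
    · rw [wedgePow_cons_cons s hef l u (fun i => ((hmem _).1 (huU i)).2.1)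
        (fun i => ((hmem _).1 (huU i)).2.2)]
      exact mul_ne_zero (by positivity) hu

end TwoForms

end CouplingPoisson

end

noncomputable section

namespace CouplingPoisson

/-! ### Top-degree forms and bidegree components -/

section Multilinear

variable {W : Type*} [AddCommGroup W] [Module ℝ W]

theorem map_update_sum_smul {m : ℕ} (ζ : AltForm W m) (v : Fin m → W) (i : Fin m)
    (c : Fin m → ℝ) : ζ (Function.update v i (∑ j, c j • v j)) = c i * ζ v := by
  rw [AlternatingMap.map_update_sum, Finset.sum_eq_single i]
  · rw [AlternatingMap.map_update_smul, Function.update_eq_self, smul_eq_mul]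
  · intro j _ hj
    rw [AlternatingMap.map_update_smul, AlternatingMap.map_update_self _ _ hj.symm, smul_zero]
  · simp

/-- A top-degree form, evaluated on a basis in which one vector is replaced. -/
theorem map_update_basis {m : ℕ} (ζ : AltForm W m) (b : Module.Basis (Fin m) ℝ W) (i : Fin m)
    (u : W) : ζ (Function.update b i u) = b.repr u i * ζ b := by
  conv_lhs => rw [← b.sum_repr u]
  exact map_update_sum_smul ζ b i fun j => b.repr u j

/-- Replacing each basis vector in turn by `u`,
weighted by a linear form, gives the value of the linear form at `u`. -/
theorem sum_apply_mul_map_update {m : ℕ} (ζ : AltForm W m) (b : Module.Basis (Fin m) ℝ W)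
    (φ : Module.Dual ℝ W) (u : W) :
    ∑ i, φ (b i) * ζ (Function.update b i u) = φ u * ζ b := by
  simp only [map_update_basis]
  conv_rhs => rw [← b.sum_repr u, map_sum, Finset.sum_mul]
  exact Finset.sum_congr rfl fun i _ => by rw [map_smul, smul_eq_mul]; ring

theorem ne_zero_apply_basis {m : ℕ} (ζ : AltForm W m) (hζ : ζ ≠ 0)
    (b : Module.Basis (Fin m) ℝ W) : ζ b ≠ 0 := by
  intro h
  exact hζ ((AlternatingMap.map_basis_eq_zero_iff b ζ).1 h)

theorem ext_basis {m : ℕ} {ζ ζ' : AltForm W m} (b : Module.Basis (Fin m) ℝ W)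
    (h : ζ b = ζ' b) : ζ = ζ' := by
  rw [← sub_eq_zero, ← AlternatingMap.map_basis_eq_zero_iff b]
  simp [h]

/-- The derivation property of `∑ i, ζ(…, c i, …)` for wedge products, before normalization. -/
theorem factorial_mul_sum_wedge_update {p q : ℕ} (a : AltForm W p) (b : AltForm W q)
    (v c : Fin (p + q) → W) :
    ((p.factorial * q.factorial : ℕ) : ℝ) * ∑ i, wedge a b (Function.update v i (c i)) =
      ∑ π : Equiv.Perm (Fin (p + q)), ((Equiv.Perm.sign π : ℤ) : ℝ) *
        ((∑ j, a (Function.update (fun i => v (π (Fin.castAdd q i))) j (c (π (Fin.castAdd q j))))) *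
            b (fun i => v (π (Fin.natAdd p i))) +
          a (fun i => v (π (Fin.castAdd q i))) *
            ∑ j, b (Function.update (fun i => v (π (Fin.natAdd p i))) j (c (π (Fin.natAdd p j))))) := by
  rw [Finset.mul_sum]
  simp only [factorial_mul_wedge_apply]
  rw [Finset.sum_comm]
  refine Finset.sum_congr rfl fun π _ => ?_
  rw [← Finset.mul_sum]
  congr 1
  rw [← Equiv.sum_comp π, Fin.sum_univ_add, Finset.sum_mul, Finset.mul_sum]
  congr 1
  · refine Finset.sum_congr rfl fun j _ => ?_
    congr 2
    · funext i
      simp only [Function.update_apply, EmbeddingLike.apply_eq_iff_eq, Fin.castAdd_inj]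
    · funext i
      rw [Function.update_of_ne]
      intro h
      have := π.injective h
      simp [Fin.ext_iff] at this
      omega
  · refine Finset.sum_congr rfl fun j _ => ?_
    congr 2
    · funext i
      rw [Function.update_of_ne]
      intro h
      have := π.injective h
      simp [Fin.ext_iff] at this
      omega
    · funext i
      simp only [Function.update_apply, EmbeddingLike.apply_eq_iff_eq, Fin.natAdd_inj]

/-- The component with one slot along the image of `a` and the others along the image of `b`. -/
theorem splitComponent_one (a b : W →ₗ[ℝ] W) {m : ℕ} (η : AltForm W (m + 1)) (v : Fin (m + 1) → W) :
    splitComponent a b 1 η v = ∑ i : Fin (m + 1), (-1 : ℝ) ^ (i : ℕ) *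
      η (Matrix.vecCons (a (v i)) (fun j => b (v (i.succAbove j)))) := by
  classical
  have h0 : splitComponent a b 1 η v =
      ∑ S ∈ Finset.powersetCard 1 (Finset.univ : Finset (Fin (m + 1))),
        η (fun i => (if i ∈ S then a else b) (v i)) := by
    change (∑ S ∈ Finset.powersetCard 1 (Finset.univ : Finset (Fin (m + 1))),
      η.toMultilinearMap.compLinearMap (fun i => if i ∈ S then a else b)) v = _
    rw [sum_apply]
    rfl
  rw [h0, Finset.powersetCard_one, Finset.sum_map]
  refine Finset.sum_congr rfl fun i _ => ?_
  have h1 : (fun j => (if j ∈ ({i} : Finset (Fin (m + 1))) then a else b) (v j)) =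
      i.insertNth (a (v i)) (fun j => b (v (i.succAbove j))) := by
    funext j
    refine Fin.succAboveCases i ?_ (fun j => ?_) j
    · simp
    · simp
  refine (congrArg η h1).trans ?_
  rw [AlternatingMap.map_insertNth]
  simp

/-- Complementing the set of slots exchanges the two projections. The `(2l, 1)` component in the
definition of `Λ` thus becomes a component with one distinguished slot, like the `(1, k)` component
for `θ`. -/
theorem splitComponent_compl (a b : W →ₗ[ℝ] W) {m : ℕ} (η : AltForm W (m + 1)) :
    splitComponent a b m η = splitComponent b a 1 η := by
  classical
  ext v
  change (∑ S ∈ Finset.powersetCard m (Finset.univ : Finset (Fin (m + 1))),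
      η.toMultilinearMap.compLinearMap (fun i => if i ∈ S then a else b)) v =
    (∑ S ∈ Finset.powersetCard 1 (Finset.univ : Finset (Fin (m + 1))),
      η.toMultilinearMap.compLinearMap (fun i => if i ∈ S then b else a)) v
  congr 1
  refine Finset.sum_bij (fun S _ => Sᶜ) ?_ ?_ ?_ ?_
  · intro S hS
    rw [Finset.mem_powersetCard_univ] at hS ⊢
    rw [Finset.card_compl, hS, Fintype.card_fin]
    omega
  · intro S _ T _ h
    exact compl_injective h
  · intro T hT
    refine ⟨Tᶜ, ?_, compl_compl T⟩
    rw [Finset.mem_powersetCard_univ] at hT ⊢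
    rw [Finset.card_compl, hT, Fintype.card_fin]
    omega
  · intro S _
    congr 1
    funext i
    by_cases h : i ∈ S <;> simp [h]

/-- Characterization of the component with one slot along the image of `a`. -/
theorem splitComponent_one_eq_wedgeCovector (a b : W →ₗ[ℝ] W) {m : ℕ} (η : AltForm W (m + 1))
    (θ : Module.Dual ℝ W) (ζ : AltForm W m)
    (h : ∀ (u : W) (w : Fin m → W), η (Matrix.vecCons (a u) (fun j => b (w j))) = θ u * ζ w) :
    splitComponent a b 1 η = wedgeCovector θ ζ := by
  ext v
  rw [splitComponent_one, wedgeCovector_apply]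
  exact Finset.sum_congr rfl fun i _ => by rw [h]

end Multilinear

/-! ### Contraction with a bivector as a trace -/

section Contraction

variable {W : Type*} [AddCommGroup W] [Module ℝ W]

theorem bivector_swap (B : Bivector W) (α β : Module.Dual ℝ W) : B ![α, β] = - B ![β, α] :=
  twoForm_swap B α β

theorem bivector_self (B : Bivector W) (α : Module.Dual ℝ W) : B ![α, α] = 0 :=
  B.map_eq_zero_of_eq _ (i := 0) (j := 1) rfl (by decide)

variable [FiniteDimensional ℝ W]

theorem apply_contract {N : Type*} [AddCommGroup N] [Module ℝ N] (φ : N →ₗ[ℝ] ℝ)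
    (B : Bivector W) (F : W → W → N) :
    φ (contract B F) = contract B (fun u v => φ (F u v)) := by
  simp [contract, map_sum]

/-- The contraction of a bivector with a bilinear form is half of a trace. -/
theorem contract_eq_trace (B : Bivector W) (F : W →ₗ[ℝ] Module.Dual ℝ W) :
    contract B (fun u v => F u v) = (1 / 2 : ℝ) * LinearMap.trace ℝ W (sharp B ∘ₗ F) := by
  rw [contract, smul_eq_mul, LinearMap.trace_eq_matrix_trace ℝ (Module.finBasis ℝ W), Matrix.trace]
  congr 1
  rw [Finset.sum_comm]
  refine Finset.sum_congr rfl fun j _ => ?_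
  rw [Matrix.diag_apply, LinearMap.toMatrix_apply, LinearMap.comp_apply,
    ← Module.Basis.coord_apply, apply_sharp, bivector_swap]
  have h : F (Module.finBasis ℝ W j) =
      ∑ i, F (Module.finBasis ℝ W j) (Module.finBasis ℝ W i) • (Module.finBasis ℝ W).coord i := by
    refine (Module.finBasis ℝ W).ext fun i => ?_
    simp
  conv_rhs => rw [← apply_sharp, h, LinearMap.sum_apply]
  rw [← Finset.sum_neg_distrib]
  refine Finset.sum_congr rfl fun i _ => ?_
  rw [LinearMap.smul_apply, apply_sharp, bivector_swap]
  simp only [smul_eq_mul]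
  ring

/-- A trace does not depend on the basis, so the contraction, defined with a fixed arbitrary basis,
may be computed in a frame adapted to the splitting. The sign comes from the skew-symmetry of `B`.
-/
theorem contract_eq_sum {ι : Type*} [Fintype ι] [DecidableEq ι] (B : Bivector W)
    (F : W →ₗ[ℝ] Module.Dual ℝ W) (b : Module.Basis ι ℝ W) :
    contract B (fun u v => F u v) = - (1 / 2 : ℝ) * ∑ i, F (b i) (sharp B (b.coord i)) := by
  rw [contract_eq_trace, LinearMap.trace_eq_matrix_trace ℝ b, Matrix.trace, neg_mul, ← mul_neg,
    ← Finset.sum_neg_distrib]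
  congr 1
  refine Finset.sum_congr rfl fun j _ => ?_
  rw [Matrix.diag_apply, LinearMap.toMatrix_apply, LinearMap.comp_apply,
    ← Module.Basis.coord_apply, apply_sharp, apply_sharp, bivector_swap]

end Contraction

end CouplingPoisson

end

noncomputable section

namespace CouplingPoisson

/-! ### Smooth functions, vector fields and local extension -/

section SmoothObjects

open Filter Topology

variable {E : Type*} [NormedAddCommGroup E] [NormedSpace ℝ E]
  {M : Type*} [TopologicalSpace M] [ChartedSpace E M]

/-- Smoothness of a function at a point. -/
abbrev SmoothFunAt (E : Type*) {M : Type*} [NormedAddCommGroup E] [NormedSpace ℝ E]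
    [TopologicalSpace M] [ChartedSpace E M] (f : M → ℝ) (x : M) : Prop :=
  ContMDiffAt 𝓘(ℝ, E) 𝓘(ℝ, ℝ) ∞ f x

theorem SmoothFunAt.mdiff {f : M → ℝ} {x : M} (hf : SmoothFunAt E f x) :
    MDifferentiableAt 𝓘(ℝ, E) 𝓘(ℝ, ℝ) f x :=
  ContMDiffAt.mdifferentiableAt hf (by simp)

theorem IsSmoothFun.at {f : M → ℝ} (hf : IsSmoothFun E f) (x : M) : SmoothFunAt E f x :=
  ContMDiff.contMDiffAt hf

theorem IsSmoothFun.mul {f g : M → ℝ} (hf : IsSmoothFun E f) (hg : IsSmoothFun E g) :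
    IsSmoothFun E (fun x => f x * g x) := ContMDiff.mul hf hg

theorem IsSmoothFun.add {f g : M → ℝ} (hf : IsSmoothFun E f) (hg : IsSmoothFun E g) :
    IsSmoothFun E (fun x => f x + g x) := ContMDiff.add hf hg

theorem IsSmoothFun.sub {f g : M → ℝ} (hf : IsSmoothFun E f) (hg : IsSmoothFun E g) :
    IsSmoothFun E (fun x => f x - g x) := ContMDiff.sub hf hg

theorem IsSmoothFun.neg {f : M → ℝ} (hf : IsSmoothFun E f) :
    IsSmoothFun E (fun x => - f x) := ContMDiff.neg hf

theorem IsSmoothFun.const (c : ℝ) : IsSmoothFun E (fun _ : M => c) := contMDiff_const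

theorem IsSmoothFun.sum {ι : Type*} {s : Finset ι} {f : ι → M → ℝ}
    (hf : ∀ i ∈ s, IsSmoothFun E (f i)) : IsSmoothFun E (fun x => ∑ i ∈ s, f i x) :=
  ContMDiff.sum hf

theorem SmoothFunAt.mul {f g : M → ℝ} {x : M} (hf : SmoothFunAt E f x) (hg : SmoothFunAt E g x) :
    SmoothFunAt E (fun x => f x * g x) x := ContMDiffAt.mul hf hg

theorem SmoothFunAt.sum {ι : Type*} {s : Finset ι} {f : ι → M → ℝ} {x : M}
    (hf : ∀ i ∈ s, SmoothFunAt E (f i) x) : SmoothFunAt E (fun x => ∑ i ∈ s, f i x) x :=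
  ContMDiffAt.sum hf

theorem SmoothFunAt.inv {f : M → ℝ} {x : M} (hf : SmoothFunAt E f x) (hx : f x ≠ 0) :
    SmoothFunAt E (fun x => (f x)⁻¹) x := ContMDiffAt.inv₀ hf hx

theorem SmoothFunAt.congr {f g : M → ℝ} {x : M} (hf : SmoothFunAt E f x) (h : g =ᶠ[𝓝 x] f) :
    SmoothFunAt E g x := ContMDiffAt.congr_of_eventuallyEq hf h

theorem SmoothFunAt.continuousAt {f : M → ℝ} {x : M} (hf : SmoothFunAt E f x) :
    ContinuousAt f x := ContMDiffAt.continuousAt hf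

/-! #### The differential -/

theorem differential_congr {f g : M → ℝ} {x : M} (h : f =ᶠ[𝓝 x] g) :
    differential E f x = differential E g x := by
  simp only [differential, mvfderiv, h.mfderiv_eq]
  congr 2

theorem differential_mul {f g : M → ℝ} {x : M} (hf : SmoothFunAt E f x) (hg : SmoothFunAt E g x)
    (v : TangentSpace 𝓘(ℝ, E) x) : differential E (fun y => f y * g y) x v =
      f x * differential E g x v + g x * differential E f x v := by
  simp only [differential]
  rw [show (fun y => f y * g y) = f * g from rfl, mvfderiv_mul hf.mdiff hg.mdiff]
  rfl

theorem differential_add {f g : M → ℝ} {x : M} (hf : SmoothFunAt E f x) (hg : SmoothFunAt E g x)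
    (v : TangentSpace 𝓘(ℝ, E) x) : differential E (fun y => f y + g y) x v =
      differential E f x v + differential E g x v := by
  simp only [differential]
  rw [show (fun y => f y + g y) = f + g from rfl, mvfderiv_add hf.mdiff hg.mdiff]
  rfl

theorem differential_const (c : ℝ) (x : M) : differential E (fun _ : M => c) x = 0 := by
  simp only [differential]
  rw [mvfderiv_const]
  rfl

theorem differential_const_mul (c : ℝ) {f : M → ℝ} {x : M} (hf : SmoothFunAt E f x)
    (v : TangentSpace 𝓘(ℝ, E) x) :
    differential E (fun y => c * f y) x v = c * differential E f x v := by
  rw [differential_mul contMDiffAt_const hf, differential_const]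
  simp

theorem differential_neg {f : M → ℝ} {x : M} (hf : SmoothFunAt E f x)
    (v : TangentSpace 𝓘(ℝ, E) x) :
    differential E (fun y => - f y) x v = - differential E f x v := by
  have := differential_const_mul (-1) hf v
  simpa using this

theorem differential_sum {ι : Type*} (s : Finset ι) {f : ι → M → ℝ} {x : M}
    (hf : ∀ i ∈ s, SmoothFunAt E (f i) x) (v : TangentSpace 𝓘(ℝ, E) x) :
    differential E (fun y => ∑ i ∈ s, f i y) x v = ∑ i ∈ s, differential E (f i) x v := by
  classical
  induction s using Finset.induction_on with
  | empty => simp [differential_const]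
  | insert a s ha ih =>
    simp only [Finset.sum_insert ha]
    rw [differential_add (hf _ (Finset.mem_insert_self _ _))
      (SmoothFunAt.sum fun i hi => hf _ (Finset.mem_insert_of_mem hi)),
      ih fun i hi => hf _ (Finset.mem_insert_of_mem hi)]

theorem isSmoothFun_bump_mul {χ f : M → ℝ} (hχ : IsSmoothFun E χ)
    (hf : ∀ y ∈ tsupport χ, SmoothFunAt E f y) : IsSmoothFun E (fun y => χ y * f y) := by
  refine contMDiff_of_tsupport fun y hy => (hχ.at y).mul (hf y ?_)
  exact tsupport_mul_subset_left hy

variable [FiniteDimensional ℝ E] [IsManifold 𝓘(ℝ, E) ∞ M]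

/-- Smoothness of a vector field at a point. -/
abbrev SmoothVFieldAt (X : VField E M) (x : M) : Prop :=
  ContMDiffAt 𝓘(ℝ, E) 𝓘(ℝ, E).tangent ∞ (fun x => (⟨x, X x⟩ : TangentBundle 𝓘(ℝ, E) M)) x

theorem IsSmoothVField.at {X : VField E M} (hX : IsSmoothVField X) (x : M) : SmoothVFieldAt X x :=
  ContMDiff.contMDiffAt hX

theorem IsSmoothVField.add {X Y : VField E M} (hX : IsSmoothVField X) (hY : IsSmoothVField Y) :
    IsSmoothVField (fun x => X x + Y x) := ContMDiff.add_section hX hY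

theorem IsSmoothVField.neg {X : VField E M} (hX : IsSmoothVField X) :
    IsSmoothVField (fun x => - X x) := ContMDiff.neg_section hX

theorem IsSmoothVField.sub {X Y : VField E M} (hX : IsSmoothVField X) (hY : IsSmoothVField Y) :
    IsSmoothVField (fun x => X x - Y x) := ContMDiff.sub_section hX hY

theorem IsSmoothVField.smul {f : M → ℝ} {X : VField E M} (hf : IsSmoothFun E f)
    (hX : IsSmoothVField X) : IsSmoothVField (fun x => f x • X x) := ContMDiff.smul_section hf hX

theorem IsSmoothVField.sum {ι : Type*} {s : Finset ι} {X : ι → VField E M}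
    (hX : ∀ i ∈ s, IsSmoothVField (X i)) : IsSmoothVField (fun x => ∑ i ∈ s, X i x) :=
  ContMDiff.sum_section hX

theorem SmoothVFieldAt.congr {X Y : VField E M} {x : M} (hX : SmoothVFieldAt X x)
    (h : ∀ᶠ y in 𝓝 x, Y y = X y) : SmoothVFieldAt Y x :=
  ContMDiffAt.congr_of_eventuallyEq hX (h.mono fun y hy => by simp [hy])

theorem IsSmoothVField.mlieBracket {X Y : VField E M} (hX : IsSmoothVField X)
    (hY : IsSmoothVField Y) : IsSmoothVField (VectorField.mlieBracket 𝓘(ℝ, E) X Y) := by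
  intro x
  have : IsManifold 𝓘(ℝ, E) (minSmoothness ℝ 2) M := by
    rw [minSmoothness_of_isRCLikeNormedField]
    exact IsManifold.of_le (n := ∞) (WithTop.coe_le_coe.2 (le_top : (2 : ℕ∞) ≤ ⊤))
  have : IsManifold 𝓘(ℝ, E) (((⊤ : ℕ∞) : ℕ∞ω) + 1) M :=
    inferInstanceAs (IsManifold 𝓘(ℝ, E) ∞ M)
  exact ContMDiffAt.mlieBracket_vectorField (n := ⊤) (m := ⊤) (hX.at x) (hY.at x)
    (by rw [minSmoothness_of_isRCLikeNormedField]; rfl)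

/-- The derivative of a smooth function along a smooth vector field is smooth. -/
theorem SmoothFunAt.differential_apply {f : M → ℝ} {X : VField E M} {x : M}
    (hf : IsSmoothFun E f) (hX : SmoothVFieldAt X x) :
    SmoothFunAt E (fun y => differential E f y (X y)) x := by
  have h1 : ContMDiff 𝓘(ℝ, E).tangent 𝓘(ℝ, ℝ).tangent ∞ (tangentMap 𝓘(ℝ, E) 𝓘(ℝ, ℝ) f) :=
    ContMDiff.contMDiff_tangentMap hf (by simp)
  have h2 := (contMDiff_snd_tangentBundle_modelSpace ℝ 𝓘(ℝ, ℝ) (n := ∞)).comp h1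
  exact ContMDiffAt.comp x (h2.contMDiffAt) hX

theorem IsSmoothFun.differential_apply {f : M → ℝ} {X : VField E M}
    (hf : IsSmoothFun E f) (hX : IsSmoothVField X) :
    IsSmoothFun E (fun y => differential E f y (X y)) :=
  fun x => SmoothFunAt.differential_apply hf (hX.at x)

theorem IsSmoothFun.isSmoothCovectorField {f : M → ℝ} (hf : IsSmoothFun E f) :
    IsSmoothCovectorField (differential E f) :=
  fun _ hX => hf.differential_apply hX

variable [T2Space M]

/-- Smoothness of forms is tested on globally smooth fields, so every local construction has to be
cut off to a global one that agrees with it near `x`. -/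
theorem exists_bump {x : M} {U : Set M} (hU : U ∈ 𝓝 x) :
    ∃ χ : M → ℝ, IsSmoothFun E χ ∧ (∀ᶠ y in 𝓝 x, χ y = 1) ∧ tsupport χ ⊆ U := by
  obtain ⟨f, hf, -⟩ := ((SmoothBumpFunction.nhds_basis_support (I := 𝓘(ℝ, E)) hU).mem_iff).1 hU
  exact ⟨f, f.contMDiff, f.eventuallyEq_one, hf⟩

theorem isSmoothVField_bump_smul {χ : M → ℝ} {X : VField E M} (hχ : IsSmoothFun E χ)
    (hX : ∀ y ∈ tsupport χ, SmoothVFieldAt X y) : IsSmoothVField (fun y => χ y • X y) := by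
  intro y
  by_cases hy : y ∈ tsupport χ
  · exact ContMDiffAt.smul_section (hχ.at y) (hX y hy)
  · have h0 : SmoothVFieldAt (fun y : M => (0 : TangentSpace 𝓘(ℝ, E) y)) y :=
      (Bundle.contMDiff_zeroSection ℝ (fun y : M => TangentSpace 𝓘(ℝ, E) y)).contMDiffAt
    refine h0.congr ?_
    filter_upwards [notMem_tsupport_iff_eventuallyEq.1 hy] with z hz
    simp [hz]

theorem exists_isSmoothFun_eventuallyEq {f : M → ℝ} {x : M} (hf : ∀ᶠ y in 𝓝 x, SmoothFunAt E f y) :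
    ∃ g, IsSmoothFun E g ∧ g =ᶠ[𝓝 x] f := by
  obtain ⟨χ, hχ, h1, hs⟩ := exists_bump (E := E) hf
  exact ⟨_, isSmoothFun_bump_mul hχ fun y hy => hs hy, by
    filter_upwards [h1] with y hy
    simp [hy]⟩

theorem exists_isSmoothVField_eventuallyEq {X : VField E M} {x : M}
    (hX : ∀ᶠ y in 𝓝 x, SmoothVFieldAt X y) :
    ∃ Y, IsSmoothVField Y ∧ ∀ᶠ y in 𝓝 x, Y y = X y := by
  obtain ⟨χ, hχ, h1, hs⟩ := exists_bump (E := E) hX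
  exact ⟨_, isSmoothVField_bump_smul hχ fun y hy => hs hy, by
    filter_upwards [h1] with y hy
    simp [hy]⟩

/-- `FiberBundle.extend` agrees near `x` with a smooth vector field. -/
theorem exists_isSmoothVField_eventuallyEq_extend {x : M} (v : TangentSpace 𝓘(ℝ, E) x) :
    ∃ Y : VField E M, IsSmoothVField Y ∧ ∀ᶠ y in 𝓝 x, Y y = FiberBundle.extend E v y := by
  refine exists_isSmoothVField_eventuallyEq ?_
  obtain ⟨s, hs, h⟩ := FiberBundle.exists_contMDiffOn_extend (k := ∞) 𝓘(ℝ, E) E v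
  filter_upwards [eventually_mem_nhds_iff.2 hs] with y hy
  exact (h y (mem_of_mem_nhds hy)).contMDiffAt hy

theorem exists_isSmoothVField_apply_eq {x : M} (v : TangentSpace 𝓘(ℝ, E) x) :
    ∃ Y : VField E M, IsSmoothVField Y ∧ Y x = v := by
  obtain ⟨Y, hY, h⟩ := exists_isSmoothVField_eventuallyEq_extend v
  exact ⟨Y, hY, by rw [h.self_of_nhds, FiberBundle.extend_apply_self]⟩

/-- Coordinate vector fields and coordinate functions near a point, extended to `M`. -/
theorem exists_coordinate_frame (x : M) :
    ∃ (e : Fin (Module.finrank ℝ E) → VField E M) (f : Fin (Module.finrank ℝ E) → M → ℝ),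
      (∀ i, IsSmoothVField (e i)) ∧ (∀ i, IsSmoothFun E (f i)) ∧
      (∀ᶠ y in 𝓝 x, ∀ v : TangentSpace 𝓘(ℝ, E) y, v = ∑ i, differential E (f i) y v • e i y) ∧
      ∀ᶠ y in 𝓝 x, ∀ i j, differential E (f i) y (e j y) = if i = j then 1 else 0 := by
  classical
  set b := Module.finBasis ℝ E
  set t := trivializationAt E (TangentSpace 𝓘(ℝ, E)) x with ht
  have htx : x ∈ t.baseSet := FiberBundle.mem_baseSet_trivializationAt' x
  choose e he he' using fun i => exists_isSmoothVField_eventuallyEq_extend (E := E) (x := x)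
    (t.symmL ℝ x (b i))
  have hsm : ∀ i, ∀ᶠ y in 𝓝 x, SmoothFunAt E (fun y => b.coord i (extChartAt 𝓘(ℝ, E) x y)) y := by
    intro i
    filter_upwards [chart_source_mem_nhds E x] with y hy
    have h1 : ContMDiffAt 𝓘(ℝ, E) 𝓘(ℝ, E) ∞ (extChartAt 𝓘(ℝ, E) x) y := contMDiffAt_extChartAt' hy
    exact ((b.coord i).toContinuousLinearMap.contMDiff).contMDiffAt.comp y h1
  choose f hf hf' using fun i => exists_isSmoothFun_eventuallyEq (hsm i)
  -- The trivialization of the tangent bundle at `x` is the derivative of the chart, so the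
  -- differentials of chart coordinates are the coordinates of the trivialization. Both conclusions
  -- follow from this and `he2`.
  have hdf : ∀ i, ∀ᶠ y in 𝓝 x, ∀ v : TangentSpace 𝓘(ℝ, E) y, differential E (f i) y v =
      b.coord i (t.continuousLinearMapAt ℝ y v) := by
    intro i
    filter_upwards [(hf' i).eventually_nhds, chart_source_mem_nhds E x] with y hy hy' v
    rw [differential_congr hy, TangentBundle.continuousLinearMapAt_trivializationAt hy']
    have h1 : MDifferentiableAt 𝓘(ℝ, E) 𝓘(ℝ, E) (extChartAt 𝓘(ℝ, E) x) y :=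
      mdifferentiableAt_extChartAt hy'
    have h2 : MDifferentiableAt 𝓘(ℝ, E) 𝓘(ℝ, ℝ) (b.coord i).toContinuousLinearMap
        (extChartAt 𝓘(ℝ, E) x y) := (b.coord i).toContinuousLinearMap.mdifferentiableAt
    have h3 := mvfderiv_comp_apply y h2 h1 v
    refine h3.trans ?_
    simp only [mvfderiv, ContinuousLinearMap.mfderiv_eq]
    rfl
  have he2 : ∀ i, ∀ᶠ y in 𝓝 x, t.continuousLinearMapAt ℝ y (e i y) = b i := by
    intro i
    filter_upwards [he' i, t.open_baseSet.mem_nhds htx] with y hy hy'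
    have h4 : (t ⟨x, t.symmL ℝ x (b i)⟩).2 = b i := by
      have h5 := t.continuousLinearMapAt_symmL (R := ℝ) htx (b i)
      rw [Bundle.Trivialization.continuousLinearMapAt_apply,
        Bundle.Trivialization.coe_linearMapAt_of_mem _ htx] at h5
      exact h5
    have h6 : e i y = t.symmL ℝ y (b i) := by
      rw [hy, FiberBundle.extend, ← ht, h4, t.symmL_apply hy']
    rw [h6, t.continuousLinearMapAt_symmL hy']
  refine ⟨e, f, he, hf, ?_, ?_⟩
  · filter_upwards [eventually_all.2 hdf, eventually_all.2 he2,
      t.open_baseSet.mem_nhds htx] with y h1 h2 h3 v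
    apply (t.continuousLinearEquivAt ℝ y h3).injective
    have h6 : ∀ w, t.continuousLinearEquivAt ℝ y h3 w =
        t.continuousLinearMapAt ℝ y w := fun w => by
      rw [Bundle.Trivialization.continuousLinearMapAt_apply,
        Bundle.Trivialization.coe_linearMapAt_of_mem _ h3]
      rfl
    rw [h6, h6, map_sum]
    simp only [map_smul, h2, h1]
    exact (b.sum_repr _).symm
  · filter_upwards [eventually_all.2 hdf, eventually_all.2 he2] with y h1 h2 i j
    rw [h1, h2]
    simp [Finsupp.single_apply, eq_comm]

end SmoothObjects

end CouplingPoisson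

end

noncomputable section

namespace CouplingPoisson

/-! ### Vector fields and forms in a chart -/

section ChartCalculus

open Filter Topology

variable {E : Type*} [NormedAddCommGroup E] [NormedSpace ℝ E] [FiniteDimensional ℝ E]
  {M : Type*} [TopologicalSpace M] [ChartedSpace E M] [IsManifold 𝓘(ℝ, E) ∞ M]

/-- The representation of a vector field in the chart around `x`. -/
def chartField (X : VField E M) (x : M) (y : E) : E :=
  (mfderiv 𝓘(ℝ, E) 𝓘(ℝ, E) (extChartAt 𝓘(ℝ, E) x).symm y).inverse
    (X ((extChartAt 𝓘(ℝ, E) x).symm y))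

theorem isManifold_one : IsManifold 𝓘(ℝ, E) 1 M :=
  IsManifold.of_le (n := ∞) (WithTop.coe_le_coe.2 (le_top : (1 : ℕ∞) ≤ ⊤))

theorem isManifold_two : IsManifold 𝓘(ℝ, E) 2 M :=
  IsManifold.of_le (n := ∞) (WithTop.coe_le_coe.2 (le_top : (2 : ℕ∞) ≤ ⊤))

theorem isInvertible_mfderiv_chart_symm (x : M) {y : E} (hy : y ∈ (extChartAt 𝓘(ℝ, E) x).target) :
    (mfderiv 𝓘(ℝ, E) 𝓘(ℝ, E) (extChartAt 𝓘(ℝ, E) x).symm y).IsInvertible := by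
  have := isManifold_one (E := E) (M := M)
  have h := isInvertible_mfderivWithin_extChartAt_symm (I := 𝓘(ℝ, E)) hy
  rwa [modelWithCornersSelf_coe, Set.range_id, mfderivWithin_univ] at h

theorem mfderiv_chart_symm_chartField (X : VField E M) (x : M) {y : E}
    (hy : y ∈ (extChartAt 𝓘(ℝ, E) x).target) :
    mfderiv 𝓘(ℝ, E) 𝓘(ℝ, E) (extChartAt 𝓘(ℝ, E) x).symm y (chartField (E := E) X x y) =
      X ((extChartAt 𝓘(ℝ, E) x).symm y) :=
  (isInvertible_mfderiv_chart_symm x hy).self_apply_inverse _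

theorem mfderiv_chart_apply (X : VField E M) (x : M) {y : E}
    (hy : y ∈ (extChartAt 𝓘(ℝ, E) x).target) :
    mfderiv 𝓘(ℝ, E) 𝓘(ℝ, E) (extChartAt 𝓘(ℝ, E) x) ((extChartAt 𝓘(ℝ, E) x).symm y)
      (X ((extChartAt 𝓘(ℝ, E) x).symm y)) = chartField X x y := by
  have := isManifold_one (E := E) (M := M)
  have h := mfderiv_extChartAt_comp_mfderivWithin_extChartAt_symm (I := 𝓘(ℝ, E)) hy
  rw [modelWithCornersSelf_coe, Set.range_id, mfderivWithin_univ] at h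
  rw [← mfderiv_chart_symm_chartField X x hy]
  exact congrArg (fun L => L (chartField (E := E) X x y)) h

theorem mfderiv_chart_self_apply (X : VField E M) (x : M) :
    mfderiv 𝓘(ℝ, E) 𝓘(ℝ, E) (extChartAt 𝓘(ℝ, E) x) x (X x) =
      chartField X x (extChartAt 𝓘(ℝ, E) x x) := by
  have h := mfderiv_chart_apply X x (mem_extChartAt_target (I := 𝓘(ℝ, E)) x)
  rw [extChartAt_to_inv] at h
  exact h

theorem IsSmoothVField.differentiableAt_chartField {X : VField E M} (hX : IsSmoothVField X)
    (x : M) : DifferentiableAt ℝ (chartField X x) (extChartAt 𝓘(ℝ, E) x x) := by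
  have := isManifold_two (E := E) (M := M)
  have h1 : MDifferentiableWithinAt 𝓘(ℝ, E) 𝓘(ℝ, E).tangent
      (fun x => (⟨x, X x⟩ : TangentBundle 𝓘(ℝ, E) M)) Set.univ x :=
    ((hX.at x).mdifferentiableAt (by simp)).mdifferentiableWithinAt
  have h := h1.differentiableWithinAt_mpullbackWithin_vectorField
  simp only [Set.preimage_univ, modelWithCornersSelf_coe, Set.range_id, Set.inter_univ] at h
  rw [VectorField.mpullbackWithin_univ] at h
  exact differentiableWithinAt_univ.1 h

theorem mfderiv_chart_mlieBracket (X Y : VField E M) (x : M) :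
    chartField (VectorField.mlieBracket 𝓘(ℝ, E) X Y) x (extChartAt 𝓘(ℝ, E) x x) =
      VectorField.lieBracket ℝ (chartField X x) (chartField Y x) (extChartAt 𝓘(ℝ, E) x x) := by
  have := isManifold_one (E := E) (M := M)
  rw [← mfderiv_chart_self_apply, ← VectorField.mlieBracketWithin_univ,
    VectorField.mlieBracketWithin_apply]
  simp only [Set.preimage_univ, modelWithCornersSelf_coe, Set.range_id, Set.inter_univ,
    VectorField.mpullbackWithin_univ]
  refine ((isInvertible_mfderiv_extChartAt (I := 𝓘(ℝ, E)) (M := M)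
    (mem_extChartAt_source x)).self_apply_inverse _).trans ?_
  exact congrFun (VectorField.lieBracketWithin_univ (𝕜 := ℝ) (V := chartField (E := E) X x)
    (W := chartField (E := E) Y x)) _

theorem contDiffAt_comp_chart_symm {f : M → ℝ} (hf : IsSmoothFun E f) (x : M) {y : E}
    (hy : y ∈ (extChartAt 𝓘(ℝ, E) x).target) :
    ContDiffAt ℝ ∞ (f ∘ (extChartAt 𝓘(ℝ, E) x).symm) y := by
  have h1 : ContMDiffWithinAt 𝓘(ℝ, E) 𝓘(ℝ, E) ∞ (extChartAt 𝓘(ℝ, E) x).symm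
      (extChartAt 𝓘(ℝ, E) x).target y := contMDiffOn_extChartAt_symm x y hy
  have h2 := h1.contMDiffAt (extChartAt_target_mem_nhds' hy)
  exact (ContMDiffAt.comp y (hf.at _) h2).contDiffAt

theorem differential_apply_chart {f : M → ℝ} (hf : IsSmoothFun E f) (X : VField E M) (x : M) {y : E}
    (hy : y ∈ (extChartAt 𝓘(ℝ, E) x).target) :
    differential E f ((extChartAt 𝓘(ℝ, E) x).symm y) (X ((extChartAt 𝓘(ℝ, E) x).symm y)) =
      fderiv ℝ (f ∘ (extChartAt 𝓘(ℝ, E) x).symm) y (chartField X x y) := by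
  have h1 : ContMDiffWithinAt 𝓘(ℝ, E) 𝓘(ℝ, E) ∞ (extChartAt 𝓘(ℝ, E) x).symm
      (extChartAt 𝓘(ℝ, E) x).target y := contMDiffOn_extChartAt_symm x y hy
  have h2 := (h1.contMDiffAt (extChartAt_target_mem_nhds' hy)).mdifferentiableAt (by simp)
  have h3 := mvfderiv_comp_apply y (hf.at _).mdiff h2 (chartField (E := E) X x y)
  rw [mfderiv_chart_symm_chartField X x hy] at h3
  refine h3.symm.trans ?_
  simp only [mvfderiv, mfderiv_eq_fderiv]
  rfl

theorem differential_apply_chart_self {f : M → ℝ} (hf : IsSmoothFun E f) (X : VField E M) (x : M) :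
    differential E f x (X x) = fderiv ℝ (f ∘ (extChartAt 𝓘(ℝ, E) x).symm)
      (extChartAt 𝓘(ℝ, E) x x) (chartField X x (extChartAt 𝓘(ℝ, E) x x)) := by
  have h := differential_apply_chart hf X x (mem_extChartAt_target (I := 𝓘(ℝ, E)) x)
  rw [extChartAt_to_inv] at h
  exact h

/-- The Lie bracket acts on functions as the commutator of derivations. -/
theorem differential_mlieBracket {f : M → ℝ} (hf : IsSmoothFun E f) {X Y : VField E M}
    (hX : IsSmoothVField X) (hY : IsSmoothVField Y) (x : M) :
    differential E f x (VectorField.mlieBracket 𝓘(ℝ, E) X Y x) =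
      differential E (fun y => differential E f y (Y y)) x (X x) -
        differential E (fun y => differential E f y (X y)) x (Y x) := by
  have ht := mem_extChartAt_target (I := 𝓘(ℝ, E)) x
  rw [differential_apply_chart_self hf, mfderiv_chart_mlieBracket,
    VectorField.fderiv_apply_lieBracket (contDiffAt_comp_chart_symm hf x ht)
      (by rw [minSmoothness_of_isRCLikeNormedField]; exact WithTop.coe_le_coe.2 le_top)
      (hY.differentiableAt_chartField x) (hX.differentiableAt_chartField x),
    differential_apply_chart_self (hf.differential_apply hY),
    differential_apply_chart_self (hf.differential_apply hX)]
  have h : ∀ Z : VField E M, (fun y => fderiv ℝ (f ∘ (extChartAt 𝓘(ℝ, E) x).symm) y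
      (chartField Z x y)) =ᶠ[𝓝 (extChartAt 𝓘(ℝ, E) x x)]
      (fun y => differential E f y (Z y)) ∘ (extChartAt 𝓘(ℝ, E) x).symm := fun Z => by
    filter_upwards [extChartAt_target_mem_nhds x] with y hy
    exact (differential_apply_chart hf Z x hy).symm
  rw [(h Y).fderiv_eq, (h X).fderiv_eq]

theorem chartForm_apply_chartField {k : ℕ} (η : DForm E M k) (X : Fin k → VField E M) (x : M)
    {y : E} (hy : y ∈ (extChartAt 𝓘(ℝ, E) x).target) :
    chartForm η x y (fun i => chartField (X i) x y) =
      η ((extChartAt 𝓘(ℝ, E) x).symm y) fun i => X i ((extChartAt 𝓘(ℝ, E) x).symm y) := by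
  simp only [← mfderiv_chart_symm_chartField _ x hy]
  rfl

variable [T2Space M]

/-- Test fields with constant coefficients in the chart: on them the value of a form is a single
coefficient of its chart representation. -/
theorem exists_chartField_eq_const (x : M) (w : E) : ∃ X : VField E M, IsSmoothVField X ∧
    ∀ᶠ y in 𝓝 (extChartAt 𝓘(ℝ, E) x x), chartField X x y = w := by
  have := isManifold_one (E := E) (M := M)
  set t := trivializationAt E (TangentSpace 𝓘(ℝ, E)) x with ht
  have htx : x ∈ t.baseSet := FiberBundle.mem_baseSet_trivializationAt' x
  obtain ⟨X, hX, hX'⟩ := exists_isSmoothVField_eventuallyEq_extend (E := E) (x := x)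
    (t.symmL ℝ x w)
  refine ⟨X, hX, ?_⟩
  have h1 : ∀ᶠ y in 𝓝 x, mfderiv 𝓘(ℝ, E) 𝓘(ℝ, E) (extChartAt 𝓘(ℝ, E) x) y (X y) = w := by
    filter_upwards [hX', t.open_baseSet.mem_nhds htx, chart_source_mem_nhds E x] with y hy hy' hs
    have h4 : (t ⟨x, t.symmL ℝ x w⟩).2 = w := by
      have h5 := t.continuousLinearMapAt_symmL (R := ℝ) htx w
      rw [Bundle.Trivialization.continuousLinearMapAt_apply,
        Bundle.Trivialization.coe_linearMapAt_of_mem _ htx] at h5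
      exact h5
    have h6 : X y = t.symmL ℝ y w := by
      rw [hy, FiberBundle.extend, ← ht, h4, t.symmL_apply hy']
    rw [h6, ← TangentBundle.continuousLinearMapAt_trivializationAt hs]
    exact t.continuousLinearMapAt_symmL hy' w
  have h2 : Tendsto (extChartAt 𝓘(ℝ, E) x).symm (𝓝 (extChartAt 𝓘(ℝ, E) x x)) (𝓝 x) := by
    have := continuousAt_extChartAt_symm (I := 𝓘(ℝ, E)) x
    rwa [ContinuousAt, extChartAt_to_inv] at this
  filter_upwards [h2.eventually h1, extChartAt_target_mem_nhds x] with y hy hy'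
  rw [← mfderiv_chart_apply X x hy']
  exact hy

/-- An alternating map is determined by its values on tuples of basis vectors, and the evaluation
map `ev` has a linear left inverse in finite dimension. Differentiability is therefore tested
coefficientwise, each coefficient being a value of `η` on fields constant in the chart. -/
theorem IsSmoothForm.differentiableAt_chartForm {k : ℕ} {η : DForm E M k} (hη : IsSmoothForm η)
    (x : M) : DifferentiableAt ℝ (chartForm η x) (extChartAt 𝓘(ℝ, E) x x) := by
  classical
  set b := Module.finBasis ℝ E
  let ev : (E [⋀^Fin k]→L[ℝ] ℝ) →ₗ[ℝ] ((Fin k → Fin (Module.finrank ℝ E)) → ℝ) :=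
    { toFun := fun L r => L fun i => b (r i)
      map_add' := fun _ _ => rfl
      map_smul' := fun _ _ => rfl }
  have hev : Function.Injective ev := fun L L' h => by
    apply ContinuousAlternatingMap.toAlternatingMap_injective
    refine AlternatingMap.coe_multilinearMap_injective (Module.Basis.ext_multilinear
      (fun _ => b) fun r => congrFun h r)
  obtain ⟨R, hR⟩ := ev.exists_leftInverse_of_injective (LinearMap.ker_eq_bot.2 hev)
  have h1 : chartForm η x = fun y => R (ev (chartForm η x y)) :=
    funext fun y => (congrArg (fun L => L (chartForm η x y)) hR).symm
  rw [h1]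
  have hRc : Differentiable ℝ R :=
    (⟨R, R.continuous_of_finiteDimensional⟩ : _ →L[ℝ] (E [⋀^Fin k]→L[ℝ] ℝ)).differentiable
  refine (hRc _).comp (extChartAt 𝓘(ℝ, E) x x) (differentiableAt_pi.2 fun r => ?_)
  choose X hX hX' using fun i => exists_chartField_eq_const x (b i)
  have h2 := contDiffAt_comp_chart_symm (hη (fun i => X (r i)) fun i => hX _) x
    (mem_extChartAt_target (I := 𝓘(ℝ, E)) x)
  refine (h2.differentiableAt (by simp)).congr_of_eventuallyEq ?_
  filter_upwards [eventually_all.2 hX', extChartAt_target_mem_nhds x] with y hy hy'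
  simp only [Function.comp_apply]
  rw [← chartForm_apply_chartField η _ x hy']
  simp [ev, hy]

end ChartCalculus

end CouplingPoisson

end

noncomputable section

namespace CouplingPoisson

/-! ### Invariant formula for the exterior derivative and Cartan's formula -/

section CartanCalculus

open Filter Topology

variable {E : Type*} [NormedAddCommGroup E] [NormedSpace ℝ E]

theorem removeNth_removeNth_apply_update {W : Type*} {n : ℕ} (v : Fin (n + 2) → W) (c : W)
    {i j : Fin (n + 1)} (hij : i ≤ j) :
    (fun a => if j.succ.succAbove a = i.castSucc then c else v (j.succ.succAbove a)) =
      i.insertNth c (j.removeNth (i.castSucc.removeNth v)) := by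
  have H₁ : i.castSucc.succAbove j = j.succ := by simp [Fin.succAbove_of_le_castSucc, hij]
  have H₂ : j.predAbove i.castSucc = i := by simp [Fin.predAbove_of_le_castSucc, hij]
  have H₃ : j.succ.succAbove i = i.castSucc := by simp [Fin.succAbove_of_castSucc_lt, hij]
  rw [Fin.removeNth_removeNth_eq_swap, H₁, H₂]
  funext a
  rcases Fin.eq_self_or_eq_succAbove i a with rfl | ⟨b, rfl⟩
  · simp [H₃]
  · have : j.succ.succAbove (i.succAbove b) ≠ i.castSucc := by
      rw [← H₃]
      exact fun h => Fin.succAbove_ne i b (Fin.succAbove_right_injective h)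
    simp [this, Fin.removeNth]

/-- Pairs `i < j` in `Fin (n + 2)` are exactly the pairs `(i.castSucc, j.succ)` with `i ≤ j` in `Fin
(n + 1)`; this matches two ways of indexing the bracket terms. -/
theorem sum_sum_lt_eq {n : ℕ} (F : Fin (n + 2) → Fin (n + 2) → ℝ) :
    ∑ j, ∑ i ∈ Finset.univ.filter (fun i => i < j), F i j =
      ∑ i : Fin (n + 1), ∑ j ∈ Finset.Ici i, F i.castSucc j.succ := by
  have h : ∀ j : Fin (n + 1), ∑ i ∈ Finset.univ.filter (fun i => i < j.succ), F i j.succ =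
      ∑ i ∈ Finset.univ.filter (fun i => i ≤ j), F i.castSucc j.succ := fun j => by
    rw [Finset.sum_filter, Finset.sum_filter, Fin.sum_univ_castSucc]
    have h1 : ¬ Fin.last (n + 1) < j.succ := not_lt.2 (Fin.le_last _)
    simp only [h1, if_false, add_zero, Fin.castSucc_lt_succ_iff]
  rw [Fin.sum_univ_succ]
  simp only [h, Fin.not_lt_zero, Finset.filter_false, Finset.sum_empty, zero_add]
  simp only [Finset.sum_filter]
  rw [Finset.sum_comm]
  refine Finset.sum_congr rfl fun i _ => ?_
  rw [← Finset.sum_filter]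
  congr 1
  ext j
  simp

/-- The same invariant formula as `extDeriv_apply_vectorField`, with each bracket written in the
slot of `Y i` rather than in front. This is the shape used by `leafD`. -/
theorem extDeriv_apply_vectorField_eq {k : ℕ} {η : E → E [⋀^Fin k]→L[ℝ] ℝ}
    {Y : Fin (k + 1) → E → E} {x : E}
    (hη : DifferentiableAt ℝ η x) (hY : ∀ i, DifferentiableAt ℝ (Y i) x) :
    extDeriv η x (fun i => Y i x) =
      (∑ i : Fin (k + 1), (-1 : ℝ) ^ (i : ℕ) *
        fderiv ℝ (fun y => η y fun a => Y (i.succAbove a) y) x (Y i x)) +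
      ∑ j : Fin (k + 1), ∑ i ∈ Finset.univ.filter (fun i => i < j), (-1 : ℝ) ^ (j : ℕ) *
        η x fun a => if j.succAbove a = i then VectorField.lieBracket ℝ (Y i) (Y j) x
          else Y (j.succAbove a) x := by
  cases k with
  | zero =>
    -- In degree zero there is only one field, so the commutation hypothesis is vacuous and there
    -- are no bracket terms.
    rw [extDeriv_apply_vectorField_of_pairwise_commute hη hY
      (fun i j hij => (hij (Subsingleton.elim (α := Fin 1) _ _)).elim)]
    refine (Finset.sum_congr rfl fun i _ => (zsmul_eq_mul _ _).trans (by push_cast; rfl)).trans ?_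
    refine left_eq_add.2 ?_
    refine Finset.sum_eq_zero fun j _ => Finset.sum_eq_zero fun i hi => ?_
    rw [Subsingleton.elim (α := Fin 1) i j] at hi
    simp at hi
  | succ n =>
    rw [extDeriv_apply_vectorField hη hY, sum_sum_lt_eq, sub_eq_add_neg]
    refine congrArg₂ (· + ·) (Finset.sum_congr rfl fun i _ => (zsmul_eq_mul _ _).trans (by push_cast; rfl)) ?_
    rw [← Finset.sum_neg_distrib]
    refine Finset.sum_congr rfl fun i _ => ?_
    rw [← Finset.sum_neg_distrib]
    refine Finset.sum_congr rfl fun j hj => ?_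
    rw [removeNth_removeNth_apply_update (fun a => Y a x) _ (Finset.mem_Ici.1 hj)]
    -- Moving the bracket from the front to slot `i` costs `(-1) ^ i`, which leaves the sign `(-1) ^
    -- (j + 1)` of the slot `j.succ`.
    have := ContinuousAlternatingMap.map_insertNth (η x) i
      (VectorField.lieBracket ℝ (Y i.castSucc) (Y j.succ) x)
      (j.removeNth (i.castSucc.removeNth fun a => Y a x))
    rw [this, zsmul_eq_mul, zsmul_eq_mul, Fin.val_succ]
    push_cast
    ring

variable [FiniteDimensional ℝ E]
  {M : Type*} [TopologicalSpace M] [ChartedSpace E M] [IsManifold 𝓘(ℝ, E) ∞ M]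

theorem chartForm_apply_chartField_self {k : ℕ} (η : DForm E M k) (X : Fin k → VField E M) (x : M) :
    chartForm η x (extChartAt 𝓘(ℝ, E) x x)
      (fun i => chartField (X i) x (extChartAt 𝓘(ℝ, E) x x)) = η x fun i => X i x := by
  rw [chartForm_apply_chartField η X x (mem_extChartAt_target x), extChartAt_to_inv]

variable [T2Space M]

/-- The invariant formula for the exterior derivative. -/
theorem extD_apply {k : ℕ} {η : DForm E M k} (hη : IsSmoothForm η) {Y : Fin (k + 1) → VField E M}
    (hY : ∀ i, IsSmoothVField (Y i)) (x : M) :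
    extD η x (fun i => Y i x) =
      (∑ i : Fin (k + 1), (-1 : ℝ) ^ (i : ℕ) *
        differential E (fun y => η y fun a => Y (i.succAbove a) y) x (Y i x)) +
      ∑ j : Fin (k + 1), ∑ i ∈ Finset.univ.filter (fun i => i < j), (-1 : ℝ) ^ (j : ℕ) *
        η x fun a => if j.succAbove a = i then VectorField.mlieBracket 𝓘(ℝ, E) (Y i) (Y j) x
          else Y (j.succAbove a) x := by
  have h0 : extD η x (fun i => Y i x) = extDeriv (chartForm η x) (extChartAt 𝓘(ℝ, E) x x)
      (fun i => chartField (Y i) x (extChartAt 𝓘(ℝ, E) x x)) := by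
    simp only [← mfderiv_chart_self_apply]
    rfl
  rw [h0, extDeriv_apply_vectorField_eq (hη.differentiableAt_chartForm x)
    fun i => (hY i).differentiableAt_chartField x]
  congr 1
  · refine Finset.sum_congr rfl fun i _ => ?_
    rw [differential_apply_chart_self (hη _ fun a => hY _)]
    congr 2
    refine Filter.EventuallyEq.fderiv_eq ?_
    filter_upwards [extChartAt_target_mem_nhds x] with y hy
    exact chartForm_apply_chartField η _ x hy
  · refine Finset.sum_congr rfl fun j _ => Finset.sum_congr rfl fun i _ => ?_
    have h1 := chartForm_apply_chartField_self η (fun a => if j.succAbove a = i then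
      VectorField.mlieBracket 𝓘(ℝ, E) (Y i) (Y j) else Y (j.succAbove a)) x
    congr 1
    have e1 : ∀ a, (if j.succAbove a = i then VectorField.mlieBracket 𝓘(ℝ, E) (Y i) (Y j) x
        else Y (j.succAbove a) x) = (if j.succAbove a = i then
      VectorField.mlieBracket 𝓘(ℝ, E) (Y i) (Y j) else Y (j.succAbove a)) x := fun a => by
      split_ifs <;> rfl
    simp only [e1]
    rw [← h1]
    congr 1
    funext a
    split_ifs
    · exact (mfderiv_chart_mlieBracket _ _ _).symm
    · rfl

/-- The insertion `i_A η`. -/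
def insertField {k : ℕ} (A : VField E M) (η : DForm E M (k + 1)) : DForm E M k :=
  fun x => (η x).curryLeft (A x)

theorem insertField_apply {k : ℕ} (A : VField E M) (η : DForm E M (k + 1)) (x : M)
    (v : Fin k → TangentSpace 𝓘(ℝ, E) x) :
    insertField A η x v = η x (Matrix.vecCons (A x) v) := rfl

theorem vecCons_field {k : ℕ} (A : VField E M) (Y : Fin k → VField E M) (x : M) :
    (fun i => (Matrix.vecCons A Y : Fin (k + 1) → VField E M) i x) =
      Matrix.vecCons (A x) fun i => Y i x := by
  funext i
  refine Fin.cases ?_ (fun i => ?_) i <;> rfl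

theorem forall_vecCons {k : ℕ} {A : VField E M} {Y : Fin k → VField E M} (hA : IsSmoothVField A)
    (hY : ∀ i, IsSmoothVField (Y i)) :
    ∀ i, IsSmoothVField ((Matrix.vecCons A Y : Fin (k + 1) → VField E M) i) := by
  refine Fin.cases hA hY

theorem IsSmoothForm.insertField {k : ℕ} {A : VField E M} {η : DForm E M (k + 1)}
    (hη : IsSmoothForm η) (hA : IsSmoothVField A) : IsSmoothForm (insertField A η) := by
  intro Y hY
  have := hη _ (forall_vecCons hA hY)
  simp only [vecCons_field] at this
  exact this

theorem update_eq_insertNth {W : Type*} {k : ℕ} (v : Fin (k + 1) → W) (i : Fin (k + 1)) (c : W) :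
    Function.update v i c = i.insertNth c (i.removeNth v) := by
  simp

/-- Cartan's formula `L_A = i_A d + d i_A`. -/
theorem extD_vecCons {k : ℕ} {η : DForm E M (k + 1)} (hη : IsSmoothForm η) {A : VField E M}
    (hA : IsSmoothVField A) {Y : Fin (k + 1) → VField E M} (hY : ∀ i, IsSmoothVField (Y i)) (x : M) :
    extD η x (Matrix.vecCons (A x) fun i => Y i x) =
      lieDerivApply A η Y x - extD (insertField A η) x fun i => Y i x := by
  rw [← vecCons_field, extD_apply hη (forall_vecCons hA hY), extD_apply (hη.insertField hA) hY,
    lieDerivApply]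
  rw [Fin.sum_univ_succ, Fin.sum_univ_succ (fun j : Fin (k + 2) => ∑ i ∈ _, _)]
  have e1 : ∀ i : Fin (k + 1), (fun y => η y fun a =>
      (Matrix.vecCons A Y : Fin (k + 2) → VField E M) (i.succ.succAbove a) y) =
      fun y => insertField A η y fun a => Y (i.succAbove a) y := fun i => by
    funext y
    rw [insertField_apply]
    congr 1
    funext a
    refine Fin.cases ?_ (fun a => ?_) a <;> simp
  -- The bracket terms with `i = 0` involve `A` and give those of the Lie derivative; the remaining
  -- ones are those of `d (i_A η)` with the opposite sign.
  have e2 : ∀ j : Fin (k + 1), (∑ i ∈ Finset.univ.filter (fun i => i < j.succ),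
      (-1 : ℝ) ^ (j.succ : ℕ) * η x fun a => if j.succ.succAbove a = i then
        VectorField.mlieBracket 𝓘(ℝ, E) ((Matrix.vecCons A Y : Fin (k + 2) → VField E M) i)
          ((Matrix.vecCons A Y : Fin (k + 2) → VField E M) j.succ) x
          else (Matrix.vecCons A Y : Fin (k + 2) → VField E M) (j.succ.succAbove a) x) =
      - η x (Function.update (fun j => Y j x) j (VectorField.mlieBracket 𝓘(ℝ, E) A (Y j) x)) -
      ∑ i ∈ Finset.univ.filter (fun i => i < j), (-1 : ℝ) ^ (j : ℕ) *
        insertField A η x fun a => if j.succAbove a = i then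
          VectorField.mlieBracket 𝓘(ℝ, E) (Y i) (Y j) x else Y (j.succAbove a) x := fun j => by
    rw [Finset.sum_filter, Fin.sum_univ_succ, if_pos (Fin.succ_pos j), Finset.sum_filter,
      sub_eq_add_neg, ← Finset.sum_neg_distrib]
    congr 1
    · rw [update_eq_insertNth, AlternatingMap.map_insertNth]
      have : (fun a => if j.succ.succAbove a = 0 then
        VectorField.mlieBracket 𝓘(ℝ, E) ((Matrix.vecCons A Y : Fin (k + 2) → VField E M) 0)
          ((Matrix.vecCons A Y : Fin (k + 2) → VField E M) j.succ) x
          else (Matrix.vecCons A Y : Fin (k + 2) → VField E M) (j.succ.succAbove a) x) =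
          Matrix.vecCons (VectorField.mlieBracket 𝓘(ℝ, E) A (Y j) x) (j.removeNth fun j => Y j x) := by
        funext a
        refine Fin.cases ?_ (fun a => ?_) a
        · simp
        · simp [Fin.removeNth]
      rw [this, Fin.val_succ, pow_succ, zsmul_eq_mul]
      push_cast
      ring
    · refine Finset.sum_congr rfl fun i _ => ?_
      simp only [Fin.succ_lt_succ_iff]
      split_ifs with hij
      · rw [insertField_apply, Fin.val_succ, pow_succ]
        have : (fun a => if j.succ.succAbove a = i.succ then
          VectorField.mlieBracket 𝓘(ℝ, E) ((Matrix.vecCons A Y : Fin (k + 2) → VField E M) i.succ)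
            ((Matrix.vecCons A Y : Fin (k + 2) → VField E M) j.succ) x
            else (Matrix.vecCons A Y : Fin (k + 2) → VField E M) (j.succ.succAbove a) x) =
            Matrix.vecCons (A x) (fun a => if j.succAbove a = i then
          VectorField.mlieBracket 𝓘(ℝ, E) (Y i) (Y j) x else Y (j.succAbove a) x) := by
          funext a
          refine Fin.cases ?_ (fun a => ?_) a
          · simp [(Fin.succ_ne_zero _).symm]
          · simp
        rw [this]
        ring
      · simp
  have e3 : ∀ j : Fin (k + 1), (-1 : ℝ) ^ (j.succ : ℕ) = - (-1) ^ (j : ℕ) := fun j => by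
    rw [Fin.val_succ, pow_succ]; ring
  simp only [e1, e2]
  simp only [e3, Finset.sum_sub_distrib, Finset.sum_neg_distrib, neg_mul,
    Fin.not_lt_zero, Finset.filter_false, Finset.sum_empty]
  simp only [Matrix.cons_val_zero, Matrix.cons_val_succ, Fin.succAbove_zero, Fin.val_zero, pow_zero,
    one_mul]
  ring

end CartanCalculus

end CouplingPoisson

end

noncomputable section

namespace CouplingPoisson

/-! ### Local frames and dual coframes -/

section Frames

open Filter Topology

variable {E : Type*} [NormedAddCommGroup E] [NormedSpace ℝ E] [FiniteDimensional ℝ E]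
  {M : Type*} [TopologicalSpace M] [ChartedSpace E M] [IsManifold 𝓘(ℝ, E) ∞ M]

theorem SmoothFunAt.det {ι : Type*} [Fintype ι] [DecidableEq ι] {A : ι → ι → M → ℝ} {x : M}
    (hA : ∀ i j, SmoothFunAt E (A i j) x) :
    SmoothFunAt E (fun y => (Matrix.of fun i j => A i j y).det) x := by
  simp only [Matrix.det_apply', Matrix.of_apply]
  refine SmoothFunAt.sum fun σ _ => contMDiffAt_const.mul ?_
  exact contMDiffAt_finsetProd fun i _ => hA _ _

/-- `b` is a family of smooth vector fields which is a frame near `x`, and `ε` is a family of smooth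
one-forms which is the dual frame near `x`. -/
structure IsFrameNear (x : M) {ι : Type*} [Fintype ι] [DecidableEq ι] (b : ι → VField E M)
    (ε : ι → CovectorField E M) : Prop where
  smooth : ∀ i, IsSmoothVField (b i)
  smooth_dual : ∀ i, IsSmoothCovectorField (ε i)
  expand : ∀ᶠ y in 𝓝 x, ∀ u : TangentSpace 𝓘(ℝ, E) y, u = ∑ i, ε i y u • b i y
  dual : ∀ᶠ y in 𝓝 x, ∀ i j, ε i y (b j y) = if i = j then 1 else 0

theorem IsSmoothCovectorField.sum {ι : Type*} {s : Finset ι} {α : ι → CovectorField E M}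
    (h : ∀ i ∈ s, IsSmoothCovectorField (α i)) :
    IsSmoothCovectorField fun x => ∑ i ∈ s, α i x := fun X hX => by
  simp only [LinearMap.sum_apply]
  exact IsSmoothFun.sum fun i hi => h i hi X hX

theorem IsSmoothCovectorField.smul {f : M → ℝ} {α : CovectorField E M} (hf : IsSmoothFun E f)
    (h : IsSmoothCovectorField α) : IsSmoothCovectorField fun x => f x • α x := fun X hX => by
  simp only [LinearMap.smul_apply, smul_eq_mul]
  exact hf.mul (h X hX)

theorem IsSmoothCovectorField.add {α β : CovectorField E M} (hα : IsSmoothCovectorField α)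
    (hβ : IsSmoothCovectorField β) : IsSmoothCovectorField fun x => α x + β x :=
  fun X hX => (hα X hX).add (hβ X hX)

theorem IsSmoothCovectorField.neg {α : CovectorField E M} (hα : IsSmoothCovectorField α) :
    IsSmoothCovectorField fun x => - α x :=
  fun X hX => (hα X hX).neg

variable [T2Space M]

theorem exists_coordinate_isFrameNear (x : M) :
    ∃ (e : Fin (Module.finrank ℝ E) → VField E M) (f : Fin (Module.finrank ℝ E) → M → ℝ),
      (∀ i, IsSmoothFun E (f i)) ∧ IsFrameNear x e fun i => differential E (f i) := by
  obtain ⟨e, f, he, hf, h1, h2⟩ := exists_coordinate_frame (E := E) x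
  exact ⟨e, f, hf, he, fun i => (hf i).isSmoothCovectorField, h1, h2⟩

/-- In coordinates the frame is a matrix `A` of smooth functions, invertible at `x` and hence
nearby. By Cramer's rule the entries of the inverse are smooth where the determinant does not
vanish; cut off by a bump function, they give the dual coframe. -/
theorem exists_isFrameNear {x : M} {ι : Type*} [Fintype ι] [DecidableEq ι] {b : ι → VField E M}
    (hb : ∀ i, IsSmoothVField (b i)) (hι : Fintype.card ι = Module.finrank ℝ E)
    (hx : LinearIndependent ℝ fun i => b i x) : ∃ ε, IsFrameNear x b ε := by
  obtain ⟨e, f, hf, he⟩ := exists_coordinate_isFrameNear (E := E) x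
  let σ : ι ≃ Fin (Module.finrank ℝ E) := Fintype.equivFinOfCardEq hι
  let A : M → Matrix ι ι ℝ := fun y => Matrix.of fun i j => differential E (f (σ i)) y (b j y)
  have hsep : ∀ᶠ y in 𝓝 x, ∀ u : TangentSpace 𝓘(ℝ, E) y,
      (∀ i, differential E (f (σ i)) y u = 0) → u = 0 := by
    filter_upwards [he.expand] with y hy u hu
    rw [hy u]
    refine Finset.sum_eq_zero fun i _ => ?_
    have := hu (σ.symm i)
    rw [σ.apply_symm_apply] at this
    rw [this, zero_smul]
  have hdx : (A x).det ≠ 0 := by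
    intro h0
    obtain ⟨c, hc, hc'⟩ := Matrix.exists_mulVec_eq_zero_iff.2 h0
    apply hc
    have h1 : ∑ j, c j • b j x = 0 := by
      refine hsep.self_of_nhds _ fun i => ?_
      have := congrFun hc' i
      simp only [Matrix.mulVec, dotProduct, A, Matrix.of_apply, Pi.zero_apply] at this
      rw [map_sum, ← this]
      exact Finset.sum_congr rfl fun j _ => by rw [map_smul, smul_eq_mul, mul_comm]
    funext j
    exact Fintype.linearIndependent_iff.1 hx c h1 j
  have hA : ∀ y i j, SmoothFunAt E (fun y => A y i j) y := fun y i j =>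
    ((hf (σ i)).differential_apply (hb j)).at y
  have hdet : ∀ y, SmoothFunAt E (fun y => (A y).det) y := fun y => SmoothFunAt.det fun i j => hA y i j
  have hne : ∀ᶠ y in 𝓝 x, (A y).det ≠ 0 := (hdet x).continuousAt.eventually_ne hdx
  obtain ⟨χ, hχ, h1, hs⟩ := exists_bump (E := E) hne
  have hadj : ∀ y i j, SmoothFunAt E (fun y => (A y).adjugate i j) y := fun y i j => by
    simp only [Matrix.adjugate_apply]
    refine SmoothFunAt.det (A := fun p q y => (A y).updateRow j (Pi.single i 1) p q) fun p q => ?_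
    by_cases hp : p = j
    · subst hp
      simp only [Matrix.updateRow_self]
      exact contMDiffAt_const
    · simp only [Matrix.updateRow_ne hp]
      exact hA y p q
  have hinv : ∀ i j, IsSmoothFun E fun y => χ y * (A y)⁻¹ i j := fun i j => by
    refine isSmoothFun_bump_mul hχ fun y hy => ?_
    have h2 : ∀ z, (A z)⁻¹ i j = ((A z).det)⁻¹ * (A z).adjugate i j := fun z => by
      rw [Matrix.inv_def, Ring.inverse_eq_inv', Matrix.smul_apply, smul_eq_mul]
    simp only [h2]
    exact ((hdet y).inv (hs hy)).mul (hadj y i j)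
  refine ⟨fun i y => ∑ j, (χ y * (A y)⁻¹ i j) • differential E (f (σ j)) y, hb,
    fun i => IsSmoothCovectorField.sum fun j _ => (hf _).isSmoothCovectorField.smul (hinv i j), ?_, ?_⟩
  · filter_upwards [h1, hne, hsep] with y hy1 hy2 hy3 u
    rw [← sub_eq_zero]
    refine hy3 _ fun m => ?_
    have h4 : ∀ i, differential E (f (σ m)) y (b i y) = A y m i := fun i => rfl
    have h5 : ∑ i, (∑ j, (A y)⁻¹ i j * differential E (f (σ j)) y u) * A y m i =
        differential E (f (σ m)) y u := by
      have h6 : A y * (A y)⁻¹ = 1 := Matrix.mul_nonsing_inv _ (isUnit_iff_ne_zero.2 hy2)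
      simp only [Finset.sum_mul]
      rw [Finset.sum_comm]
      have h7 : ∀ j, ∑ i, (A y)⁻¹ i j * differential E (f (σ j)) y u * A y m i =
          (if m = j then 1 else 0) * differential E (f (σ j)) y u := fun j => by
        rw [← Matrix.one_apply, ← h6, Matrix.mul_apply, Finset.sum_mul]
        exact Finset.sum_congr rfl fun i _ => by ring
      simp [h7]
    rw [map_sub, map_sum, sub_eq_zero]
    simp only [map_smul, LinearMap.sum_apply, LinearMap.smul_apply, hy1, one_mul, smul_eq_mul, h4]
    exact h5.symm
  · filter_upwards [h1, hne] with y hy1 hy2 i m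
    have h6 : (A y)⁻¹ * A y = 1 := Matrix.nonsing_inv_mul _ (isUnit_iff_ne_zero.2 hy2)
    rw [← Matrix.one_apply, ← h6, Matrix.mul_apply, LinearMap.sum_apply]
    refine Finset.sum_congr rfl fun j _ => ?_
    rw [hy1, one_mul, LinearMap.smul_apply, smul_eq_mul]
    rfl

theorem IsFrameNear.smoothVFieldAt {x : M} {ι : Type*} [Fintype ι] [DecidableEq ι]
    {b : ι → VField E M} {ε : ι → CovectorField E M} (h : IsFrameNear x b ε) {X : VField E M}
    (hX : ∀ i, IsSmoothFun E fun y => ε i y (X y)) : SmoothVFieldAt X x := by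
  have h1 : IsSmoothVField fun y => ∑ i, ε i y (X y) • b i y :=
    IsSmoothVField.sum fun i _ => IsSmoothVField.smul (hX i) (h.smooth i)
  exact (h1.at x).congr (h.expand.mono fun y hy => hy _)

/-- A vector field is smooth if the derivatives of smooth functions along it are smooth. -/
theorem isSmoothVField_of_differential {X : VField E M}
    (hX : ∀ f, IsSmoothFun E f → IsSmoothFun E fun y => differential E f y (X y)) :
    IsSmoothVField X := fun x => by
  obtain ⟨e, f, hf, he⟩ := exists_coordinate_isFrameNear (E := E) x
  exact he.smoothVFieldAt fun i => hX _ (hf i)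

theorem IsSmoothBivectorField.sharp {B : BivectorField E M} (hB : IsSmoothBivectorField B)
    {α : CovectorField E M} (hα : IsSmoothCovectorField α) :
    IsSmoothVField fun x => sharp (B x) (α x) := by
  refine isSmoothVField_of_differential fun f hf => ?_
  simp only [apply_sharp]
  exact hB _ _ hα hf.isSmoothCovectorField

theorem exists_differential_eq {x : M} (α : Module.Dual ℝ (TangentSpace 𝓘(ℝ, E) x)) :
    ∃ f, IsSmoothFun E f ∧ differential E f x = α := by
  obtain ⟨e, f, hf, he⟩ := exists_coordinate_isFrameNear (E := E) x
  refine ⟨fun y => ∑ i, α (e i x) * f i y, IsSmoothFun.sum fun i _ => (IsSmoothFun.const _).mul (hf i),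
    LinearMap.ext fun u => ?_⟩
  rw [differential_sum _ fun i _ => ((IsSmoothFun.const _).mul (hf i)).at x]
  conv_rhs => rw [he.expand.self_of_nhds u, map_sum]
  refine Finset.sum_congr rfl fun i _ => ?_
  rw [differential_const_mul _ ((hf i).at x), map_smul, smul_eq_mul, mul_comm]

theorem eq_of_forall_differential {x : M} {u v : TangentSpace 𝓘(ℝ, E) x}
    (h : ∀ f, IsSmoothFun E f → differential E f x u = differential E f x v) : u = v := by
  rw [← sub_eq_zero, ← Module.forall_dual_apply_eq_zero_iff ℝ]
  intro α
  obtain ⟨f, hf, rfl⟩ := exists_differential_eq α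
  rw [map_sub, h f hf, sub_self]

/-- Near a point every smooth one-form is a combination of differentials of smooth functions. -/
theorem exists_eventually_eq_sum_differential {x : M} {α : CovectorField E M}
    (hα : IsSmoothCovectorField α) : ∃ a f : Fin (Module.finrank ℝ E) → M → ℝ,
      (∀ i, IsSmoothFun E (a i)) ∧ (∀ i, IsSmoothFun E (f i)) ∧
      ∀ᶠ y in 𝓝 x, α y = ∑ i, a i y • differential E (f i) y := by
  obtain ⟨e, f, hf, he⟩ := exists_coordinate_isFrameNear (E := E) x
  refine ⟨fun i y => α y (e i y), f, fun i => hα _ (he.smooth i), hf, ?_⟩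
  filter_upwards [he.expand] with y hy
  refine LinearMap.ext fun u => ?_
  conv_lhs => rw [hy u, map_sum]
  rw [LinearMap.sum_apply]
  exact Finset.sum_congr rfl fun i _ => by
    rw [map_smul, LinearMap.smul_apply, smul_eq_mul, smul_eq_mul, mul_comm]

end Frames

end CouplingPoisson

end

noncomputable section

namespace CouplingPoisson

/-! ### The Jacobi identity for arbitrary one-forms -/

section Poisson

open Filter Topology VectorField

variable {E : Type*} [NormedAddCommGroup E] [NormedSpace ℝ E] [FiniteDimensional ℝ E]
  {M : Type*} [TopologicalSpace M] [ChartedSpace E M] [IsManifold 𝓘(ℝ, E) ∞ M]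

theorem mlieBracket_smul_field {f : M → ℝ} {X Y : VField E M} (hf : IsSmoothFun E f)
    (hY : IsSmoothVField Y) (x : M) :
    mlieBracket 𝓘(ℝ, E) X (fun y => f y • Y y) x =
      differential E f x (X x) • Y x + f x • mlieBracket 𝓘(ℝ, E) X Y x := by
  have := isManifold_two (E := E) (M := M)
  exact mlieBracket_smul_right (hf.at x).mdiff ((hY.at x).mdifferentiableAt (by simp))

theorem smul_field_mlieBracket {f : M → ℝ} {X Y : VField E M} (hf : IsSmoothFun E f)
    (hX : IsSmoothVField X) (x : M) :
    mlieBracket 𝓘(ℝ, E) (fun y => f y • X y) Y x =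
      - differential E f x (Y x) • X x + f x • mlieBracket 𝓘(ℝ, E) X Y x := by
  have := isManifold_two (E := E) (M := M)
  exact mlieBracket_smul_left (hf.at x).mdiff ((hX.at x).mdifferentiableAt (by simp))

theorem mlieBracket_add_field {X Y Z : VField E M} (hY : IsSmoothVField Y)
    (hZ : IsSmoothVField Z) (x : M) :
    mlieBracket 𝓘(ℝ, E) X (fun y => Y y + Z y) x =
      mlieBracket 𝓘(ℝ, E) X Y x + mlieBracket 𝓘(ℝ, E) X Z x := by
  have := isManifold_two (E := E) (M := M)
  exact mlieBracket_add_right ((hY.at x).mdifferentiableAt (by simp))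
    ((hZ.at x).mdifferentiableAt (by simp))

theorem add_field_mlieBracket {X Y Z : VField E M} (hY : IsSmoothVField Y)
    (hZ : IsSmoothVField Z) (x : M) :
    mlieBracket 𝓘(ℝ, E) (fun y => Y y + Z y) X x =
      mlieBracket 𝓘(ℝ, E) Y X x + mlieBracket 𝓘(ℝ, E) Z X x := by
  have := isManifold_two (E := E) (M := M)
  exact mlieBracket_add_left ((hY.at x).mdifferentiableAt (by simp))
    ((hZ.at x).mdifferentiableAt (by simp))

theorem mlieBracket_field_congr {X X' Y Y' : VField E M} {x : M} (hX : ∀ᶠ y in 𝓝 x, X y = X' y)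
    (hY : ∀ᶠ y in 𝓝 x, Y y = Y' y) :
    mlieBracket 𝓘(ℝ, E) X Y x = mlieBracket 𝓘(ℝ, E) X' Y' x :=
  Filter.EventuallyEq.mlieBracket_vectorField_eq hX hY

theorem mlieBracket_field_swap (X Y : VField E M) (x : M) :
    mlieBracket 𝓘(ℝ, E) X Y x = - mlieBracket 𝓘(ℝ, E) Y X x :=
  congrFun mlieBracket_swap x

/-- The cyclic expression in three one-forms whose vanishing is the Jacobi identity. -/
def koszul (B : BivectorField E M) (α β η : CovectorField E M) (x : M) : ℝ :=
  η x (mlieBracket 𝓘(ℝ, E) (fun y => sharp (B y) (α y)) (fun y => sharp (B y) (β y)) x) +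
  β x (mlieBracket 𝓘(ℝ, E) (fun y => sharp (B y) (η y)) (fun y => sharp (B y) (α y)) x) +
  α x (mlieBracket 𝓘(ℝ, E) (fun y => sharp (B y) (β y)) (fun y => sharp (B y) (η y)) x) +
  differential E (fun y => B y ![η y, β y]) x (sharp (B x) (α x)) +
  differential E (fun y => B y ![α y, η y]) x (sharp (B x) (β x)) +
  differential E (fun y => B y ![β y, α y]) x (sharp (B x) (η x))

theorem koszul_cyclic (B : BivectorField E M) (α β η : CovectorField E M) (x : M) :
    koszul B α β η x = koszul B β η α x := by
  simp only [koszul]; ring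

theorem koszul_congr (B : BivectorField E M) {α β η η' : CovectorField E M} {x : M}
    (h : ∀ᶠ y in 𝓝 x, η y = η' y) : koszul B α β η x = koszul B α β η' x := by
  have h1 : ∀ᶠ y in 𝓝 x, sharp (B y) (η y) = sharp (B y) (η' y) := h.mono fun y hy => by rw [hy]
  have r : ∀ X : VField E M, ∀ᶠ y in 𝓝 x, X y = X y := fun X => Eventually.of_forall fun _ => rfl
  simp only [koszul]
  rw [mlieBracket_field_congr h1 (r _), mlieBracket_field_congr (r _) h1, h.self_of_nhds,
    differential_congr (f := fun y => B y ![η y, β y]) (g := fun y => B y ![η' y, β y])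
      (h.mono fun y hy => by simp only [hy]),
    differential_congr (f := fun y => B y ![α y, η y]) (g := fun y => B y ![α y, η' y])
      (h.mono fun y hy => by simp only [hy])]

variable [T2Space M]

variable {B : BivectorField E M}

theorem bivector_apply_add_left {W : Type*} [AddCommGroup W] [Module ℝ W] (B : Bivector W)
    (α α' β : Module.Dual ℝ W) : B ![α + α', β] = B ![α, β] + B ![α', β] := by
  simpa using B.map_vecCons_add ![β] α α'

theorem bivector_apply_smul_left {W : Type*} [AddCommGroup W] [Module ℝ W] (B : Bivector W)
    (c : ℝ) (α β : Module.Dual ℝ W) : B ![c • α, β] = c * B ![α, β] := by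
  simpa using B.map_vecCons_smul ![β] c α

theorem koszul_add (hB : IsSmoothBivectorField B) {α β η ζ : CovectorField E M}
    (hα : IsSmoothCovectorField α) (hβ : IsSmoothCovectorField β)
    (hη : IsSmoothCovectorField η) (hζ : IsSmoothCovectorField ζ) (x : M) :
    koszul B α β (fun y => η y + ζ y) x = koszul B α β η x + koszul B α β ζ x := by
  simp only [koszul, map_add, LinearMap.add_apply, bivector_apply_add_left, map_snd_add]
  rw [add_field_mlieBracket (hB.sharp hη) (hB.sharp hζ),
    mlieBracket_add_field (hB.sharp hη) (hB.sharp hζ),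
    differential_add ((hB _ _ hη hβ).at x) ((hB _ _ hζ hβ).at x),
    differential_add ((hB _ _ hα hη).at x) ((hB _ _ hα hζ).at x)]
  simp only [map_add]
  ring

/-- The derivatives of `g` produced by the two brackets cancel those produced by the two
differentials, because `β(B^♯ η) = B(η, β)` and `B` is skew. With additivity, the expression is
tensorial in its last argument. -/
theorem koszul_smul (hB : IsSmoothBivectorField B) {g : M → ℝ} {α β η : CovectorField E M}
    (hg : IsSmoothFun E g) (hα : IsSmoothCovectorField α) (hβ : IsSmoothCovectorField β)
    (hη : IsSmoothCovectorField η) (x : M) :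
    koszul B α β (fun y => g y • η y) x = g x * koszul B α β η x := by
  simp only [koszul, map_smul, LinearMap.smul_apply, bivector_apply_smul_left, map_snd_smul,
    smul_eq_mul]
  rw [smul_field_mlieBracket hg (hB.sharp hη), mlieBracket_smul_field hg (hB.sharp hη),
    differential_mul (hg.at x) ((hB _ _ hη hβ).at x),
    differential_mul (hg.at x) ((hB _ _ hα hη).at x)]
  simp only [map_add, map_smul, smul_eq_mul, apply_sharp]
  rw [bivector_swap (B x) (α x) (η x)]
  ring

/-- By tensoriality it suffices to test the last argument on differentials, since every one-form is
locally a combination of these. -/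
theorem koszul_eq_zero_of_differential (hB : IsSmoothBivectorField B) {α β : CovectorField E M}
    (hα : IsSmoothCovectorField α) (hβ : IsSmoothCovectorField β) {x : M}
    (h : ∀ f, IsSmoothFun E f → koszul B α β (differential E f) x = 0)
    {η : CovectorField E M} (hη : IsSmoothCovectorField η) : koszul B α β η x = 0 := by
  classical
  obtain ⟨a, f, ha, hf, he⟩ := exists_eventually_eq_sum_differential (x := x) hη
  rw [koszul_congr B he]
  have hs : ∀ s : Finset (Fin (Module.finrank ℝ E)),
      koszul B α β (fun y => ∑ i ∈ s, a i y • differential E (f i) y) x = 0 := fun s => by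
    induction s using Finset.induction_on with
    | empty =>
      have h0 := h (fun _ => 0) (IsSmoothFun.const 0)
      rw [← h0]
      refine koszul_congr B (Eventually.of_forall fun y => ?_)
      rw [Finset.sum_empty, differential_const]
    | insert i s hi ih =>
      simp only [Finset.sum_insert hi]
      rw [koszul_add hB hα hβ ((hf i).isSmoothCovectorField.smul (ha i))
        (IsSmoothCovectorField.sum fun j _ => (hf j).isSmoothCovectorField.smul (ha j)), ih,
        koszul_smul hB (ha i) hα hβ (hf i).isSmoothCovectorField, h _ (hf i)]
      ring
  exact hs _

/-- The three commutators give six iterated Poisson brackets. Three of them cancel against the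
derivative terms, and the others form the Jacobi sum. -/
theorem IsPoisson.koszul_differential (hB : IsPoisson B) {f g h : M → ℝ} (hf : IsSmoothFun E f)
    (hg : IsSmoothFun E g) (hh : IsSmoothFun E h) (x : M) :
    koszul B (differential E f) (differential E g) (differential E h) x = 0 := by
  have hs := fun {f : M → ℝ} (hf : IsSmoothFun E f) => hB.smooth.sharp hf.isSmoothCovectorField
  have hj := hB.jacobi f g h hf hg hh x
  rw [koszul, differential_mlieBracket hh (hs hf) (hs hg), differential_mlieBracket hg (hs hh) (hs hf),
    differential_mlieBracket hf (hs hg) (hs hh)]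
  simp only [apply_sharp]
  unfold poissonBracket at hj
  linarith

/-- The Jacobi identity of a Poisson bivector field, for arbitrary one-forms. -/
theorem IsPoisson.koszul_eq_zero (hB : IsPoisson B) {α β η : CovectorField E M}
    (hα : IsSmoothCovectorField α) (hβ : IsSmoothCovectorField β) (hη : IsSmoothCovectorField η)
    (x : M) : koszul B α β η x = 0 := by
  refine koszul_eq_zero_of_differential hB.smooth hα hβ (fun h hh => ?_) hη
  -- Only the last argument can be reduced to differentials; cyclic rotation brings each of the
  -- three there in turn.
  rw [← koszul_cyclic]
  refine koszul_eq_zero_of_differential hB.smooth hh.isSmoothCovectorField hα (fun g hg => ?_) hβ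
  rw [← koszul_cyclic]
  refine koszul_eq_zero_of_differential hB.smooth hg.isSmoothCovectorField
    hh.isSmoothCovectorField (fun f hf => ?_) hα
  exact hB.koszul_differential hg hh hf x

end Poisson

end CouplingPoisson

end

noncomputable section

namespace CouplingPoisson

open Filter Topology VectorField

/-! ### Linear algebra of the coupling form and the volume form -/

section Pointwise

variable {E : Type*} [NormedAddCommGroup E] [NormedSpace ℝ E] [FiniteDimensional ℝ E]
  {M : Type*} [TopologicalSpace M] [ChartedSpace E M] [IsManifold 𝓘(ℝ, E) ∞ M]
  {k : ℕ} {F : RegularFoliation E M k}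

namespace CouplingStructure

theorem conn_of_mem (C : CouplingStructure F) {x : M} (v : F.tangent x) :
    C.conn x (v : TangentSpace 𝓘(ℝ, E) x) = v :=
  Submodule.projectionOnto_apply_left _ _

theorem conn_of_mem_horizontal (C : CouplingStructure F) {x : M} {v : TangentSpace 𝓘(ℝ, E) x}
    (hv : v ∈ C.horizontal x) : C.conn x v = 0 :=
  (Submodule.projectionOnto_apply_eq_zero_iff _).2 hv

theorem verProj_apply (C : CouplingStructure F) (x : M) (v : TangentSpace 𝓘(ℝ, E) x) :
    C.verProj x v = C.conn x v := rfl

theorem verProj_mem (C : CouplingStructure F) (x : M) (v : TangentSpace 𝓘(ℝ, E) x) :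
    C.verProj x v ∈ F.tangent x := (C.conn x v).2

theorem verProj_of_mem (C : CouplingStructure F) {x : M} {v : TangentSpace 𝓘(ℝ, E) x}
    (hv : v ∈ F.tangent x) : C.verProj x v = v :=
  congrArg Subtype.val (C.conn_of_mem ⟨v, hv⟩)

theorem verProj_of_mem_horizontal (C : CouplingStructure F) {x : M} {v : TangentSpace 𝓘(ℝ, E) x}
    (hv : v ∈ C.horizontal x) : C.verProj x v = 0 := by
  rw [verProj_apply, C.conn_of_mem_horizontal hv]; rfl

theorem horProj_apply (C : CouplingStructure F) (x : M) (v : TangentSpace 𝓘(ℝ, E) x) :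
    C.horProj x v = v - C.verProj x v := rfl

theorem horProj_of_mem_tangent (C : CouplingStructure F) {x : M} {v : TangentSpace 𝓘(ℝ, E) x}
    (hv : v ∈ F.tangent x) : C.horProj x v = 0 := by
  rw [horProj_apply, C.verProj_of_mem hv, sub_self]

theorem horProj_add_verProj (C : CouplingStructure F) (x : M) (v : TangentSpace 𝓘(ℝ, E) x) :
    C.horProj x v + C.verProj x v = v := by
  rw [horProj_apply, sub_add_cancel]

theorem sharp_mem_horizontal (C : CouplingStructure F) {x : M}
    {α : Module.Dual ℝ (TangentSpace 𝓘(ℝ, E) x)} (hα : α ∈ (F.tangent x).dualAnnihilator) :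
    sharp (C.bivector x) α ∈ C.horizontal x :=
  Submodule.mem_map_of_mem hα

theorem couplingForm_apply (C : CouplingStructure F) (x : M) (v : Fin 2 → TangentSpace 𝓘(ℝ, E) x) :
    C.couplingForm x v = C.couplingFlat x (v 0) (v 1) := rfl

theorem couplingFlat_swap (C : CouplingStructure F) (x : M) (u v : TangentSpace 𝓘(ℝ, E) x) :
    C.couplingFlat x u v = - C.couplingFlat x v u :=
  twoForm_swap (C.couplingForm x) u v

theorem couplingFlat_sharp (C : CouplingStructure F) {x : M}
    {α : Module.Dual ℝ (TangentSpace 𝓘(ℝ, E) x)} (hα : α ∈ (F.tangent x).dualAnnihilator) :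
    C.couplingFlat x (sharp (C.bivector x) α) = - α := by
  have h : (C.horProj x).codRestrict (C.horizontal x) (C.horProj_mem x) (sharp (C.bivector x) α) =
      C.sharpEquiv x ⟨α, hα⟩ := by
    apply Subtype.ext
    rw [coe_sharpEquiv, C.sharp_horBivector_of_mem hα]
    exact C.horProj_of_mem (C.sharp_mem_horizontal hα)
  simp [couplingFlat, h]

theorem couplingFlat_of_mem (C : CouplingStructure F) {x : M} {v : TangentSpace 𝓘(ℝ, E) x}
    (hv : v ∈ F.tangent x) : C.couplingFlat x v = 0 := by
  have h : (C.horProj x).codRestrict (C.horizontal x) (C.horProj_mem x) v = 0 :=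
    Subtype.ext (C.horProj_of_mem_tangent hv)
  simp [couplingFlat, h]

theorem couplingFlat_apply_of_mem (C : CouplingStructure F) {x : M} (u : TangentSpace 𝓘(ℝ, E) x)
    {v : TangentSpace 𝓘(ℝ, E) x} (hv : v ∈ F.tangent x) : C.couplingFlat x u v = 0 := by
  rw [couplingFlat_swap, C.couplingFlat_of_mem hv]; simp

theorem couplingFlat_nondegenerate (C : CouplingStructure F) {x : M} {u : TangentSpace 𝓘(ℝ, E) x}
    (hu : u ∈ C.horizontal x) (h : ∀ w ∈ C.horizontal x, C.couplingFlat x u w = 0) : u = 0 := by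
  obtain ⟨α, hα, rfl⟩ := hu
  have h0 : α = 0 := LinearMap.ext fun w => by
    have := h _ (C.horProj_mem x w)
    rw [C.couplingFlat_sharp hα, LinearMap.neg_apply, neg_eq_zero, C.apply_horProj_of_mem hα] at this
    exact this
  rw [h0, map_zero]

theorem finrank_horizontal (C : CouplingStructure F) (x : M) :
    Module.finrank ℝ (C.horizontal x) + k = Module.finrank ℝ E := by
  have h2 := Submodule.finrank_add_eq_of_isCompl (C.isCompl x)
  rw [F.finrank_eq] at h2
  exact h2

/-- Nondegeneracy of `σ` on `ℍ` forces the rank of `ℍ` to be even, so the truncated division in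
`halfRank` is exact and `σ^l` has top degree on `ℍ`. -/
theorem exists_transversalForm_ne_zero (C : CouplingStructure F) (x : M) :
    2 * C.halfRank + k = Module.finrank ℝ E ∧
      ∃ u : Fin (2 * C.halfRank) → TangentSpace 𝓘(ℝ, E) x,
        (∀ i, u i ∈ C.horizontal x) ∧ C.transversalForm x u ≠ 0 := by
  obtain ⟨l, hl, hu⟩ := exists_wedgePow_ne_zero (C.couplingForm x) _ (C.horizontal x) rfl
    fun u hu h => C.couplingFlat_nondegenerate hu h
  have h1 := C.finrank_horizontal x
  have h2 : l = C.halfRank := by rw [halfRank]; omega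
  subst h2
  exact ⟨by omega, hu⟩

end CouplingStructure

/-- In every term of the permutation sum the vector `z` sits in an argument of `a` or of `b`. -/
theorem wedge_eq_zero_of_forall {W : Type*} [AddCommGroup W] [Module ℝ W] {p q : ℕ}
    (a : AltForm W p) (b : AltForm W q) (z : W) (ha : ∀ u i, u i = z → a u = 0)
    (hb : ∀ u i, u i = z → b u = 0) (v : Fin (p + q) → W) (i : Fin (p + q)) (hi : v i = z) :
    wedge a b v = 0 := by
  have h := factorial_mul_wedge_apply a b v
  rw [Finset.sum_eq_zero] at h
  · exact (mul_eq_zero.1 h).resolve_left (by positivity)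
  · intro π _
    obtain ⟨j, rfl⟩ := π.surjective i
    induction j using Fin.addCases with
    | left j => rw [ha _ j hi]; simp
    | right j => rw [hb _ j hi]; simp

theorem wedgePow_eq_zero_of_forall {W : Type*} [AddCommGroup W] [Module ℝ W] (s : AltForm W 2)
    (z : W) (hs : ∀ u i, u i = z → s u = 0) (l : ℕ) (v : Fin (2 * l) → W) (i : Fin (2 * l))
    (hi : v i = z) : wedgePow s l v = 0 := by
  induction l with
  | zero => exact i.elim0
  | succ l ih => exact wedge_eq_zero_of_forall (wedgePow s l) s z ih hs v i hi

namespace CouplingStructure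

theorem transversalForm_eq_zero (C : CouplingStructure F) {x : M}
    {v : Fin (2 * C.halfRank) → TangentSpace 𝓘(ℝ, E) x} {i : Fin (2 * C.halfRank)}
    (hi : v i ∈ F.tangent x) : C.transversalForm x v = 0 := by
  refine wedgePow_eq_zero_of_forall _ (v i) (fun u j hj => ?_) _ v i rfl
  rw [couplingForm_apply]
  rw [← hj] at hi
  revert hi
  refine Fin.cases (fun hi => ?_) (fun j hi => ?_) j
  · rw [C.couplingFlat_of_mem hi]; rfl
  · rw [Subsingleton.elim j 0] at hi
    exact C.couplingFlat_apply_of_mem _ hi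

theorem extendForm_apply (C : CouplingStructure F) {p : ℕ} (μ : F.LeafForm p) (x : M)
    (v : Fin p → TangentSpace 𝓘(ℝ, E) x) : C.extendForm μ x v = μ x fun i => C.conn x (v i) := rfl

theorem extendForm_coe (C : CouplingStructure F) {p : ℕ} (μ : F.LeafForm p) (x : M)
    (v : Fin p → F.tangent x) : C.extendForm μ x (fun i => (v i : TangentSpace 𝓘(ℝ, E) x)) = μ x v := by
  rw [extendForm_apply]
  simp only [conn_of_mem]

theorem extendForm_eq_zero (C : CouplingStructure F) {p : ℕ} (μ : F.LeafForm p) {x : M}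
    {v : Fin p → TangentSpace 𝓘(ℝ, E) x} {i : Fin p}
    (hi : v i ∈ C.horizontal x) : C.extendForm μ x v = 0 := by
  rw [extendForm_apply]
  exact (μ x).map_coord_zero i (C.conn_of_mem_horizontal hi)

theorem volume_append (C : CouplingStructure F) (τ : F.LeafForm k) {x : M}
    {u : Fin (2 * C.halfRank) → TangentSpace 𝓘(ℝ, E) x} (v : Fin k → TangentSpace 𝓘(ℝ, E) x)
    (hu : ∀ i, u i ∈ C.horizontal x) : C.volume τ x (Fin.append u v) =
      C.transversalForm x u * C.extendForm τ x v :=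
  wedge_append_of_right _ _ _ _ fun _ i j h => C.extendForm_eq_zero τ (i := i) (h ▸ hu j)

theorem volume_ne_zero (C : CouplingStructure F) {τ : F.LeafForm k} {x : M} (hτ : τ x ≠ 0) :
    C.volume τ x ≠ 0 := by
  obtain ⟨-, u, hu, hu0⟩ := C.exists_transversalForm_ne_zero x
  obtain ⟨v, hv⟩ : ∃ v, τ x v ≠ 0 := by
    by_contra! h
    exact hτ (AlternatingMap.ext h)
  intro h0
  have := C.volume_append τ (fun i => (v i : TangentSpace 𝓘(ℝ, E) x)) hu
  rw [h0, extendForm_coe] at this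
  exact mul_ne_zero hu0 hv this.symm

end CouplingStructure

end Pointwise

/-! ### Conormal one-forms and adapted frames -/

section SmoothGeometry

variable {E : Type*} [NormedAddCommGroup E] [NormedSpace ℝ E] [FiniteDimensional ℝ E]
  {M : Type*} [TopologicalSpace M] [T2Space M] [ChartedSpace E M] [IsManifold 𝓘(ℝ, E) ∞ M]
  {k : ℕ} {F : RegularFoliation E M k}

namespace RegularFoliation

/-- The vector field on `M` given by a section of `𝕍`. -/
def Section.field (Y : F.Section) : VField E M := fun x => (Y.val x : TangentSpace 𝓘(ℝ, E) x)

theorem Section.field_mem (Y : F.Section) (x : M) : Y.field x ∈ F.tangent x := (Y.val x).2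

theorem Section.smooth_field (Y : F.Section) : IsSmoothVField Y.field := Y.smooth

theorem exists_section_eq (F : RegularFoliation E M k) {x : M} (v : F.tangent x) :
    ∃ Y : F.Section, Y.val x = v := by
  obtain ⟨X, hX, hX', hv⟩ := F.smooth x v v.2
  exact ⟨⟨fun y => ⟨X y, hX' y⟩, hX⟩, Subtype.ext hv⟩

/-- Sections of `𝕍` complete the given transversal fields to a frame. At nearby points these `k`
sections still span the leaf tangent space, so the dual one-forms of the transversal fields
annihilate it. -/
theorem exists_frame (F : RegularFoliation E M k) {x : M} {m : ℕ} {h : Fin m → VField E M}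
    (hh : ∀ i, IsSmoothVField (h i)) {U : Submodule ℝ (TangentSpace 𝓘(ℝ, E) x)}
    (hU : Disjoint U (F.tangent x)) (hm : m + k = Module.finrank ℝ E)
    (hli : LinearIndependent ℝ fun i => h i x) (hmem : ∀ i, h i x ∈ U) :
    ∃ (v : Fin k → F.Section) (ε : Fin m ⊕ Fin k → CovectorField E M),
      IsFrameNear x (Sum.elim h fun j => (v j).field) ε ∧
      ∀ᶠ y in 𝓝 x, ∀ u ∈ F.tangent y, ∀ i, ε (Sum.inl i) y u = 0 := by
  set bV := Module.finBasisOfFinrankEq ℝ (F.tangent x) (F.finrank_eq x)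
  choose v hv using fun j => F.exists_section_eq (bV j)
  have hli2 : LinearIndependent ℝ fun j => (v j).field x := by
    rw [show (fun j => (v j).field x) = (F.tangent x).subtype ∘ bV from
      funext fun j => congrArg Subtype.val (hv j)]
    exact bV.linearIndependent.map' (F.tangent x).subtype (Submodule.ker_subtype _)
  have hdis : Disjoint (Submodule.span ℝ (Set.range fun i => h i x))
      (Submodule.span ℝ (Set.range fun j => (v j).field x)) := by
    refine hU.mono (Submodule.span_le.2 ?_) (Submodule.span_le.2 ?_)
    · rintro _ ⟨i, rfl⟩; exact hmem i
    · rintro _ ⟨j, rfl⟩; exact (v j).field_mem x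
  obtain ⟨ε, hε⟩ := exists_isFrameNear (x := x) (b := Sum.elim h fun j => (v j).field)
    (by rintro (i | j); exacts [hh i, (v j).smooth_field]) (by simpa using hm) (by
      rw [show (fun s => (Sum.elim h fun j => (v j).field) s x) =
        Sum.elim (fun i => h i x) fun j => (v j).field x from
          funext fun s => by rcases s with i | j <;> rfl]
      exact hli.sum_type hli2 hdis)
  refine ⟨v, ε, hε, ?_⟩
  filter_upwards [hε.dual] with y hy u hu i
  have hli3 : LinearIndependent ℝ fun j => (v j).val y := by
    refine Fintype.linearIndependent_iff.2 fun c hc j => ?_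
    have h1 : ∑ j, c j • (v j).field y = 0 := by
      have := congrArg (F.tangent y).subtype hc
      simpa using! this
    have h2 := congrArg (ε (Sum.inr j) y) h1
    rw [map_sum, map_zero] at h2
    have h3 : ∀ j', ε (Sum.inr j) y ((v j').field y) = if j = j' then 1 else 0 := fun j' => by
      simpa using hy (Sum.inr j) (Sum.inr j')
    simpa [h3] using h2
  let b := Module.Basis.mk hli3 (hli3.span_eq_top_of_card_eq_finrank' (by
    rw [F.finrank_eq]; simp)).ge
  have hu' : u = ∑ j, b.repr ⟨u, hu⟩ j • (v j).field y := by
    have := congrArg (F.tangent y).subtype (b.sum_repr ⟨u, hu⟩)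
    rw [map_sum] at this
    simp only [map_smul, b, Module.Basis.coe_mk] at this
    exact this.symm
  rw [hu', map_sum]
  refine Finset.sum_eq_zero fun j _ => ?_
  have h4 : ε (Sum.inl i) y ((v j).field y) = 0 := by simpa using hy (Sum.inl i) (Sum.inr j)
  rw [map_smul, h4, smul_zero]

/-- Conormal covectors extend to smooth conormal one-forms. -/
theorem exists_conormal_eq (F : RegularFoliation E M k) {x : M}
    {α : Module.Dual ℝ (TangentSpace 𝓘(ℝ, E) x)} (hα : α ∈ (F.tangent x).dualAnnihilator) :
    ∃ β : CovectorField E M, IsSmoothCovectorField β ∧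
      (∀ y, β y ∈ (F.tangent y).dualAnnihilator) ∧ β x = α := by
  obtain ⟨U, hU⟩ := (F.tangent x).exists_isCompl
  set bU := Module.finBasis ℝ U
  choose h hh hx using fun i => exists_isSmoothVField_apply_eq (E := E) (bU i : TangentSpace 𝓘(ℝ, E) x)
  have hd := Submodule.finrank_add_eq_of_isCompl hU
  rw [F.finrank_eq] at hd
  obtain ⟨v, ε, hε, hε'⟩ := F.exists_frame hh hU.disjoint.symm ((add_comm _ _).trans hd) (by
      rw [show (fun i => h i x) = U.subtype ∘ bU from funext hx]
      exact bU.linearIndependent.map' U.subtype (Submodule.ker_subtype _)) fun i => by rw [hx]; exact (bU i).2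
  -- The one-forms `ε (Sum.inl i)` are known to be conormal only near `x`; cutting them off makes
  -- the extension conormal on all of `M`.
  obtain ⟨χ, hχ, h1, hs⟩ := exists_bump (E := E) hε'
  refine ⟨fun y => χ y • ∑ i, α (h i x) • ε (Sum.inl i) y, ?_, fun y => ?_, ?_⟩
  · exact IsSmoothCovectorField.smul hχ (IsSmoothCovectorField.sum fun i _ =>
      (hε.smooth_dual _).smul (IsSmoothFun.const _))
  · refine (Submodule.mem_dualAnnihilator _).2 fun u hu => ?_
    by_cases hy : y ∈ tsupport χ
    · have := hs hy u hu
      simp [LinearMap.sum_apply, this]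
    · change (χ y • ∑ i, α (h i x) • ε (Sum.inl i) y) u = 0
      rw [image_eq_zero_of_notMem_tsupport hy, zero_smul, LinearMap.zero_apply]
  · refine LinearMap.ext fun u => ?_
    conv_rhs => rw [hε.expand.self_of_nhds u, map_sum, Fintype.sum_sum_type]
    change (χ x • ∑ i, α (h i x) • ε (Sum.inl i) x) u = _
    rw [h1.self_of_nhds, one_smul, LinearMap.sum_apply]
    have h0 : ∀ j, α ((v j).field x) = 0 := fun j =>
      (Submodule.mem_dualAnnihilator _).1 hα _ ((v j).field_mem x)
    simp [h0, mul_comm]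

end RegularFoliation

namespace CouplingStructure

/-- The horizontal lift `Π^♯ α` of a one-form. -/
abbrev sharpField (C : CouplingStructure F) (α : CovectorField E M) : VField E M :=
  fun x => sharp (C.bivector x) (α x)

theorem smooth_sharpField (C : CouplingStructure F) {α : CovectorField E M}
    (hα : IsSmoothCovectorField α) : IsSmoothVField (C.sharpField α) :=
  C.isPoisson.smooth.sharp hα

/-- A local frame consisting of horizontal fields `Π^♯ α_i` and of sections of `𝕍`. -/
structure IsAdaptedFrame (C : CouplingStructure F) (x : M) {m : ℕ} (α : Fin m → CovectorField E M)
    (v : Fin k → F.Section) (ε : Fin m ⊕ Fin k → CovectorField E M) : Prop where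
  smooth : ∀ i, IsSmoothCovectorField (α i)
  conormal : ∀ i y, α i y ∈ (F.tangent y).dualAnnihilator
  frame : IsFrameNear x (Sum.elim (fun i => C.sharpField (α i)) fun j => (v j).field) ε

/-- A basis of `ℍ` at `x` consists of vectors `Π^♯ a_i` with conormal `a_i`. When the `a_i` are
extended to conormal one-forms, the fields `Π^♯ α_i` are horizontal on all of `M` and not only at
`x`. -/
theorem exists_isAdaptedFrame (C : CouplingStructure F) (x : M) :
    ∃ (α : Fin (2 * C.halfRank) → CovectorField E M) (v : Fin k → F.Section)
      (ε : Fin (2 * C.halfRank) ⊕ Fin k → CovectorField E M), C.IsAdaptedFrame x α v ε := by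
  have hl := (C.exists_transversalForm_ne_zero x).1
  let b := Module.finBasisOfFinrankEq ℝ (C.horizontal x)
    (show Module.finrank ℝ _ = 2 * C.halfRank by have := C.finrank_horizontal x; omega)
  choose a ha hab using fun i => (b i).2
  choose α hα hα' hx using fun i => F.exists_conormal_eq (ha i)
  obtain ⟨v, ε, hε, -⟩ := F.exists_frame (h := fun i => C.sharpField (α i))
    (fun i => C.smooth_sharpField (hα i))
    (C.isCompl x).disjoint hl (by
      rw [show (fun i => C.sharpField (α i) x) = (C.horizontal x).subtype ∘ b from
          funext fun i => (congrArg (sharp (C.bivector x)) (hx i)).trans (hab i)]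
      exact b.linearIndependent.map' (C.horizontal x).subtype (Submodule.ker_subtype _))
    fun i => C.sharp_mem_horizontal (hα' i x)
  exact ⟨α, v, ε, hα, hα', hε⟩

end CouplingStructure

end SmoothGeometry

end CouplingPoisson

end

noncomputable section

namespace CouplingPoisson

open Filter Topology VectorField

/-! ### Smoothness of the projections, of the coupling form and of the volume form -/

section Smoothness

variable {E : Type*} [NormedAddCommGroup E] [NormedSpace ℝ E] [FiniteDimensional ℝ E]
  {M : Type*} [TopologicalSpace M] [T2Space M] [ChartedSpace E M] [IsManifold 𝓘(ℝ, E) ∞ M]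
  {k : ℕ} {F : RegularFoliation E M k}

theorem IsSmoothForm.wedge {p q : ℕ} {a : DForm E M p} {b : DForm E M q} (ha : IsSmoothForm a)
    (hb : IsSmoothForm b) : IsSmoothForm fun x => wedge (a x) (b x) := by
  intro X hX
  have h : ∀ x, CouplingPoisson.wedge (a x) (b x) (fun i => X i x) =
      ((p.factorial * q.factorial : ℕ) : ℝ)⁻¹ * ∑ π : Equiv.Perm (Fin (p + q)),
        ((Equiv.Perm.sign π : ℤ) : ℝ) * (a x (fun i => X (π (Fin.castAdd q i)) x) *
          b x (fun i => X (π (Fin.natAdd p i)) x)) := fun x => by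
    rw [← factorial_mul_wedge_apply (a x) (b x) fun i => X i x, inv_mul_cancel_left₀ (by positivity)]
  simp only [h]
  exact (IsSmoothFun.const _).mul (IsSmoothFun.sum fun π _ => (IsSmoothFun.const _).mul
    ((ha _ fun i => hX _).mul (hb _ fun i => hX _)))

theorem IsSmoothForm.wedgePow {s : DForm E M 2} (hs : IsSmoothForm s) (l : ℕ) :
    IsSmoothForm fun x => wedgePow (s x) l := by
  induction l with
  | zero => exact fun X _ => IsSmoothFun.const 1
  | succ l ih => exact ih.wedge hs

theorem IsFrameNear.exists_basis {x : M} {ι : Type*} [Fintype ι] [DecidableEq ι] {b : ι → VField E M}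
    {ε : ι → CovectorField E M} (h : IsFrameNear x b ε) :
    ∃ B : Module.Basis ι ℝ (TangentSpace 𝓘(ℝ, E) x), (∀ i, B i = b i x) ∧
      ∀ i, B.coord i = ε i x := by
  have hd := h.dual.self_of_nhds
  have he := h.expand.self_of_nhds
  have hli : LinearIndependent ℝ fun i => b i x := by
    refine Fintype.linearIndependent_iff.2 fun c hc j => ?_
    have h2 := congrArg (ε j x) hc
    simpa [hd] using h2
  let B := Module.Basis.mk hli (fun u _ => by
    rw [he u]
    exact Submodule.sum_mem _ fun i _ =>
      Submodule.smul_mem _ _ (Submodule.subset_span (Set.mem_range_self i)))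
  have hB : ∀ i, B i = b i x := fun i => Module.Basis.mk_apply _ _ i
  refine ⟨B, hB, fun i => B.ext fun j => ?_⟩
  rw [Module.Basis.coord_apply, B.repr_self, hB, hd, Finsupp.single_apply]
  simp [eq_comm]

namespace CouplingStructure

variable {C : CouplingStructure F} {x : M} {m : ℕ} {α : Fin m → CovectorField E M}
  {v : Fin k → F.Section} {ε : Fin m ⊕ Fin k → CovectorField E M}

theorem IsAdaptedFrame.verProj_eq (h : C.IsAdaptedFrame x α v ε) :
    ∀ᶠ y in 𝓝 x, ∀ u, C.verProj y u = ∑ j, ε (Sum.inr j) y u • (v j).field y := by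
  filter_upwards [h.frame.expand] with y hy u
  conv_lhs => rw [hy u]
  have h0 : ∀ i, C.verProj y (C.sharpField (α i) y) = 0 := fun i =>
    C.verProj_of_mem_horizontal (C.sharp_mem_horizontal (h.conormal i y))
  have h1 : ∀ j, C.verProj y ((v j).field y) = (v j).field y := fun j =>
    C.verProj_of_mem ((v j).field_mem y)
  simp [h0, h1]

theorem IsAdaptedFrame.horProj_eq (h : C.IsAdaptedFrame x α v ε) :
    ∀ᶠ y in 𝓝 x, ∀ u, C.horProj y u = ∑ i, ε (Sum.inl i) y u • C.sharpField (α i) y := by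
  filter_upwards [h.frame.expand, h.verProj_eq] with y hy hy' u
  rw [horProj_apply, hy', sub_eq_iff_eq_add]
  refine (hy u).trans ?_
  rw [Fintype.sum_sum_type]
  rfl

theorem IsAdaptedFrame.exists_tangent_basis (h : C.IsAdaptedFrame x α v ε) :
    ∃ B : Module.Basis (Fin k) ℝ (F.tangent x), (∀ j, B j = (v j).val x) ∧
      ∀ j u, B.coord j u = ε (Sum.inr j) x u := by
  have hd : ∀ j j', ε (Sum.inr j) x ((v j').val x) = if j = j' then 1 else 0 := fun j j' => by
    simpa using! h.frame.dual.self_of_nhds (Sum.inr j) (Sum.inr j')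
  have hli : LinearIndependent ℝ fun j => (v j).val x := by
    refine Fintype.linearIndependent_iff.2 fun c hc j => ?_
    have h2 := congrArg (ε (Sum.inr j) x ∘ₗ (F.tangent x).subtype) hc
    simpa [hd] using h2
  let B := Module.Basis.mk hli (hli.span_eq_top_of_card_eq_finrank' (by
    rw [F.finrank_eq]; simp)).ge
  have hB : ∀ j, B j = (v j).val x := fun j => Module.Basis.mk_apply _ _ j
  have h3 : ∀ j, B.coord j = ε (Sum.inr j) x ∘ₗ (F.tangent x).subtype := fun j =>
    B.ext fun j' => by
      rw [Module.Basis.coord_apply, B.repr_self, LinearMap.comp_apply, hB, Submodule.subtype_apply, hd,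
        Finsupp.single_apply]
      simp [eq_comm]
  exact ⟨B, hB, fun j u => by rw [h3]; rfl⟩

theorem IsAdaptedFrame.exists_horizontal_basis (h : C.IsAdaptedFrame x α v ε)
    (hm : m + k = Module.finrank ℝ E) :
    ∃ B : Module.Basis (Fin m) ℝ (C.horizontal x), ∀ i, (B i : TangentSpace 𝓘(ℝ, E) x) =
      C.sharpField (α i) x := by
  let g : Fin m → C.horizontal x := fun i =>
    ⟨C.sharpField (α i) x, C.sharp_mem_horizontal (h.conormal i x)⟩
  have hd : ∀ i i', ε (Sum.inl i) x (g i') = if i = i' then 1 else 0 := fun j j' => by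
    simpa using! h.frame.dual.self_of_nhds (Sum.inl j) (Sum.inl j')
  have hli : LinearIndependent ℝ g := by
    refine Fintype.linearIndependent_iff.2 fun c hc j => ?_
    have h2 := congrArg (ε (Sum.inl j) x ∘ₗ (C.horizontal x).subtype) hc
    simpa [hd] using h2
  have hf := C.finrank_horizontal x
  let B := Module.Basis.mk hli (hli.span_eq_top_of_card_eq_finrank' (by
    rw [Fintype.card_fin]; omega)).ge
  exact ⟨B, fun i => congrArg Subtype.val (Module.Basis.mk_apply _ _ i)⟩

variable (C)

/-- The splitting is defined pointwise; its smoothness is read off from an adapted frame, in which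
the projection is given by the vertical part of the dual coframe. -/
theorem smooth_verProj {X : VField E M} (hX : IsSmoothVField X) :
    IsSmoothVField fun x => C.verProj x (X x) := fun x => by
  obtain ⟨α, v, ε, h⟩ := C.exists_isAdaptedFrame x
  have h1 : IsSmoothVField fun y => ∑ j, ε (Sum.inr j) y (X y) • (v j).field y :=
    IsSmoothVField.sum fun j _ => IsSmoothVField.smul (h.frame.smooth_dual _ _ hX) (v j).smooth_field
  exact (h1.at x).congr (h.verProj_eq.mono fun y hy => hy _)

theorem smooth_horProj {X : VField E M} (hX : IsSmoothVField X) :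
    IsSmoothVField fun x => C.horProj x (X x) :=
  hX.sub (C.smooth_verProj hX)

/-- The vertical part of a smooth vector field, as a section of `𝕍`. -/
def connSection {X : VField E M} (hX : IsSmoothVField X) : F.Section :=
  ⟨fun x => C.conn x (X x), C.smooth_verProj hX⟩

theorem smooth_extendForm {p : ℕ} {μ : F.LeafForm p} (hμ : F.IsSmoothLeafForm μ) :
    IsSmoothForm (C.extendForm μ) :=
  fun _ hX => hμ fun i => C.connSection (hX i)

/-- In an adapted frame `σ(X, Y) = -∑ ε_i(X) α_i(Y)`, the sum running over the horizontal indices,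
because `σ^♭ Π^♯ α_i = -α_i`. -/
theorem smooth_couplingFlat {X Y : VField E M} (hX : IsSmoothVField X) (hY : IsSmoothVField Y) :
    IsSmoothFun E fun x => C.couplingFlat x (X x) (Y x) := fun x => by
  obtain ⟨α, v, ε, h⟩ := C.exists_isAdaptedFrame x
  have h1 : IsSmoothFun E fun y => ∑ i, ε (Sum.inl i) y (X y) * (- α i y (Y y)) :=
    IsSmoothFun.sum fun i _ => (h.frame.smooth_dual _ _ hX).mul (h.smooth i _ hY).neg
  refine (h1.at x).congr ?_
  filter_upwards [h.horProj_eq] with y hy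
  have h2 : C.couplingFlat y (X y) = C.couplingFlat y (C.horProj y (X y)) := by
    conv_lhs => rw [← C.horProj_add_verProj y (X y)]
    rw [map_add, C.couplingFlat_of_mem (C.verProj_mem y _), add_zero]
  rw [h2, hy, map_sum, LinearMap.sum_apply]
  refine Finset.sum_congr rfl fun i _ => ?_
  rw [map_smul, C.couplingFlat_sharp (h.conormal i y)]
  rfl

theorem smooth_couplingForm : IsSmoothForm C.couplingForm :=
  fun _ hX => C.smooth_couplingFlat (hX 0) (hX 1)

theorem smooth_transversalForm : IsSmoothForm C.transversalForm :=
  C.smooth_couplingForm.wedgePow _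

theorem isVolumeForm_volume {τ : F.LeafForm k} (hτ : F.IsLeafwiseVolume τ) :
    IsVolumeForm (C.volume τ) :=
  ⟨C.smooth_transversalForm.wedge (C.smooth_extendForm hτ.1), fun x =>
    ⟨(C.exists_transversalForm_ne_zero x).1, C.volume_ne_zero (hτ.2 x)⟩⟩

end CouplingStructure

end Smoothness

end CouplingPoisson

end

noncomputable section

namespace CouplingPoisson

open Filter Topology VectorField

theorem altForm_sum_apply {U ι : Type*} [AddCommGroup U] [Module ℝ U] {m : ℕ} (s : Finset ι)
    (f : ι → AltForm U m) (v : Fin m → U) : (∑ i ∈ s, f i) v = ∑ i ∈ s, f i v := by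
  classical
  induction s using Finset.induction_on with
  | empty => rfl
  | insert i s hi ih => rw [Finset.sum_insert hi, Finset.sum_insert hi, AlternatingMap.add_apply, ih]

theorem exists_eq_smul_of_finrank_eq {U : Type*} [AddCommGroup U] [Module ℝ U]
    [FiniteDimensional ℝ U] {m : ℕ} (hU : Module.finrank ℝ U = m) {ζ : AltForm U m} (hζ : ζ ≠ 0)
    (f : AltForm U m) : ∃ c : ℝ, f = c • ζ := by
  let b := Module.finBasisOfFinrankEq ℝ U hU
  have h := ne_zero_apply_basis ζ hζ b
  refine ⟨f b / ζ b, ext_basis b ?_⟩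
  rw [AlternatingMap.smul_apply, smul_eq_mul, div_mul_cancel₀ _ h]

/-! ### Factoring a covector out of a form -/

section Factor

variable {W : Type*} [AddCommGroup W] [Module ℝ W] {m : ℕ}

/-- For fixed `u`, inserting `a u` in `D` gives on `U` a form of top degree, which is a multiple of
`ζ`; the factor is linear in `u` and is computed at one tuple `w0` with `ζ w0 ≠ 0`. The statement is
neutral in the two projections so as to yield both `θ` and `Λ`. -/
theorem exists_covector_factor [FiniteDimensional ℝ W] (a b : W →ₗ[ℝ] W) {U : Submodule ℝ W}
    (hb : ∀ w, b w ∈ U) (hU : Module.finrank ℝ U = m) {ζ : AltForm W m}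
    (hζb : ∀ w, ζ (fun j => b (w j)) = ζ w) (hζ : ζ ≠ 0) (D : AltForm W (m + 1)) :
    ∃ θ : Module.Dual ℝ W, (∀ w, a w = 0 → θ w = 0) ∧
      ∀ u w, D (Matrix.vecCons (a u) fun j => b (w j)) = θ u * ζ w := by
  obtain ⟨w0, hw0⟩ : ∃ w, ζ w ≠ 0 := by
    by_contra! h
    exact hζ (AlternatingMap.ext h)
  let θ : Module.Dual ℝ W := (ζ w0)⁻¹ •
    { toFun := fun u => D (Matrix.vecCons (a u) fun j => b (w0 j))
      map_add' := fun u u' => by rw [map_add, D.map_vecCons_add]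
      map_smul' := fun c u => by rw [map_smul, D.map_vecCons_smul]; rfl }
  have hθ : ∀ u, θ u = (ζ w0)⁻¹ * D (Matrix.vecCons (a u) fun j => b (w0 j)) := fun u => rfl
  refine ⟨θ, fun w hw => ?_, fun u w => ?_⟩
  · rw [hθ, hw, D.map_coord_zero 0 rfl, mul_zero]
  · have hζU : ζ.compLinearMap U.subtype ≠ 0 := fun h => hw0 (by
      rw [← hζb]
      exact congrArg (fun g : AltForm U m => g fun j => ⟨b (w0 j), hb _⟩) h)
    obtain ⟨c, hc⟩ := exists_eq_smul_of_finrank_eq hU hζU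
      ((D.curryLeft (a u)).compLinearMap U.subtype)
    have h : ∀ w : Fin m → W, D (Matrix.vecCons (a u) fun j => b (w j)) = c * ζ w := fun w => by
      rw [← hζb w]
      exact congrArg (fun g : AltForm U m => g fun j => ⟨b (w j), hb _⟩) hc
    rw [hθ, h, h, mul_comm c (ζ w0), inv_mul_cancel_left₀ hw0]

theorem wedgeCovector_vecCons {θ : Module.Dual ℝ W} {ζ : AltForm W m} (u : W) {w : Fin m → W}
    (hw : ∀ j, θ (w j) = 0) : wedgeCovector θ ζ (Matrix.vecCons u w) = θ u * ζ w := by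
  rw [wedgeCovector_apply, Fin.sum_univ_succ]
  simp [hw]

end Factor

/-! ### Rules for the Lie derivative -/

section LieDerivative

variable {E : Type*} [NormedAddCommGroup E] [NormedSpace ℝ E] [FiniteDimensional ℝ E]
  {M : Type*} [TopologicalSpace M] [T2Space M] [ChartedSpace E M] [IsManifold 𝓘(ℝ, E) ∞ M]

theorem IsSmoothForm.extD {m : ℕ} {η : DForm E M m} (hη : IsSmoothForm η) :
    IsSmoothForm (extD η) := by
  intro Y hY
  simp only [extD_apply hη hY]
  refine IsSmoothFun.add (IsSmoothFun.sum fun i _ => (IsSmoothFun.const _).mul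
    (IsSmoothFun.differential_apply (hη _ fun a => hY _) (hY i)))
    (IsSmoothFun.sum fun j _ => IsSmoothFun.sum fun i _ => (IsSmoothFun.const _).mul ?_)
  have h := hη (fun a => if j.succAbove a = i then
      VectorField.mlieBracket 𝓘(ℝ, E) (Y i) (Y j) else Y (j.succAbove a)) fun a => by
    split_ifs
    exacts [(hY i).mlieBracket (hY j), hY _]
  have e1 : ∀ a x, (if j.succAbove a = i then VectorField.mlieBracket 𝓘(ℝ, E) (Y i) (Y j) x
      else Y (j.succAbove a) x) = (if j.succAbove a = i then
      VectorField.mlieBracket 𝓘(ℝ, E) (Y i) (Y j) else Y (j.succAbove a)) x := fun a x => by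
    split_ifs <;> rfl
  simp only [e1]
  exact h

theorem extD_congr {m : ℕ} {η η' : DForm E M m} (hη : IsSmoothForm η) (hη' : IsSmoothForm η')
    {x : M} (h : ∀ᶠ y in 𝓝 x, η y = η' y) : extD η x = extD η' x := by
  refine AlternatingMap.ext fun v => ?_
  choose Y hY hv using fun i => exists_isSmoothVField_apply_eq (v i)
  obtain rfl : (fun i => Y i x) = v := funext hv
  rw [extD_apply hη hY, extD_apply hη' hY, h.self_of_nhds]
  congr 1
  refine Finset.sum_congr rfl fun i _ => ?_
  rw [differential_congr (f := fun y => η y fun a => Y (i.succAbove a) y)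
    (g := fun y => η' y fun a => Y (i.succAbove a) y) (h.mono fun y hy => by simp only [hy])]

theorem extD_const_mul_sum {m : ℕ} {ι : Type*} [Fintype ι] (c : ℝ) {η : ι → DForm E M m}
    (hη : ∀ i, IsSmoothForm (η i)) (x : M) :
    extD (fun y => c • ∑ i, η i y) x = c • ∑ i, extD (η i) x := by
  refine AlternatingMap.ext fun v => ?_
  choose Y hY hv using fun i => exists_isSmoothVField_apply_eq (v i)
  obtain rfl : (fun i => Y i x) = v := funext hv
  have hsm : IsSmoothForm fun y => c • ∑ i, η i y := fun X hX => by
    simp only [AlternatingMap.smul_apply, altForm_sum_apply, smul_eq_mul]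
    exact (IsSmoothFun.const _).mul (IsSmoothFun.sum fun i _ => hη i X hX)
  rw [extD_apply hsm hY]
  simp only [AlternatingMap.smul_apply, altForm_sum_apply, smul_eq_mul]
  simp only [extD_apply (hη _) hY, Finset.sum_add_distrib, mul_add]
  congr 1
  · rw [Finset.sum_comm, Finset.mul_sum]
    refine Finset.sum_congr rfl fun i _ => ?_
    rw [differential_const_mul _ ((IsSmoothFun.sum fun l _ => hη l _ fun a => hY _).at x),
      differential_sum _ fun l _ => (hη l _ fun a => hY _).at x]
    simp only [Finset.mul_sum]
    exact Finset.sum_congr rfl fun l _ => by ring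
  · rw [Finset.sum_comm, Finset.mul_sum]
    refine Finset.sum_congr rfl fun j _ => ?_
    rw [Finset.sum_comm, Finset.mul_sum]
    refine Finset.sum_congr rfl fun i _ => ?_
    simp only [Finset.mul_sum]
    exact Finset.sum_congr rfl fun l _ => by ring

theorem extD_zero {m : ℕ} {η : DForm E M m} (hη : ∀ x, η x = 0) (x : M) : extD η x = 0 := by
  refine AlternatingMap.ext fun v => ?_
  choose Y hY hv using fun i => exists_isSmoothVField_apply_eq (v i)
  have hsm : IsSmoothForm η := fun X _ => by
    simp only [hη, AlternatingMap.zero_apply]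
    exact IsSmoothFun.const 0
  obtain rfl : (fun i => Y i x) = v := funext hv
  rw [extD_apply hsm hY]
  simp only [hη, AlternatingMap.zero_apply, differential_const]
  simp

/-- The Lie derivative of a form is a form. -/
theorem exists_lieDeriv {m : ℕ} {η : DForm E M m} (hη : IsSmoothForm η) {X : VField E M}
    (hX : IsSmoothVField X) (x : M) : ∃ L : AltForm (TangentSpace 𝓘(ℝ, E) x) m,
      ∀ Y : Fin m → VField E M, (∀ i, IsSmoothVField (Y i)) →
        lieDerivApply X η Y x = L fun i => Y i x := by
  cases m with
  | zero =>
    refine ⟨AlternatingMap.constOfIsEmpty ℝ _ (Fin 0)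
      (differential E (fun y => η y Fin.elim0) x (X x)), fun Y _ => ?_⟩
    rw [lieDerivApply]
    simp only [Finset.univ_eq_empty, Finset.sum_empty, sub_zero,
      AlternatingMap.constOfIsEmpty_apply]
    congr 2
    funext y
    congr 1
    exact Subsingleton.elim _ _
  | succ m =>
    refine ⟨(extD η x).curryLeft (X x) + extD (insertField X η) x, fun Y hY => ?_⟩
    have h := extD_vecCons hη hX hY x
    rw [AlternatingMap.add_apply, AlternatingMap.curryLeft_apply_apply, h, sub_add_cancel]

/-- Cartan's formula without the term `d (i_X η)`. Degree zero is separate because there is nothing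
to insert into. -/
theorem extD_vecCons_of_insert_eq_zero {m : ℕ} {η : DForm E M m} (hη : IsSmoothForm η)
    {X : VField E M} (hX : IsSmoothVField X)
    (h0 : ∀ y (w : Fin m → TangentSpace 𝓘(ℝ, E) y) i, w i = X y → η y w = 0)
    {Y : Fin m → VField E M} (hY : ∀ i, IsSmoothVField (Y i)) (x : M) :
    extD η x (Matrix.vecCons (X x) fun i => Y i x) = lieDerivApply X η Y x := by
  cases m with
  | zero =>
    rw [← vecCons_field, extD_apply hη (forall_vecCons hX hY), lieDerivApply]
    simp only [Nat.reduceAdd, Fin.sum_univ_one, Finset.univ_eq_empty, Finset.sum_empty, sub_zero]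
    have : Finset.univ.filter (fun i : Fin 1 => i < 0) = ∅ := by simp
    rw [this, Finset.sum_empty, add_zero, Fin.val_zero, pow_zero, one_mul, Matrix.cons_val_zero]
    congr 2
  | succ m =>
    rw [extD_vecCons hη hX hY, extD_zero (η := insertField X η), AlternatingMap.zero_apply, sub_zero]
    exact fun y => AlternatingMap.ext fun w => h0 y _ 0 rfl

theorem lieDerivApply_congr {m : ℕ} (η : DForm E M m) {X X' : VField E M} {Y : Fin m → VField E M}
    {x : M} (h : ∀ᶠ y in 𝓝 x, X y = X' y) : lieDerivApply X η Y x = lieDerivApply X' η Y x := by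
  rw [lieDerivApply, lieDerivApply, h.self_of_nhds]
  simp only [fun i => mlieBracket_field_congr (Y := Y i) (Y' := Y i) h
    (Eventually.of_forall fun _ => rfl)]

theorem lieDerivApply_add {m : ℕ} (η : DForm E M m) {X X' : VField E M} (hX : IsSmoothVField X)
    (hX' : IsSmoothVField X') (Y : Fin m → VField E M) (x : M) :
    lieDerivApply (fun y => X y + X' y) η Y x = lieDerivApply X η Y x + lieDerivApply X' η Y x := by
  simp only [lieDerivApply, add_field_mlieBracket hX hX', map_add, AlternatingMap.map_update_add,
    Finset.sum_add_distrib]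
  ring

theorem lieDerivApply_smul {m : ℕ} (η : DForm E M m) {g : M → ℝ} {X : VField E M}
    (hg : IsSmoothFun E g) (hX : IsSmoothVField X) (Y : Fin m → VField E M) (x : M) :
    lieDerivApply (fun y => g y • X y) η Y x = g x * lieDerivApply X η Y x +
      ∑ i, differential E g x (Y i x) * η x (Function.update (fun j => Y j x) i (X x)) := by
  simp only [lieDerivApply, smul_field_mlieBracket hg hX, map_smul, AlternatingMap.map_update_add,
    AlternatingMap.map_update_smul, Finset.sum_add_distrib, smul_eq_mul, mul_sub, Finset.mul_sum,
    neg_mul, Finset.sum_neg_distrib]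
  ring

theorem lieDerivApply_sum {m : ℕ} (η : DForm E M m) {ι : Type*} (s : Finset ι) {X : ι → VField E M}
    (hX : ∀ i, IsSmoothVField (X i)) (Y : Fin m → VField E M) (x : M) :
    lieDerivApply (fun y => ∑ i ∈ s, X i y) η Y x = ∑ i ∈ s, lieDerivApply (X i) η Y x := by
  classical
  induction s using Finset.induction_on with
  | empty =>
    have h := lieDerivApply_smul η (IsSmoothFun.const (0 : ℝ))
      (X := fun y => (0 : TangentSpace 𝓘(ℝ, E) y))
      (fun y => (Bundle.contMDiff_zeroSection ℝ (fun y : M => TangentSpace 𝓘(ℝ, E) y)).contMDiffAt) Y x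
    simp only [differential_const, smul_zero] at h
    simpa using h
  | insert i s hi ih =>
    simp only [Finset.sum_insert hi]
    rw [lieDerivApply_add η (hX i) (IsSmoothVField.sum fun j _ => hX j), ih]

/-- Inserting a field in the first slot commutes with the Lie derivative up to a bracket. -/
theorem lieDerivApply_insertField {m : ℕ} (η : DForm E M (m + 1)) (A B : VField E M)
    (Y : Fin m → VField E M) (x : M) : lieDerivApply B (insertField A η) Y x =
      lieDerivApply B η (Matrix.vecCons A Y) x +
        η x (Matrix.vecCons (mlieBracket 𝓘(ℝ, E) B A x) fun i => Y i x) := by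
  simp only [lieDerivApply, Fin.sum_univ_succ, vecCons_field, insertField_apply]
  have h0 : Function.update (Matrix.vecCons (A x) fun i => Y i x) 0
      (mlieBracket 𝓘(ℝ, E) B A x) = Matrix.vecCons (mlieBracket 𝓘(ℝ, E) B A x) fun i => Y i x :=
    Fin.update_cons_zero _ _ _
  have h1 : ∀ (i : Fin m) c, Function.update (Matrix.vecCons (A x) fun i => Y i x) i.succ c =
      Matrix.vecCons (A x) (Function.update (fun i => Y i x) i c) := fun i c =>
    (Fin.cons_update _ _ _ _).symm
  simp only [Matrix.cons_val_zero, Matrix.cons_val_succ, h0, h1]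
  ring

/-- `X` acts on the functions `a(h_{r 0}, …)` as a derivation with `h_i ↦ c_i`. -/
def ActsAs {m : ℕ} {ι : Type*} (a : DForm E M m) (X : VField E M) (h : ι → VField E M) (x : M)
    (c : ι → TangentSpace 𝓘(ℝ, E) x) : Prop :=
  ∀ r : Fin m → ι, differential E (fun y => a y fun i => h (r i) y) x (X x) =
    ∑ i, a x (Function.update (fun j => h (r j) x) i (c (r i)))

/-- The Leibniz rule holds for each term of the permutation sum. The vectors `c i` are not required
to be the brackets `[X, h i]`: this leaves room for a correction when `X` does not preserve the
two-form. -/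
theorem ActsAs.wedge {p q : ℕ} {ι : Type*} {a : DForm E M p} {b : DForm E M q} {X : VField E M}
    {h : ι → VField E M} {x : M} {c : ι → TangentSpace 𝓘(ℝ, E) x} (ha : ActsAs a X h x c)
    (hb : ActsAs b X h x c) (hsa : IsSmoothForm a) (hsb : IsSmoothForm b)
    (hh : ∀ i, IsSmoothVField (h i)) : ActsAs (fun y => wedge (a y) (b y)) X h x c := by
  intro r
  have h0 : ((p.factorial * q.factorial : ℕ) : ℝ) ≠ 0 := by positivity
  apply mul_left_cancel₀ h0
  rw [factorial_mul_sum_wedge_update (a x) (b x) (fun j => h (r j) x) fun i => c (r i),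
    ← differential_const_mul _ ((hsa.wedge hsb _ fun i => hh (r i)).at x)]
  simp only [factorial_mul_wedge_apply]
  have hsab : ∀ π : Equiv.Perm (Fin (p + q)), IsSmoothFun E fun y =>
      a y (fun i => h (r (π (Fin.castAdd q i))) y) * b y fun i => h (r (π (Fin.natAdd p i))) y :=
    fun π => (hsa _ fun i => hh _).mul (hsb _ fun i => hh _)
  rw [differential_sum _ fun π _ => ((IsSmoothFun.const _).mul (hsab π)).at x]
  refine Finset.sum_congr rfl fun π _ => ?_
  rw [differential_const_mul _ ((hsab π).at x), differential_mul ((hsa _ fun i => hh _).at x)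
    ((hsb _ fun i => hh _).at x), ha fun i => r (π (Fin.castAdd q i)),
    hb fun i => r (π (Fin.natAdd p i))]
  ring

theorem ActsAs.wedgePow {ι : Type*} {s : DForm E M 2} {X : VField E M}
    {h : ι → VField E M} {x : M} {c : ι → TangentSpace 𝓘(ℝ, E) x} (hs : ActsAs s X h x c)
    (hss : IsSmoothForm s) (hh : ∀ i, IsSmoothVField (h i)) (l : ℕ) :
    ActsAs (fun y => wedgePow (s y) l) X h x c := by
  induction l with
  | zero =>
    intro r
    refine (congrArg (fun L => L (X x)) (differential_const (E := E) (1 : ℝ) x)).trans ?_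
    simp
  | succ l ih => exact ih.wedge hs (hss.wedgePow l) hss hh

end LieDerivative

end CouplingPoisson

end

/-! ### Existence and uniqueness of the divergence form and of the Reeb form -/

noncomputable section

namespace CouplingPoisson

open Filter Topology VectorField

variable {E : Type*} [NormedAddCommGroup E] [NormedSpace ℝ E] [FiniteDimensional ℝ E]
  {M : Type*} [TopologicalSpace M] [T2Space M] [ChartedSpace E M] [IsManifold 𝓘(ℝ, E) ∞ M]

/-- The covectors found pointwise form a smooth field: near each point `θ(X)` is the quotient of
`dζ(a X, w_1, …, w_m)` by `ζ(w_1, …, w_m)`, for smooth sections `w_j` of `U` on which `ζ` does not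
vanish there. -/
theorem exists_smooth_covector_factor {m : ℕ} {U : (x : M) → Submodule ℝ (TangentSpace 𝓘(ℝ, E) x)}
    {a b : (x : M) → TangentSpace 𝓘(ℝ, E) x →ₗ[ℝ] TangentSpace 𝓘(ℝ, E) x}
    (hsa : ∀ X : VField E M, IsSmoothVField X → IsSmoothVField fun x => a x (X x))
    (hb : ∀ x w, b x w ∈ U x) (hbU : ∀ x, ∀ w ∈ U x, b x w = w) (haU : ∀ x, ∀ w ∈ U x, a x w = 0)
    (hU : ∀ x, Module.finrank ℝ (U x) = m) {ζ : DForm E M m} (hζ : IsSmoothForm ζ)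
    (hζb : ∀ x w, ζ x (fun j => b x (w j)) = ζ x w)
    (hfr : ∀ x, ∃ w : Fin m → VField E M, (∀ j, IsSmoothVField (w j)) ∧ (∀ j y, w j y ∈ U y) ∧
      ζ x (fun j => w j x) ≠ 0) :
    ∃ θ : CovectorField E M, IsSmoothCovectorField θ ∧ (∀ x, ∀ w ∈ U x, θ x w = 0) ∧
      ∀ x u w, extD ζ x (Matrix.vecCons (a x u) fun j => b x (w j)) = θ x u * ζ x w := by
  have h0 : ∀ x, ζ x ≠ 0 := fun x h => by
    obtain ⟨w, -, -, hw⟩ := hfr x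
    exact hw (by rw [h]; rfl)
  choose θ hθ0 hθ using fun x =>
    exists_covector_factor (a x) (b x) (hb x) (hU x) (hζb x) (h0 x) (extD ζ x)
  refine ⟨θ, fun X hX x => ?_, fun x w hw => hθ0 x w (haU x w hw), hθ⟩
  obtain ⟨w, hw, hwU, hne⟩ := hfr x
  have h1 : IsSmoothFun E fun y => ζ y fun j => w j y := hζ w hw
  have h2 := hζ.extD _ (forall_vecCons (hsa X hX) hw)
  simp only [vecCons_field] at h2
  have h3 := (h2.at x).mul ((h1.at x).inv hne)
  refine h3.congr ?_
  filter_upwards [(h1.at x).continuousAt.eventually_ne hne] with y hy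
  have h4 := hθ y (X y) fun j => w j y
  simp only [hbU y _ (hwU _ y)] at h4
  rw [h4, mul_inv_cancel_right₀ hy]

variable {k : ℕ} {F : RegularFoliation E M k}

namespace CouplingStructure

variable (C : CouplingStructure F)

theorem extendForm_verProj {p : ℕ} (μ : F.LeafForm p) (x : M)
    (w : Fin p → TangentSpace 𝓘(ℝ, E) x) :
    C.extendForm μ x (fun j => C.verProj x (w j)) = C.extendForm μ x w :=
  C.extendForm_coe μ x fun j => C.conn x (w j)

/-- The slots are projected one at a time; each replacement changes the value by a term with a
vertical argument, which vanishes. -/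
theorem transversalForm_horProj (x : M) (w : Fin (2 * C.halfRank) → TangentSpace 𝓘(ℝ, E) x) :
    C.transversalForm x (fun j => C.horProj x (w j)) = C.transversalForm x w := by
  have h : ∀ s : Finset (Fin (2 * C.halfRank)),
      C.transversalForm x (fun j => if j ∈ s then C.horProj x (w j) else w j) =
        C.transversalForm x w := fun s => by
    induction s using Finset.induction_on with
    | empty => simp
    | insert i s hi ih =>
      have h1 : (fun j => if j ∈ insert i s then C.horProj x (w j) else w j) =
          Function.update (fun j => if j ∈ s then C.horProj x (w j) else w j) i
            (C.horProj x (w i)) := by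
        funext j
        by_cases hj : j = i
        · subst hj; simp
        · simp [hj]
      have h2 : Function.update (fun j => if j ∈ s then C.horProj x (w j) else w j) i (w i) =
          fun j => if j ∈ s then C.horProj x (w j) else w j := by
        rw [Function.update_eq_self_iff, if_neg hi]
      rw [h1, horProj_apply, AlternatingMap.map_update_sub, h2, ih, sub_eq_self]
      refine C.transversalForm_eq_zero (i := i) ?_
      rw [Function.update_self]
      exact C.verProj_mem x _
  simpa using h Finset.univ

/-- Sections of `𝕍` giving a basis at a point. -/
theorem exists_tangent_fields {τ : F.LeafForm k} (hτ : ∀ x, τ x ≠ 0) (x : M) :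
    ∃ v : Fin k → F.Section, C.extendForm τ x (fun j => (v j).field x) ≠ 0 := by
  obtain ⟨α, v, ε, h⟩ := C.exists_isAdaptedFrame x
  obtain ⟨B, hB, -⟩ := h.exists_tangent_basis
  refine ⟨v, ?_⟩
  have := ne_zero_apply_basis (τ x) (hτ x) B
  rw [show (B : Fin k → F.tangent x) = fun j => (v j).val x from funext hB] at this
  rw [← C.extendForm_coe] at this
  exact this

theorem exists_horizontal_fields (x : M) : ∃ w : Fin (2 * C.halfRank) → VField E M,
    (∀ j, IsSmoothVField (w j)) ∧ (∀ j y, w j y ∈ C.horizontal y) ∧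
      C.transversalForm x (fun j => w j x) ≠ 0 := by
  obtain ⟨-, u, hu, hne⟩ := C.exists_transversalForm_ne_zero x
  choose X hX hx using fun j => exists_isSmoothVField_apply_eq (u j)
  refine ⟨fun j y => C.horProj y (X j y), fun j => C.smooth_horProj (hX j),
    fun j y => C.horProj_mem y _, ?_⟩
  rw [C.transversalForm_horProj x fun j => X j x]
  simpa only [hx] using hne

theorem finrank_horizontal_eq (x : M) : Module.finrank ℝ (C.horizontal x) = 2 * C.halfRank := by
  have h1 := C.finrank_horizontal x
  have h2 := (C.exists_transversalForm_ne_zero x).1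
  omega

theorem exists_isDivergenceForm {τ : F.LeafForm k} (hτ : F.IsLeafwiseVolume τ) :
    ∃ θ, C.IsDivergenceForm τ θ := by
  obtain ⟨θ, h1, h2, h3⟩ := exists_smooth_covector_factor (a := C.horProj) (b := C.verProj)
    (U := F.tangent) (fun X hX => C.smooth_horProj hX) C.verProj_mem
    (fun x w hw => C.verProj_of_mem hw) (fun x w hw => C.horProj_of_mem_tangent hw) F.finrank_eq
    (C.smooth_extendForm hτ.1) (C.extendForm_verProj τ) (fun x => by
      obtain ⟨v, hv⟩ := C.exists_tangent_fields hτ.2 x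
      exact ⟨fun j => (v j).field, fun j => (v j).smooth_field, fun j => (v j).field_mem, hv⟩)
  exact ⟨θ, h1, h2, fun x => splitComponent_one_eq_wedgeCovector _ _ _ _ _ (h3 x)⟩

theorem exists_isReebForm : ∃ Λ, C.IsReebForm Λ := by
  obtain ⟨Λ, h1, h2, h3⟩ := exists_smooth_covector_factor (a := C.verProj) (b := C.horProj)
    (U := C.horizontal) (fun X hX => C.smooth_verProj hX) C.horProj_mem
    (fun x w hw => C.horProj_of_mem hw) (fun x w hw => C.verProj_of_mem_horizontal hw)
    C.finrank_horizontal_eq C.smooth_transversalForm C.transversalForm_horProj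
    C.exists_horizontal_fields
  refine ⟨Λ, h1, h2, fun x => ?_⟩
  rw [bidegree, splitComponent_compl]
  exact splitComponent_one_eq_wedgeCovector _ _ _ _ _ (h3 x)

variable {C}

/-- With one horizontal and `k` vertical arguments, only the choice of the first slot survives in
the bidegree component: any other choice projects a vertical vector to `ℍ`. As `τ_γ` does not vanish
on a vertical frame, this recovers `θ`, hence its uniqueness. -/
theorem IsDivergenceForm.mul_extendForm {τ : F.LeafForm k} {θ : CovectorField E M}
    (h : C.IsDivergenceForm τ θ) (x : M) {u : TangentSpace 𝓘(ℝ, E) x} (hu : u ∈ C.horizontal x)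
    {w : Fin k → TangentSpace 𝓘(ℝ, E) x} (hw : ∀ j, w j ∈ F.tangent x) :
    θ x u * C.extendForm τ x w = extD (C.extendForm τ) x (Matrix.vecCons u w) := by
  have h1 := DFunLike.congr_fun (h.eq x) (Matrix.vecCons u w)
  rw [wedgeCovector_vecCons u fun j => h.apply_tangent x _ (hw j)] at h1
  rw [← h1, bidegree, splitComponent_one, Fin.sum_univ_succ]
  rw [Finset.sum_eq_zero, add_zero]
  · simp [C.horProj_of_mem hu, C.verProj_of_mem (hw _)]
  · intro i _
    rw [AlternatingMap.map_coord_zero _ 0, mul_zero]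
    simp [C.horProj_of_mem_tangent (hw _)]

theorem IsReebForm.mul_transversalForm {Λ : CovectorField E M}
    (h : C.IsReebForm Λ) (x : M) {u : TangentSpace 𝓘(ℝ, E) x} (hu : u ∈ F.tangent x)
    {w : Fin (2 * C.halfRank) → TangentSpace 𝓘(ℝ, E) x} (hw : ∀ j, w j ∈ C.horizontal x) :
    Λ x u * C.transversalForm x w = extD C.transversalForm x (Matrix.vecCons u w) := by
  have h1 := DFunLike.congr_fun (h.eq x) (Matrix.vecCons u w)
  rw [wedgeCovector_vecCons u fun j => h.apply_horizontal x _ (hw j)] at h1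
  rw [← h1, bidegree, splitComponent_compl, splitComponent_one, Fin.sum_univ_succ]
  rw [Finset.sum_eq_zero, add_zero]
  · simp [C.verProj_of_mem hu, C.horProj_of_mem (hw _)]
  · intro i _
    rw [AlternatingMap.map_coord_zero _ 0, mul_zero]
    simp [C.verProj_of_mem_horizontal (hw _)]

theorem IsDivergenceForm.unique {τ : F.LeafForm k} (hτ : F.IsLeafwiseVolume τ)
    {θ θ' : CovectorField E M} (h : C.IsDivergenceForm τ θ) (h' : C.IsDivergenceForm τ θ') :
    θ = θ' := by
  funext x
  refine LinearMap.ext fun u => ?_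
  obtain ⟨v, hv⟩ := C.exists_tangent_fields hτ.2 x
  apply mul_right_cancel₀ hv
  rw [← C.horProj_add_verProj x u, map_add, map_add, h.apply_tangent x _ (C.verProj_mem x u),
    h'.apply_tangent x _ (C.verProj_mem x u), add_zero, add_zero,
    h.mul_extendForm x (C.horProj_mem x u) fun j => (v j).field_mem x,
    h'.mul_extendForm x (C.horProj_mem x u) fun j => (v j).field_mem x]

theorem IsReebForm.unique {Λ Λ' : CovectorField E M} (h : C.IsReebForm Λ) (h' : C.IsReebForm Λ') :
    Λ = Λ' := by
  funext x
  refine LinearMap.ext fun u => ?_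
  obtain ⟨w, -, hw, hne⟩ := C.exists_horizontal_fields x
  apply mul_right_cancel₀ hne
  rw [← C.horProj_add_verProj x u, map_add, map_add, h.apply_horizontal x _ (C.horProj_mem x u),
    h'.apply_horizontal x _ (C.horProj_mem x u), zero_add, zero_add,
    h.mul_transversalForm x (C.verProj_mem x u) fun j => hw j x,
    h'.mul_transversalForm x (C.verProj_mem x u) fun j => hw j x]

/-- A horizontal `X` is annihilated by `τ_γ`, so the Lie derivative is `i_X d τ_γ`: the form `θ` is
the divergence of horizontal fields. -/
theorem IsDivergenceForm.lieDerivApply_eq {τ : F.LeafForm k} (hτ : F.IsLeafwiseVolume τ)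
    {θ : CovectorField E M} (h : C.IsDivergenceForm τ θ) {X : VField E M} (hX : IsSmoothVField X)
    (hXH : ∀ y, X y ∈ C.horizontal y) (v : Fin k → F.Section) (x : M) :
    lieDerivApply X (C.extendForm τ) (fun j => (v j).field) x =
      θ x (X x) * C.extendForm τ x fun j => (v j).field x := by
  rw [h.mul_extendForm x (hXH x) fun j => (v j).field_mem x]
  exact (extD_vecCons_of_insert_eq_zero (C.smooth_extendForm hτ.1) hX
    (fun y w i hi => C.extendForm_eq_zero τ (i := i) (hi ▸ hXH y))
    (fun j => (v j).smooth_field) x).symm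

/-- The counterpart for vertical fields: `σ^l` annihilates them, so `L_X σ^l = i_X d σ^l`. -/
theorem IsReebForm.lieDerivApply_eq {Λ : CovectorField E M} (h : C.IsReebForm Λ) {X : VField E M}
    (hX : IsSmoothVField X) (hXV : ∀ y, X y ∈ F.tangent y) {w : Fin (2 * C.halfRank) → VField E M}
    (hw : ∀ j, IsSmoothVField (w j)) (hwH : ∀ j y, w j y ∈ C.horizontal y) (x : M) :
    lieDerivApply X C.transversalForm w x = Λ x (X x) * C.transversalForm x fun j => w j x := by
  rw [h.mul_transversalForm x (hXV x) fun j => hwH j x]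
  exact (extD_vecCons_of_insert_eq_zero C.smooth_transversalForm hX
    (fun y w i hi => C.transversalForm_eq_zero (i := i) (hi ▸ hXV y)) hw x).symm

end CouplingStructure

end CouplingPoisson

end

/-! ### The Lie derivative of the coupling form along `Π^♯ η` -/

noncomputable section

namespace CouplingPoisson

open Filter Topology VectorField

variable {E : Type*} [NormedAddCommGroup E] [NormedSpace ℝ E] [FiniteDimensional ℝ E]
  {M : Type*} [TopologicalSpace M] [T2Space M] [ChartedSpace E M] [IsManifold 𝓘(ℝ, E) ∞ M]
  {k : ℕ} {F : RegularFoliation E M k}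

namespace CouplingStructure

variable (C : CouplingStructure F)

/-- The Lie derivative of the coupling form along `Π^♯ η` is `-dη` on horizontal fields. -/
theorem differential_couplingFlat {α β η : CovectorField E M} (hα : IsSmoothCovectorField α)
    (hβ : IsSmoothCovectorField β) (hη : IsSmoothCovectorField η)
    (hα' : ∀ y, α y ∈ (F.tangent y).dualAnnihilator)
    (hβ' : ∀ y, β y ∈ (F.tangent y).dualAnnihilator) (x : M) :
    differential E (fun y => C.couplingFlat y (C.sharpField α y) (C.sharpField β y)) x
        (C.sharpField η x) =
      C.couplingFlat x (mlieBracket 𝓘(ℝ, E) (C.sharpField η) (C.sharpField α) x)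
          (C.sharpField β x) +
        C.couplingFlat x (C.sharpField α x)
          (mlieBracket 𝓘(ℝ, E) (C.sharpField η) (C.sharpField β) x) +
        (η x (mlieBracket 𝓘(ℝ, E) (C.sharpField α) (C.sharpField β) x) -
          differential E (fun y => η y (C.sharpField β y)) x (C.sharpField α x) +
          differential E (fun y => η y (C.sharpField α y)) x (C.sharpField β x)) := by
  have hs := C.isPoisson.smooth
  -- Since `σ(Π^♯ α, Π^♯ β) = -α(Π^♯ β) = -Π(β, α)`, all terms of the claim occur in the Koszul form
  -- of the Jacobi identity; the rest is skew-symmetry of `Π` and of the bracket.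
  have h := C.isPoisson.koszul_eq_zero hα hβ hη x
  rw [koszul] at h
  have e1 : (fun y => C.couplingFlat y (C.sharpField α y) (C.sharpField β y)) =
      fun y => - C.bivector y ![β y, α y] := funext fun y => by
    rw [C.couplingFlat_sharp (hα' y), LinearMap.neg_apply, apply_sharp]
  have e2 : (fun y => C.bivector y ![η y, β y]) = fun y => - η y (C.sharpField β y) :=
    funext fun y => by rw [apply_sharp, bivector_swap]
  have e3 : (fun y => C.bivector y ![α y, η y]) = fun y => η y (C.sharpField α y) :=
    funext fun y => by rw [apply_sharp]
  rw [e2, e3, differential_neg ((hη _ (C.smooth_sharpField hβ)).at x)] at h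
  rw [e1, differential_neg ((hs _ _ hβ hα).at x), C.couplingFlat_swap x _ (C.sharpField β x),
    C.couplingFlat_sharp (hα' x), C.couplingFlat_sharp (hβ' x),
    mlieBracket_field_swap (C.sharpField η) (C.sharpField β)]
  simp only [LinearMap.neg_apply, map_neg, neg_neg]
  linarith

theorem actsAs_transversalForm {ι : Type*} {X : VField E M} {h : ι → VField E M} {x : M}
    {c : ι → TangentSpace 𝓘(ℝ, E) x} (hh : ∀ i, IsSmoothVField (h i))
    (hc : ∀ i j, differential E (fun y => C.couplingFlat y (h i y) (h j y)) x (X x) =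
      C.couplingFlat x (c i) (h j x) + C.couplingFlat x (h i x) (c j)) :
    ActsAs C.transversalForm X h x c := by
  refine ActsAs.wedgePow (s := C.couplingForm) (fun r => ?_) C.smooth_couplingForm hh _
  rw [Fin.sum_univ_two]
  refine (hc (r 0) (r 1)).trans ?_
  simp [couplingForm_apply]

/-- The defect in `differential_couplingFlat` is `-dη` on horizontal fields and vanishes for `η =
df`; hence Hamiltonian fields preserve `σ`, and so `σ^l`, along `ℍ`. -/
theorem lieDerivApply_hamiltonian_transversalForm {f : M → ℝ} (hf : IsSmoothFun E f)
    {α : Fin (2 * C.halfRank) → CovectorField E M} (hα : ∀ i, IsSmoothCovectorField (α i))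
    (hα' : ∀ i y, α i y ∈ (F.tangent y).dualAnnihilator) (x : M) :
    lieDerivApply (hamiltonian C.bivector f) C.transversalForm (fun i => C.sharpField (α i)) x =
      0 := by
  have hs := fun i => C.smooth_sharpField (hα i)
  have h := C.actsAs_transversalForm (X := hamiltonian C.bivector f) (x := x)
    (c := fun i => mlieBracket 𝓘(ℝ, E) (hamiltonian C.bivector f) (C.sharpField (α i)) x)
    hs fun i j => by
      have h1 := C.differential_couplingFlat (hα i) (hα j) hf.isSmoothCovectorField (hα' i) (hα' j) x
      rw [differential_mlieBracket hf (hs i) (hs j)] at h1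
      refine h1.trans ?_
      simp only [sub_sub_cancel_left, neg_add_cancel, add_zero]
      rfl
  rw [lieDerivApply, h fun i => i, sub_self]

theorem couplingFlat_neg_sharp {x : M} {a : Module.Dual ℝ (TangentSpace 𝓘(ℝ, E) x)}
    (ha : a ∈ (F.tangent x).dualAnnihilator) (w : TangentSpace 𝓘(ℝ, E) x) :
    C.couplingFlat x (- sharp (C.bivector x) a) w = a w := by
  rw [map_neg, C.couplingFlat_sharp ha, neg_neg]

/-- As `η` vanishes on `ℍ`, the defect is `η([h_i, h_j])` for `h_i = Π^♯ α_i`. It equals `σ(T_i,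
h_j)` and, by skew-symmetry, `σ(h_i, T_j)`, hence half the sum of both. So the Lie derivative acts
on `σ`, and on `σ^l`, as the derivation `h_i ↦ (1/2) T_i`, which multiplies the top power by the
trace. -/
theorem lieDerivApply_transversalForm_eq_trace
    {α : Fin (2 * C.halfRank) → CovectorField E M} {v : Fin k → F.Section}
    {ε : Fin (2 * C.halfRank) ⊕ Fin k → CovectorField E M} {x : M} (hfr : C.IsAdaptedFrame x α v ε)
    {η : CovectorField E M} (hη : IsSmoothCovectorField η)
    (hηH : ∀ y, ∀ w ∈ C.horizontal y, η y w = 0)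
    {T : Fin (2 * C.halfRank) → TangentSpace 𝓘(ℝ, E) x} (hT : ∀ i, T i ∈ C.horizontal x)
    (hTA : ∀ i j, C.couplingFlat x (T i) (C.sharpField (α j) x) =
      η x (mlieBracket 𝓘(ℝ, E) (C.sharpField (α i)) (C.sharpField (α j)) x)) :
    lieDerivApply (C.sharpField η) C.transversalForm (fun i => C.sharpField (α i)) x =
      (1 / 2 : ℝ) * (∑ i, ε (Sum.inl i) x (T i)) *
        C.transversalForm x fun i => C.sharpField (α i) x := by
  have hs := fun i => C.smooth_sharpField (hfr.smooth i)
  have hηα : ∀ i, (fun y => η y (C.sharpField (α i) y)) = fun _ => 0 := fun i =>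
    funext fun y => hηH y _ (C.sharp_mem_horizontal (hfr.conormal i y))
  have hT' : ∀ i j, C.couplingFlat x (C.sharpField (α i) x) (T j) =
      η x (mlieBracket 𝓘(ℝ, E) (C.sharpField (α i)) (C.sharpField (α j)) x) := fun i j => by
    rw [C.couplingFlat_swap, hTA, mlieBracket_field_swap, map_neg, neg_neg]
  have h := C.actsAs_transversalForm (X := C.sharpField η) (x := x)
    (c := fun i => mlieBracket 𝓘(ℝ, E) (C.sharpField η) (C.sharpField (α i)) x + (1 / 2 : ℝ) • T i)
    hs fun i j => by
      rw [C.differential_couplingFlat (hfr.smooth i) (hfr.smooth j) hη (hfr.conormal i)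
        (hfr.conormal j) x, hηα, hηα, differential_const]
      simp only [map_add, map_smul, LinearMap.add_apply, LinearMap.smul_apply, hTA, hT', smul_eq_mul,
        LinearMap.zero_apply]
      ring
  rw [lieDerivApply, h fun i => i]
  simp only [AlternatingMap.map_update_add, AlternatingMap.map_update_smul, Finset.sum_add_distrib,
    add_sub_cancel_left, smul_eq_mul]
  rw [Finset.mul_sum, Finset.sum_mul]
  refine Finset.sum_congr rfl fun i _ => ?_
  have h1 : T i = ∑ j, ε (Sum.inl j) x (T i) • C.sharpField (α j) x := by
    rw [← hfr.horProj_eq.self_of_nhds, C.horProj_of_mem (hT i)]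
  conv_lhs => rw [h1]
  rw [map_update_sum_smul]
  ring

end CouplingStructure

end CouplingPoisson

end

/-! ### The curvature identity -/

noncomputable section

namespace CouplingPoisson

open Filter Topology VectorField

variable {E : Type*} [NormedAddCommGroup E] [NormedSpace ℝ E] [FiniteDimensional ℝ E]
  {M : Type*} [TopologicalSpace M] [T2Space M] [ChartedSpace E M] [IsManifold 𝓘(ℝ, E) ∞ M]
  {k : ℕ} {F : RegularFoliation E M k}

/-- A field of covectors as a form of degree one. -/
def covectorForm (η : CovectorField E M) : DForm E M 1 :=
  fun x => AlternatingMap.ofSubsingleton ℝ _ ℝ (0 : Fin 1) (η x)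

theorem covectorForm_apply (η : CovectorField E M) (x : M)
    (v : Fin 1 → TangentSpace 𝓘(ℝ, E) x) : covectorForm η x v = η x (v 0) := rfl

theorem IsSmoothCovectorField.covectorForm {η : CovectorField E M} (hη : IsSmoothCovectorField η) :
    IsSmoothForm (covectorForm η) := fun _ hX => hη _ (hX 0)

theorem extD_covectorForm {η : CovectorField E M} (hη : IsSmoothCovectorField η) {X Y : VField E M}
    (hX : IsSmoothVField X) (hY : IsSmoothVField Y) (x : M) :
    extD (covectorForm η) x ![X x, Y x] =
      differential E (fun y => η y (Y y)) x (X x) - differential E (fun y => η y (X y)) x (Y x) -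
        η x (mlieBracket 𝓘(ℝ, E) X Y x) := by
  have e : (fun i => (![X, Y] : Fin 2 → VField E M) i x) = ![X x, Y x] := by
    funext i
    fin_cases i <;> rfl
  have h2 : ∀ i, IsSmoothVField ((![X, Y] : Fin 2 → VField E M) i) := by
    intro i
    fin_cases i
    exacts [hX, hY]
  rw [← e, extD_apply hη.covectorForm h2]
  simp only [Finset.sum_filter, Nat.reduceAdd, Fin.sum_univ_two, covectorForm_apply]
  simp
  ring

/-- A two-form as a bilinear map. -/
def altBilin {W : Type*} [AddCommGroup W] [Module ℝ W] (A : AltForm W 2) :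
    W →ₗ[ℝ] Module.Dual ℝ W :=
  LinearMap.mk₂ ℝ (fun u v => A ![u, v])
    (fun u u' v => by simpa using A.map_vecCons_add ![v] u u')
    (fun c u v => by simpa using A.map_vecCons_smul ![v] c u)
    (fun u v v' => twoForm_add A u v v') (fun c u v => twoForm_smul A u c v)

namespace CouplingStructure

variable {C : CouplingStructure F}

theorem mem_tangent_iff {x : M} (u : TangentSpace 𝓘(ℝ, E) x) :
    u ∈ F.tangent x ↔ ∀ α ∈ (F.tangent x).dualAnnihilator, α u = 0 :=
  (Subspace.forall_mem_dualAnnihilator_apply_eq_zero_iff _ _).symm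

/-- `Π^♯` maps the annihilator of `ℍ` to `𝕍`. -/
theorem sharp_mem_tangent {x : M} {η : Module.Dual ℝ (TangentSpace 𝓘(ℝ, E) x)}
    (hη : ∀ w ∈ C.horizontal x, η w = 0) : sharp (C.bivector x) η ∈ F.tangent x := by
  refine (mem_tangent_iff _).2 fun α hα => ?_
  rw [apply_sharp, bivector_swap, ← apply_sharp, hη _ (C.sharp_mem_horizontal hα), neg_zero]

theorem IsAdaptedFrame.dual_conormal {x : M} {m : ℕ} {α : Fin m → CovectorField E M}
    {v : Fin k → F.Section} {ε : Fin m ⊕ Fin k → CovectorField E M}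
    (h : C.IsAdaptedFrame x α v ε) (i : Fin m) :
    ε (Sum.inl i) x ∈ (F.tangent x).dualAnnihilator := by
  refine (Submodule.mem_dualAnnihilator _).2 fun u hu => ?_
  rw [← C.verProj_of_mem hu, h.verProj_eq.self_of_nhds, map_sum]
  refine Finset.sum_eq_zero fun j _ => ?_
  have : ε (Sum.inl i) x ((v j).field x) = 0 := by
    simpa using h.frame.dual.self_of_nhds (Sum.inl i) (Sum.inr j)
  rw [map_smul, this, smul_zero]

theorem IsAdaptedFrame.transversalForm_ne_zero {x : M}
    {α : Fin (2 * C.halfRank) → CovectorField E M}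
    {v : Fin k → F.Section} {ε : Fin (2 * C.halfRank) ⊕ Fin k → CovectorField E M}
    (h : C.IsAdaptedFrame x α v ε) : C.transversalForm x (fun i => C.sharpField (α i) x) ≠ 0 := by
  obtain ⟨hl, u, hu, hne⟩ := C.exists_transversalForm_ne_zero x
  obtain ⟨B, hB⟩ := h.exists_horizontal_basis hl
  have h1 : (C.transversalForm x).compLinearMap (C.horizontal x).subtype ≠ 0 := fun h0 =>
    hne (DFunLike.congr_fun h0 fun i => (⟨u i, hu i⟩ : C.horizontal x))
  have h2 := ne_zero_apply_basis _ h1 B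
  rw [AlternatingMap.compLinearMap_apply] at h2
  simpa only [Submodule.subtype_apply, hB] using h2

/-- Covectors on `𝕍` extend to smooth one-forms vanishing on `ℍ`. -/
theorem exists_vertical_covectorField (C : CouplingStructure F) {x : M}
    (a : Module.Dual ℝ (F.tangent x)) :
    ∃ η : CovectorField E M, IsSmoothCovectorField η ∧ (∀ y, ∀ w ∈ C.horizontal y, η y w = 0) ∧
      η x = a ∘ₗ C.conn x := by
  obtain ⟨f, hf, hx⟩ := exists_differential_eq (a ∘ₗ C.conn x)
  refine ⟨fun y => differential E f y ∘ₗ C.verProj y,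
    fun X hX => hf.differential_apply (C.smooth_verProj hX), fun y w hw => ?_, ?_⟩
  · rw [LinearMap.comp_apply, C.verProj_of_mem_horizontal hw, map_zero]
  · refine LinearMap.ext fun u => ?_
    change differential E f x (C.verProj x u) = _
    rw [hx, LinearMap.comp_apply, LinearMap.comp_apply, verProj_apply, conn_of_mem]

theorem extD_covectorForm_of_horizontal {η : CovectorField E M} (hη : IsSmoothCovectorField η)
    (hηH : ∀ y, ∀ w ∈ C.horizontal y, η y w = 0) {X Y : VField E M}
    (hX : IsSmoothVField X) (hY : IsSmoothVField Y) (hXH : ∀ y, X y ∈ C.horizontal y)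
    (hYH : ∀ y, Y y ∈ C.horizontal y) (x : M) :
    extD (covectorForm η) x ![X x, Y x] = - η x (mlieBracket 𝓘(ℝ, E) X Y x) := by
  rw [extD_covectorForm hη hX hY]
  simp only [fun y => hηH y _ (hXH y), fun y => hηH y _ (hYH y), differential_const,
    LinearMap.zero_apply, sub_zero, zero_sub]

/-- The curvature is defined through extensions of vectors; the pairing with `a` is the value of a
two-form, because `η` vanishes on horizontal fields and `dη` reduces there to minus `η` of the
bracket. In particular `a ∘ R^γ` is alternating and bilinear. -/
theorem apply_curvature {η : CovectorField E M} (hη : IsSmoothCovectorField η)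
    (hηH : ∀ y, ∀ w ∈ C.horizontal y, η y w = 0) {x : M} {a : Module.Dual ℝ (F.tangent x)}
    (ha : η x = a ∘ₗ C.conn x) (u v : TangentSpace 𝓘(ℝ, E) x) :
    a (C.curvature x u v) = - extD (covectorForm η) x ![C.horProj x u, C.horProj x v] := by
  obtain ⟨X, hX, hX'⟩ := exists_isSmoothVField_eventuallyEq_extend u
  obtain ⟨Y, hY, hY'⟩ := exists_isSmoothVField_eventuallyEq_extend v
  have hx : X x = u := by rw [hX'.self_of_nhds, FiberBundle.extend_apply_self]
  have hy : Y x = v := by rw [hY'.self_of_nhds, FiberBundle.extend_apply_self]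
  have h := extD_covectorForm_of_horizontal (C := C) hη hηH (C.smooth_horProj hX)
    (C.smooth_horProj hY) (fun y => C.horProj_mem y _) (fun y => C.horProj_mem y _) x
  rw [hx, hy] at h
  rw [h, neg_neg, curvature, ha, LinearMap.comp_apply]
  congr 2
  refine mlieBracket_field_congr (hX'.mono fun y hy => ?_) (hY'.mono fun y hy => ?_)
  · rw [hy]
  · rw [hy]

/-- The contraction of the curvature with `Π_H` is the image of the Reeb form. -/
theorem IsReebForm.contract_curvature {Λ : CovectorField E M} (h : C.IsReebForm Λ) (x : M) :
    contract (C.horBivector x) (C.curvature x) =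
      sharp (C.verBivector x) ((Λ x).domRestrict (F.tangent x)) := by
  rw [← sub_eq_zero, ← Module.forall_dual_apply_eq_zero_iff ℝ]
  intro a
  rw [map_sub, sub_eq_zero]
  obtain ⟨η, hη, hηH, ha⟩ := C.exists_vertical_covectorField a
  obtain ⟨α, v, ε, hfr⟩ := C.exists_isAdaptedFrame x
  have hs := fun i => C.smooth_sharpField (hfr.smooth i)
  have hsH := fun i y => C.sharp_mem_horizontal (hfr.conormal i y)
  -- The two-form `a ∘ R^γ`. It vanishes on vertical arguments, so `A(u, ·)` is conormal and `Π^♯`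
  -- maps it into `ℍ`.
  set A : AltForm (TangentSpace 𝓘(ℝ, E) x) 2 :=
    - (extD (covectorForm η) x).compLinearMap (C.horProj x) with hA
  have hAuv : ∀ u w, A ![u, w] = - extD (covectorForm η) x ![C.horProj x u, C.horProj x w] :=
    fun u w => by
      rw [hA, AlternatingMap.neg_apply, AlternatingMap.compLinearMap_apply]
      congr 2
      funext i
      fin_cases i <;> rfl
  have hA0 : ∀ u, ∀ w ∈ F.tangent x, A ![u, w] = 0 := fun u w hw => by
    rw [hAuv, C.horProj_of_mem_tangent hw, AlternatingMap.map_coord_zero _ 1 rfl, neg_zero]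
  have hAcon : ∀ u, altBilin A u ∈ (F.tangent x).dualAnnihilator := fun u =>
    (Submodule.mem_dualAnnihilator _).2 fun w hw => hA0 u w hw
  -- The solution of `σ(T_i, ·) = A(Π^♯ α_i, ·)`, because `σ^♭ Π^♯ = -Id` on conormal covectors.
  let T : Fin (2 * C.halfRank) → TangentSpace 𝓘(ℝ, E) x :=
    fun i => - sharp (C.bivector x) (altBilin A (C.sharpField (α i) x))
  have hL := C.lieDerivApply_transversalForm_eq_trace hfr hη hηH (T := T)
    (fun i => Submodule.neg_mem _ (C.sharp_mem_horizontal (hAcon _))) (fun i j => by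
      rw [C.couplingFlat_neg_sharp (hAcon _)]
      refine (hAuv _ _).trans ?_
      rw [C.horProj_of_mem (hsH i x), C.horProj_of_mem (hsH j x),
        extD_covectorForm_of_horizontal hη hηH (hs i) (hs j) (hsH i) (hsH j), neg_neg])
  -- The field `Π^♯ η` is vertical, so its Lie derivative on `σ^l` is multiplication by `Λ(Π^♯ η)`.
  -- Comparison with the trace formula gives `hΛ`.
  rw [h.lieDerivApply_eq (C.smooth_sharpField hη) (fun y => sharp_mem_tangent (hηH y)) hs hsH] at hL
  have hΛ := mul_right_cancel₀ hfr.transversalForm_ne_zero hL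
  have hR : a (sharp (C.verBivector x) ((Λ x).domRestrict (F.tangent x))) =
      - Λ x (C.sharpField η x) := by
    rw [apply_sharp, apply_sharp, ← bivector_swap, verBivector, AlternatingMap.compLinearMap_apply]
    congr 1
    funext i
    fin_cases i
    · refine LinearMap.ext fun u => ?_
      change Λ x (C.verProj x u) = Λ x u
      conv_rhs => rw [← C.horProj_add_verProj x u, map_add,
        h.apply_horizontal x _ (C.horProj_mem x u), zero_add]
    · exact ha.symm
  obtain ⟨B, hB, hBc⟩ := hfr.frame.exists_basis
  have hLHS : a (contract (C.horBivector x) (C.curvature x)) =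
      - ((1 / 2 : ℝ) * ∑ i, ε (Sum.inl i) x (T i)) := by
    have h1 : (fun u w => a (C.curvature x u w)) = fun u w => altBilin A u w := by
      funext u w
      rw [apply_curvature hη hηH ha]
      exact (hAuv u w).symm
    rw [apply_contract, h1, contract_eq_sum _ _ B, Fintype.sum_sum_type]
    -- Vertical basis vectors do not contribute to the contraction, so it is a trace over the
    -- horizontal part of the frame.
    have h2 : ∀ j, altBilin A (B (Sum.inr j)) = 0 := fun j => LinearMap.ext fun w => by
      refine (twoForm_swap A _ _).trans ?_
      rw [hA0 _ _ (by rw [hB]; exact (v j).field_mem x), neg_zero]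
      rfl
    have h3 : ∀ i, altBilin A (B (Sum.inl i)) (sharp (C.horBivector x) (B.coord (Sum.inl i))) =
        ε (Sum.inl i) x (T i) := fun i => by
      rw [hBc, C.sharp_horBivector_of_mem (hfr.dual_conormal i), hB, apply_sharp, map_neg, apply_sharp,
        ← bivector_swap]
      rfl
    simp only [h2, h3, LinearMap.zero_apply, Finset.sum_const_zero, add_zero]
    ring
  rw [hR, hLHS, hΛ]

end CouplingStructure

end CouplingPoisson

end

/-! ### Leafwise divergence and its value on `P^♯ df` -/

noncomputable section

namespace CouplingPoisson

open Filter Topology VectorField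

variable {E : Type*} [NormedAddCommGroup E] [NormedSpace ℝ E] [FiniteDimensional ℝ E]
  {M : Type*} [TopologicalSpace M] [T2Space M] [ChartedSpace E M] [IsManifold 𝓘(ℝ, E) ∞ M]
  {k : ℕ} {F : RegularFoliation E M k}

theorem IsSmoothForm.lieDerivApply {m : ℕ} {η : DForm E M m} (hη : IsSmoothForm η) {X : VField E M}
    (hX : IsSmoothVField X) {Y : Fin m → VField E M} (hY : ∀ i, IsSmoothVField (Y i)) :
    IsSmoothFun E fun x => lieDerivApply X η Y x := by
  refine IsSmoothFun.sub ((hη Y hY).differential_apply hX) (IsSmoothFun.sum fun i _ => ?_)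
  have h := hη (Function.update Y i (mlieBracket 𝓘(ℝ, E) X (Y i))) fun j => by
    by_cases hj : j = i
    · subst hj
      rw [Function.update_self]
      exact hX.mlieBracket (hY _)
    · rw [Function.update_of_ne hj]
      exact hY j
  have e : ∀ x, (fun j => Function.update Y i (mlieBracket 𝓘(ℝ, E) X (Y i)) j x) =
      Function.update (fun j => Y j x) i (mlieBracket 𝓘(ℝ, E) X (Y i) x) := fun x => by
    funext j
    by_cases hj : j = i
    · subst hj; simp
    · simp [hj]
  simpa only [e] using h

theorem altForm_eq_zero_of_finrank_lt {U : Type*} [AddCommGroup U] [Module ℝ U]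
    [FiniteDimensional ℝ U] {m : ℕ} (hU : Module.finrank ℝ U < m) (ζ : AltForm U m) : ζ = 0 :=
  AlternatingMap.ext fun v => ζ.map_linearDependent v fun h => by
    have := h.fintype_card_le_finrank
    rw [Fintype.card_fin] at this
    omega

namespace CouplingStructure

variable (C : CouplingStructure F)

/-- `δ` is the divergence of the vector field `X` with respect to the leaf-wise volume form `τ`,
extended by `γ`. -/
def IsLeafDivergence (τ : F.LeafForm k) (X : VField E M) (δ : M → ℝ) : Prop :=
  ∀ (Y : Fin k → F.Section) (x : M), lieDerivApply X (C.extendForm τ) (fun j => (Y j).field) x =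
    δ x * C.extendForm τ x fun j => (Y j).field x

/-- Restricted to the leaves, the Lie derivative of `τ_γ` has top degree, hence is a multiple of
`τ`; smoothness of the factor follows by dividing values on a local frame. The field `X` need not be
tangent to the leaves. -/
theorem exists_isLeafDivergence {τ : F.LeafForm k} (hτ : F.IsLeafwiseVolume τ) {X : VField E M}
    (hX : IsSmoothVField X) : ∃ δ, IsSmoothFun E δ ∧ C.IsLeafDivergence τ X δ := by
  have hT := C.smooth_extendForm hτ.1
  have h1 : ∀ x, ∃ d : ℝ, ∀ Y : Fin k → F.Section,
      lieDerivApply X (C.extendForm τ) (fun j => (Y j).field) x =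
        d * C.extendForm τ x fun j => (Y j).field x := fun x => by
    obtain ⟨L, hL⟩ := exists_lieDeriv hT hX x
    obtain ⟨d, hd⟩ := exists_eq_smul_of_finrank_eq (F.finrank_eq x) (hτ.2 x)
      (L.compLinearMap (F.tangent x).subtype)
    refine ⟨d, fun Y => ?_⟩
    rw [hL _ fun j => (Y j).smooth_field]
    refine (DFunLike.congr_fun hd fun j => (Y j).val x).trans ?_
    rw [AlternatingMap.smul_apply, smul_eq_mul, ← C.extendForm_coe]
    rfl
  choose δ hδ using h1
  refine ⟨δ, fun x => ?_, fun Y x => hδ x Y⟩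
  obtain ⟨v, hv⟩ := C.exists_tangent_fields hτ.2 x
  have h2 := hT _ fun j => (v j).smooth_field
  have h3 := hT.lieDerivApply hX fun j => (v j).smooth_field
  refine ((h3.at x).mul ((h2.at x).inv hv)).congr ?_
  filter_upwards [(h2.at x).continuousAt.eventually_ne hv] with y hy
  rw [hδ y v, mul_inv_cancel_right₀ hy]

/-- On vertical vectors the exterior derivative of a form of top leaf degree vanishes. -/
theorem extD_eq_zero_of_mem {τ : F.LeafForm k} {x : M} {w : Fin (k + 1) → TangentSpace 𝓘(ℝ, E) x}
    (hw : ∀ i, w i ∈ F.tangent x) : extD (C.extendForm τ) x w = 0 := by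
  have h := altForm_eq_zero_of_finrank_lt (by rw [F.finrank_eq x]; omega)
    ((extD (C.extendForm τ) x).compLinearMap (F.tangent x).subtype)
  exact DFunLike.congr_fun h fun i => (⟨w i, hw i⟩ : F.tangent x)

/-- The part of a one-form which vanishes on `ℍ`. -/
def verCovector (β : CovectorField E M) : CovectorField E M := fun x => β x ∘ₗ C.verProj x

theorem smooth_verCovector {β : CovectorField E M} (hβ : IsSmoothCovectorField β) :
    IsSmoothCovectorField (C.verCovector β) := fun _ hX => hβ _ (C.smooth_verProj hX)

theorem verCovector_of_mem (β : CovectorField E M) {x : M} {u : TangentSpace 𝓘(ℝ, E) x}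
    (hu : u ∈ F.tangent x) : C.verCovector β x u = β x u := by
  rw [verCovector, LinearMap.comp_apply, C.verProj_of_mem hu]

theorem verCovector_horizontal (β : CovectorField E M) (x : M) :
    ∀ w ∈ C.horizontal x, C.verCovector β x w = 0 := fun w hw => by
  rw [verCovector, LinearMap.comp_apply, C.verProj_of_mem_horizontal hw, map_zero]

/-- The section `Π^♯(β ∘ γ)` of `𝕍`. -/
def sharpSection {β : CovectorField E M} (hβ : IsSmoothCovectorField β) : F.Section :=
  ⟨fun x => ⟨C.sharpField (C.verCovector β) x, sharp_mem_tangent (C.verCovector_horizontal β x)⟩,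
    C.smooth_sharpField (C.smooth_verCovector hβ)⟩

theorem sharpSection_field {β : CovectorField E M} (hβ : IsSmoothCovectorField β) (x : M) :
    (C.sharpSection hβ).field x = sharp (C.bivector x) (C.verCovector β x) := rfl

/-- The vector `Π^♯(a ∘ γ)` is already vertical, so `P^♯` can be computed on `M` with `Π` itself. -/
theorem sharp_verBivector {x : M} (a : Module.Dual ℝ (F.tangent x)) :
    (sharp (C.verBivector x) a : TangentSpace 𝓘(ℝ, E) x) =
      sharp (C.bivector x) (a ∘ₗ C.conn x) := by
  have hm : sharp (C.bivector x) (a ∘ₗ C.conn x) ∈ F.tangent x := sharp_mem_tangent fun w hw => by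
    rw [LinearMap.comp_apply, C.conn_of_mem_horizontal hw, map_zero]
  have h : sharp (C.verBivector x) a = ⟨_, hm⟩ := by
    rw [← sub_eq_zero, ← Module.forall_dual_apply_eq_zero_iff ℝ]
    intro b
    rw [map_sub, sub_eq_zero, apply_sharp]
    have h1 : b ⟨_, hm⟩ = (b ∘ₗ C.conn x) (sharp (C.bivector x) (a ∘ₗ C.conn x)) := by
      rw [LinearMap.comp_apply]
      exact congrArg b (C.conn_of_mem ⟨_, hm⟩).symm
    rw [h1, apply_sharp, verBivector, AlternatingMap.compLinearMap_apply]
    congr 1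
    funext i
    fin_cases i <;> rfl
  rw [h]

variable {C}

section Frame

variable {x : M} {m : ℕ} {α : Fin m → CovectorField E M} {v : Fin k → F.Section}
  {ε : Fin m ⊕ Fin k → CovectorField E M}

theorem IsAdaptedFrame.eventually (h : C.IsAdaptedFrame x α v ε) :
    ∀ᶠ y in 𝓝 x, C.IsAdaptedFrame y α v ε := by
  filter_upwards [h.frame.expand.eventually_nhds, h.frame.dual.eventually_nhds] with y h1 h2
  exact ⟨h.smooth, h.conormal, h.frame.smooth, h.frame.smooth_dual, h1, h2⟩

/-- The sections `P^♯ ε_j` for the vertical part `ε_j` of the dual frame. -/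
def IsAdaptedFrame.dualSection (h : C.IsAdaptedFrame x α v ε) (j : Fin k) : F.Section :=
  C.sharpSection (h.frame.smooth_dual (Sum.inr j))

theorem IsAdaptedFrame.verCovector_eq (h : C.IsAdaptedFrame x α v ε) (β : CovectorField E M) :
    C.verCovector β x = ∑ j, β x ((v j).field x) • C.verCovector (ε (Sum.inr j)) x := by
  refine LinearMap.ext fun u => ?_
  rw [LinearMap.sum_apply]
  change β x (C.verProj x u) = _
  conv_lhs => rw [← C.verProj_of_mem (C.verProj_mem x u), h.verProj_eq.self_of_nhds, map_sum]
  refine Finset.sum_congr rfl fun j _ => ?_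
  rw [map_smul, smul_eq_mul, mul_comm]
  rfl

/-- Two expansions of `P^♯ β` in the frame. -/
theorem IsAdaptedFrame.sharp_verCovector_eq (h : C.IsAdaptedFrame x α v ε) (β : CovectorField E M) :
    sharp (C.bivector x) (C.verCovector β x) =
      ∑ j, β x ((v j).field x) • (h.dualSection j).field x := by
  rw [h.verCovector_eq, map_sum]
  exact Finset.sum_congr rfl fun j _ => map_smul _ _ _

theorem IsAdaptedFrame.sharp_verCovector_eq_neg (h : C.IsAdaptedFrame x α v ε)
    (β : CovectorField E M) : sharp (C.bivector x) (C.verCovector β x) =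
      - ∑ j, β x ((h.dualSection j).field x) • (v j).field x := by
  have hm := sharp_mem_tangent (C := C) (C.verCovector_horizontal β x)
  rw [← C.verProj_of_mem hm, h.verProj_eq.self_of_nhds, ← Finset.sum_neg_distrib]
  refine Finset.sum_congr rfl fun j _ => ?_
  rw [← neg_smul]
  congr 1
  rw [← C.verCovector_of_mem (ε (Sum.inr j)) hm,
    ← C.verCovector_of_mem β ((h.dualSection j).field_mem x), dualSection, sharpSection_field,
    apply_sharp, apply_sharp, bivector_swap]

/-- The average of the two expansions. This skew form is the one in which the second derivatives of
`f` combine into a bracket once `β = df` and the divergence is taken. -/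
theorem IsAdaptedFrame.sharp_verCovector_eq_half (h : C.IsAdaptedFrame x α v ε)
    (β : CovectorField E M) : sharp (C.bivector x) (C.verCovector β x) =
      ∑ j, (((1 / 2 : ℝ) * β x ((v j).field x)) • (h.dualSection j).field x +
        (-(1 / 2 : ℝ) * β x ((h.dualSection j).field x)) • (v j).field x) := by
  have h1 := h.sharp_verCovector_eq β
  have h2 := h.sharp_verCovector_eq_neg β
  simp only [mul_smul, Finset.sum_add_distrib, ← Finset.smul_sum]
  rw [← h1, neg_smul, ← smul_neg, ← h2, ← add_smul]
  norm_num

/-- The divergence of `P^♯ df` in an adapted frame. -/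
theorem IsAdaptedFrame.leafDivergence_sharpSection (h : C.IsAdaptedFrame x α v ε) {τ : F.LeafForm k}
    (hτ : F.IsLeafwiseVolume τ) {δv δc : Fin k → M → ℝ}
    (hv : ∀ j, C.IsLeafDivergence τ (v j).field (δv j))
    (hc : ∀ j, C.IsLeafDivergence τ (h.dualSection j).field (δc j)) {f : M → ℝ}
    (hf : IsSmoothFun E f) {δ : M → ℝ}
    (hδ : C.IsLeafDivergence τ (C.sharpSection hf.isSmoothCovectorField).field δ) :
    δ x = differential E f x ((1 / 2 : ℝ) • ∑ j, (δc j x • (v j).field x -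
      δv j x • (h.dualSection j).field x +
        mlieBracket 𝓘(ℝ, E) (h.dualSection j).field (v j).field x)) := by
  obtain ⟨B, hB, -⟩ := h.exists_tangent_basis
  have hB' : (B : Fin k → F.tangent x) = fun j => (v j).val x := funext hB
  have hne : C.extendForm τ x (fun j => (v j).field x) ≠ 0 := by
    have := ne_zero_apply_basis (τ x) (hτ.2 x) B
    rw [hB', ← C.extendForm_coe] at this
    exact this
  -- This evaluates `dg ∧ i_A τ`, the extra term in the Lie derivative along `g A`, as `dg(A) τ`.
  have hup : ∀ (φ : Module.Dual ℝ (TangentSpace 𝓘(ℝ, E) x)) (A : F.Section),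
      ∑ i, φ ((v i).field x) * C.extendForm τ x (Function.update (fun j => (v j).field x) i (A.field x))
        = φ (A.field x) * C.extendForm τ x fun j => (v j).field x := fun φ A => by
    have h1 := sum_apply_mul_map_update (τ x) B (φ ∘ₗ (F.tangent x).subtype) (A.val x)
    rw [hB', ← C.extendForm_coe] at h1
    refine Eq.trans (Finset.sum_congr rfl fun i _ => ?_) h1
    rw [← C.extendForm_coe]
    congr 2
    funext j
    by_cases hj : j = i
    · subst hj; simp [RegularFoliation.Section.field]
    · simp [hj, RegularFoliation.Section.field]
  have hdc := fun j => hf.differential_apply (h.dualSection j).smooth_field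
  have hdv := fun j => hf.differential_apply (v j).smooth_field
  have hsc := fun j => ((IsSmoothFun.const (E := E) (M := M) (1 / 2)).mul (hdv j))
  have hsv := fun j => ((IsSmoothFun.const (E := E) (M := M) (-(1 / 2))).mul (hdc j))
  have hloc : ∀ᶠ y in 𝓝 x, (C.sharpSection hf.isSmoothCovectorField).field y =
      ∑ j, (((1 / 2 : ℝ) * differential E f y ((v j).field y)) • (h.dualSection j).field y +
        (-(1 / 2 : ℝ) * differential E f y ((h.dualSection j).field y)) • (v j).field y) := by
    filter_upwards [h.eventually] with y hy
    exact hy.sharp_verCovector_eq_half _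
  apply mul_right_cancel₀ hne
  -- With `c_j` the sections `dualSection j`, the coefficients contribute `(1/2) (c_j(v_j(f)) -
  -- v_j(c_j(f)))`, that is, half of `[c_j, v_j](f)`.
  rw [← hδ v x, lieDerivApply_congr _ hloc, lieDerivApply_sum _ _ fun j =>
    (IsSmoothVField.smul (hsc j) (h.dualSection j).smooth_field).add
      (IsSmoothVField.smul (hsv j) (v j).smooth_field), map_smul, map_sum, smul_eq_mul, Finset.mul_sum,
    Finset.sum_mul]
  refine Finset.sum_congr rfl fun j _ => ?_
  rw [lieDerivApply_add _ (IsSmoothVField.smul (hsc j) (h.dualSection j).smooth_field)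
      (IsSmoothVField.smul (hsv j) (v j).smooth_field),
    lieDerivApply_smul _ (hsc j) (h.dualSection j).smooth_field,
    lieDerivApply_smul _ (hsv j) (v j).smooth_field, hup, hup, hv j, hc j,
    differential_const_mul _ ((hdv j).at x), differential_const_mul _ ((hdc j).at x), map_add, map_sub,
    map_smul, map_smul, differential_mlieBracket hf (h.dualSection j).smooth_field (v j).smooth_field]
  simp only [smul_eq_mul]
  ring

end Frame

end CouplingStructure

end CouplingPoisson

end

/-! ### The leafwise modular field and the equation `i_W τ = -d_𝒱 i_P τ` -/

noncomputable section

namespace CouplingPoisson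

open Filter Topology VectorField

variable {E : Type*} [NormedAddCommGroup E] [NormedSpace ℝ E] [FiniteDimensional ℝ E]
  {M : Type*} [TopologicalSpace M] [T2Space M] [ChartedSpace E M] [IsManifold 𝓘(ℝ, E) ∞ M]
  {k : ℕ} {F : RegularFoliation E M k}

section LinearAlgebra

variable {U : Type*} [AddCommGroup U] [Module ℝ U]

theorem map_vecCons_smul_sum {m : ℕ} {ι : Type*} (ζ : AltForm U (m + 1)) (c : ℝ) (s : Finset ι)
    (u : ι → U) (w : Fin m → U) :
    ζ (Matrix.vecCons (c • ∑ i ∈ s, u i) w) = c * ∑ i ∈ s, ζ (Matrix.vecCons (u i) w) := by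
  rw [ζ.map_vecCons_smul, smul_eq_mul, ← AlternatingMap.curryLeft_apply_apply, map_sum,
    altForm_sum_apply]
  rfl

/-- Evaluation of forms at given vectors. -/
def evalForm {p : ℕ} (w : Fin p → U) : AltForm U p →ₗ[ℝ] ℝ where
  toFun η := η w
  map_add' _ _ := AlternatingMap.add_apply ..
  map_smul' _ _ := AlternatingMap.smul_apply ..

/-- The bilinear map `(u, u') ↦ ζ(u, u', w_1, …, w_p)`. -/
def insertTwo {p : ℕ} (ζ : AltForm U (p + 2)) (w : Fin p → U) : U →ₗ[ℝ] Module.Dual ℝ U :=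
  (evalForm w).compRight ℝ ∘ₗ AlternatingMap.curryLeftLinearMap ∘ₗ ζ.curryLeft

end LinearAlgebra

namespace CouplingStructure

variable {C : CouplingStructure F}

/-- `W(f)` is the leaf-wise divergence of `P^♯ df`. -/
def IsLeafModular (C : CouplingStructure F) (τ : F.LeafForm k) (W : F.Section) : Prop :=
  ∀ (f : M → ℝ) (hf : IsSmoothFun E f) (δ : M → ℝ),
    C.IsLeafDivergence τ (C.sharpSection hf.isSmoothCovectorField).field δ →
      ∀ x, δ x = differential E f x (W.field x)

/-- By the frame formula the divergence of `P^♯ df` at a point depends on `f` only through `df`, and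
it is `df` applied to a vector tangent to the leaf. These vectors form a smooth field because the
divergences are smooth functions. -/
theorem exists_isLeafModular (C : CouplingStructure F) {τ : F.LeafForm k}
    (hτ : F.IsLeafwiseVolume τ) : ∃ W, C.IsLeafModular τ W := by
  have h1 : ∀ x, ∃ w : F.tangent x, ∀ (f : M → ℝ) (hf : IsSmoothFun E f) (δ : M → ℝ),
      C.IsLeafDivergence τ (C.sharpSection hf.isSmoothCovectorField).field δ →
        δ x = differential E f x w := fun x => by
    obtain ⟨α, v, ε, h⟩ := C.exists_isAdaptedFrame x
    choose δv _ hv using fun j => C.exists_isLeafDivergence hτ (v j).smooth_field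
    choose δc _ hc using fun j => C.exists_isLeafDivergence hτ (h.dualSection j).smooth_field
    refine ⟨⟨_, ?_⟩, fun f hf δ hδ => h.leafDivergence_sharpSection hτ hv hc hf hδ⟩
    refine Submodule.smul_mem _ _ (Submodule.sum_mem _ fun j _ => Submodule.add_mem _
      (Submodule.sub_mem _ (Submodule.smul_mem _ _ ((v j).field_mem x))
        (Submodule.smul_mem _ _ ((h.dualSection j).field_mem x))) ?_)
    exact (F.bracket (h.dualSection j) (v j) x).2
  choose W hW using h1
  refine ⟨⟨W, isSmoothVField_of_differential fun f hf => ?_⟩, fun f hf δ hδ x => hW x f hf δ hδ⟩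
  obtain ⟨δ, hδ, hδ'⟩ := C.exists_isLeafDivergence hτ
    (C.sharpSection hf.isSmoothCovectorField).smooth_field
  rwa [show δ = _ from funext fun x => hW x f hf δ hδ'] at hδ

theorem IsLeafModular.field_eq {τ : F.LeafForm k} {W : F.Section} (hW : C.IsLeafModular τ W)
    (hτ : F.IsLeafwiseVolume τ) {x : M} {m : ℕ} {α : Fin m → CovectorField E M}
    {v : Fin k → F.Section} {ε : Fin m ⊕ Fin k → CovectorField E M} (h : C.IsAdaptedFrame x α v ε)
    {δv δc : Fin k → M → ℝ} (hv : ∀ j, C.IsLeafDivergence τ (v j).field (δv j))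
    (hc : ∀ j, C.IsLeafDivergence τ (h.dualSection j).field (δc j)) :
    W.field x = (1 / 2 : ℝ) • ∑ j, (δc j x • (v j).field x - δv j x • (h.dualSection j).field x +
      mlieBracket 𝓘(ℝ, E) (h.dualSection j).field (v j).field x) := by
  refine eq_of_forall_differential fun f hf => ?_
  obtain ⟨δ, -, hδ⟩ := C.exists_isLeafDivergence hτ
    (C.sharpSection hf.isSmoothCovectorField).smooth_field
  rw [← hW f hf δ hδ x, h.leafDivergence_sharpSection hτ hv hc hf hδ]

/-- The foliated exterior derivative is the exterior derivative of the extension by `γ`. -/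
theorem leafD_eq_extD {p : ℕ} {μ : F.LeafForm p} (hμ : IsSmoothForm (C.extendForm μ))
    (Y : Fin (p + 1) → F.Section) (x : M) :
    F.leafD μ Y x = extD (C.extendForm μ) x fun i => (Y i).field x := by
  rw [extD_apply hμ fun i => (Y i).smooth_field, RegularFoliation.leafD]
  congr 1
  · refine Finset.sum_congr rfl fun i _ => ?_
    congr 3
    funext y
    exact (C.extendForm_coe μ y _).symm
  · refine Finset.sum_congr rfl fun j _ => Finset.sum_congr rfl fun i _ => ?_
    rw [← C.extendForm_coe μ]
    congr 2
    funext a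
    split_ifs <;> rfl

/-- In the frame `P = (1/2) ∑ v_j ∧ c_j`, where `c_j` is `dualSection j`. The minus sign reflects
`i_{v ∧ c} = i_v ∘ i_c`, which inserts `c` before `v`. -/
theorem IsAdaptedFrame.insertBivector_apply {x : M} {m p : ℕ} {α : Fin m → CovectorField E M}
    {v : Fin k → F.Section} {ε : Fin m ⊕ Fin k → CovectorField E M} (h : C.IsAdaptedFrame x α v ε)
    (μ : F.LeafForm (p + 2)) (w : Fin p → F.tangent x) :
    F.insertBivector C.verBivector μ x w = -(1 / 2 : ℝ) *
      ∑ j, μ x (Matrix.vecCons ((v j).val x) (Matrix.vecCons ((h.dualSection j).val x) w)) := by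
  obtain ⟨B, hB, hBc⟩ := h.exists_tangent_basis
  have h1 : F.insertBivector C.verBivector μ x w =
      contract (C.verBivector x) fun u u' => insertTwo (μ x) w u u' :=
    (apply_contract (evalForm w) (C.verBivector x)
      fun u u' => ((μ x).curryLeft u).curryLeft u').trans
      (congrArg (contract (C.verBivector x)) (funext fun u => funext fun u' => rfl))
  rw [h1, contract_eq_sum _ _ B]
  congr 1
  refine Finset.sum_congr rfl fun j _ => ?_
  have h2 : sharp (C.verBivector x) (B.coord j) = (h.dualSection j).val x := by
    refine Subtype.ext ?_
    rw [sharp_verBivector]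
    change _ = (h.dualSection j).field x
    rw [dualSection, sharpSection_field]
    congr 1
    refine LinearMap.ext fun u => ?_
    rw [LinearMap.comp_apply, hBc]
    rfl
  rw [h2, hB]
  rfl

theorem extendForm_vecCons_vecCons {p : ℕ} (μ : F.LeafForm (p + 2)) {x : M} (u u' : F.tangent x)
    (w : Fin p → TangentSpace 𝓘(ℝ, E) x) :
    C.extendForm μ x (Matrix.vecCons (u : TangentSpace 𝓘(ℝ, E) x)
      (Matrix.vecCons (u' : TangentSpace 𝓘(ℝ, E) x) w)) =
      μ x (Matrix.vecCons u (Matrix.vecCons u' fun i => C.conn x (w i))) := by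
  rw [extendForm_apply]
  congr 1
  funext i
  refine Fin.cases ?_ (fun i => Fin.cases ?_ (fun i => rfl) i) i
  · exact C.conn_of_mem u
  · exact C.conn_of_mem u'

theorem IsAdaptedFrame.extendForm_insertBivector {x : M} {m p : ℕ} {α : Fin m → CovectorField E M}
    {v : Fin k → F.Section} {ε : Fin m ⊕ Fin k → CovectorField E M} (h : C.IsAdaptedFrame x α v ε)
    (μ : F.LeafForm (p + 2)) :
    C.extendForm (F.insertBivector C.verBivector μ) x = -(1 / 2 : ℝ) • ∑ j,
      insertField (h.dualSection j).field (insertField (v j).field (C.extendForm μ)) x := by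
  refine AlternatingMap.ext fun w => ?_
  rw [extendForm_apply, h.insertBivector_apply, AlternatingMap.smul_apply, altForm_sum_apply,
    smul_eq_mul]
  congr 1
  exact Finset.sum_congr rfl fun j _ => (extendForm_vecCons_vecCons μ _ _ _).symm

theorem smooth_extendForm_insertBivector {p : ℕ} {μ : F.LeafForm (p + 2)}
    (hμ : F.IsSmoothLeafForm μ) :
    IsSmoothForm (C.extendForm (F.insertBivector C.verBivector μ)) := fun Y hY x => by
  obtain ⟨α, v, ε, h⟩ := C.exists_isAdaptedFrame x
  have h1 : IsSmoothFun E fun y => -(1 / 2 : ℝ) * ∑ j,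
      insertField (h.dualSection j).field (insertField (v j).field (C.extendForm μ)) y
        fun i => Y i y :=
    (IsSmoothFun.const _).mul (IsSmoothFun.sum fun j _ =>
      ((C.smooth_extendForm hμ).insertField (v j).smooth_field).insertField
        (h.dualSection j).smooth_field Y hY)
  refine (h1.at x).congr ?_
  filter_upwards [h.eventually] with y hy
  rw [hy.extendForm_insertBivector, AlternatingMap.smul_apply, altForm_sum_apply, smul_eq_mul]
  rfl

theorem extD_insertBivector {p : ℕ} {μ : F.LeafForm (p + 2)} (hμ : F.IsSmoothLeafForm μ)
    {x : M} {m : ℕ} {α : Fin m → CovectorField E M}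
    {v : Fin k → F.Section} {ε : Fin m ⊕ Fin k → CovectorField E M} (h : C.IsAdaptedFrame x α v ε) :
    extD (C.extendForm (F.insertBivector C.verBivector μ)) x = -(1 / 2 : ℝ) • ∑ j,
      extD (insertField (h.dualSection j).field (insertField (v j).field (C.extendForm μ))) x := by
  have hs := fun j => ((C.smooth_extendForm hμ).insertField (v j).smooth_field).insertField
        (h.dualSection j).smooth_field
  rw [← extD_const_mul_sum _ hs]
  refine extD_congr (smooth_extendForm_insertBivector hμ) (fun Y hY => ?_) ?_
  · simp only [AlternatingMap.smul_apply, altForm_sum_apply, smul_eq_mul]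
    exact (IsSmoothFun.const _).mul (IsSmoothFun.sum fun j _ => hs j Y hY)
  · filter_upwards [h.eventually] with y hy
    exact hy.extendForm_insertBivector μ

end CouplingStructure

section Top

variable {n : ℕ} {F : RegularFoliation E M (n + 2)} {C : CouplingStructure F}

namespace CouplingStructure

/-- Cartan's formula twice: `d i_B i_A = L_B i_A - i_B d i_A` with `L_B i_A = i_A L_B + i_{[B, A]}`
and `d i_A = L_A - i_A d`. The term with `d τ_γ` drops out because its degree exceeds the leaf
dimension. -/
theorem extD_insertField_insertField {τ : F.LeafForm (n + 2)} (hτ : F.IsSmoothLeafForm τ)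
    {A B : F.Section} {a b : M → ℝ} (hA : C.IsLeafDivergence τ A.field a)
    (hB : C.IsLeafDivergence τ B.field b) (Y : Fin (n + 1) → F.Section) (x : M) :
    extD (insertField B.field (insertField A.field (C.extendForm τ))) x (fun i => (Y i).field x) =
      C.extendForm τ x (Matrix.vecCons (b x • A.field x - a x • B.field x +
        mlieBracket 𝓘(ℝ, E) B.field A.field x) fun i => (Y i).field x) := by
  have hT := C.smooth_extendForm hτ
  have hY := fun i => (Y i).smooth_field
  have h1 := extD_vecCons (hT.insertField A.smooth_field) B.smooth_field hY x
  have h2 := extD_vecCons hT A.smooth_field (forall_vecCons B.smooth_field hY) x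
  rw [vecCons_field, C.extD_eq_zero_of_mem] at h2
  · have e : ∀ S : F.Section, (Matrix.vecCons S.field fun i => (Y i).field) =
        fun i => ((Matrix.vecCons S Y : Fin (n + 2) → F.Section) i).field := fun S => by
      funext i
      refine Fin.cases rfl (fun i => rfl) i
    rw [lieDerivApply_insertField] at h1
    have h3 := hA (Matrix.vecCons B Y) x
    have h4 := hB (Matrix.vecCons A Y) x
    rw [← e] at h3 h4
    have e' : ∀ S : F.Section, (fun i => ((Matrix.vecCons S Y : Fin (n + 2) → F.Section) i).field x) =
        Matrix.vecCons (S.field x) fun i => (Y i).field x := fun S => by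
      funext i
      refine Fin.cases rfl (fun i => rfl) i
    rw [e'] at h3 h4
    rw [AlternatingMap.map_vecCons_add, sub_eq_add_neg, ← neg_smul, AlternatingMap.map_vecCons_add,
      AlternatingMap.map_vecCons_smul, AlternatingMap.map_vecCons_smul, smul_eq_mul, smul_eq_mul]
    linarith
  · intro i
    refine Fin.cases ?_ (fun i => Fin.cases ?_ (fun i => ?_) i) i
    exacts [A.field_mem x, B.field_mem x, (Y i).field_mem x]

theorem IsLeafModular.modularEquation_top {τ : F.LeafForm (n + 2)} (hτ : F.IsLeafwiseVolume τ)
    {W : F.Section} (hW : C.IsLeafModular τ W) :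
    F.IsFoliatedModularVectorField C.verBivector τ W := by
  intro Y x
  obtain ⟨α, v, ε, h⟩ := C.exists_isAdaptedFrame x
  choose δv _ hv using fun j => C.exists_isLeafDivergence hτ (v j).smooth_field
  choose δc _ hc using fun j => C.exists_isLeafDivergence hτ (h.dualSection j).smooth_field
  rw [leafD_eq_extD (C := C) (smooth_extendForm_insertBivector hτ.1), extD_insertBivector hτ.1 h,
    AlternatingMap.smul_apply, altForm_sum_apply]
  simp only [extD_insertField_insertField hτ.1 (hv _) (hc _)]
  have h1 : (τ x).curryLeft (W.val x) (fun i => (Y i).val x) =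
      C.extendForm τ x (Matrix.vecCons (W.field x) fun i => (Y i).field x) := by
    rw [AlternatingMap.curryLeft_apply_apply, ← C.extendForm_coe]
    congr 1
    funext i
    refine Fin.cases rfl (fun i => rfl) i
  rw [h1, hW.field_eq hτ h hv hc]
  rw [map_vecCons_smul_sum, smul_eq_mul, neg_mul, neg_neg]

end CouplingStructure

end Top

end CouplingPoisson

end

/-! ### Low leaf dimensions, uniqueness, and the modular vector field -/

noncomputable section

namespace CouplingPoisson

open Filter Topology VectorField

/-- A vector annihilating a nonzero top-degree form vanishes. -/
theorem eq_zero_of_curryLeft_eq_zero {U : Type*} [AddCommGroup U] [Module ℝ U]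
    [FiniteDimensional ℝ U] {m : ℕ} (hU : Module.finrank ℝ U = m + 1) {ζ : AltForm U (m + 1)}
    (hζ : ζ ≠ 0) {u : U} (hu : ζ.curryLeft u = 0) : u = 0 := by
  let b := Module.finBasisOfFinrankEq ℝ U hU
  rw [← Module.forall_dual_apply_eq_zero_iff ℝ]
  intro φ
  refine (mul_eq_zero.1 ?_).resolve_right (ne_zero_apply_basis ζ hζ b)
  rw [← sum_apply_mul_map_update]
  refine Finset.sum_eq_zero fun i _ => ?_
  rw [update_eq_insertNth, AlternatingMap.map_insertNth, ← AlternatingMap.curryLeft_apply_apply, hu,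
    AlternatingMap.zero_apply, smul_zero, mul_zero]

section Append

variable {A : Type*} {p q : ℕ}

theorem update_append_castAdd (u : Fin p → A) (v : Fin q → A) (i : Fin p) (c : A) :
    Function.update (Fin.append u v) (Fin.castAdd q i) c = Fin.append (Function.update u i c) v := by
  funext j
  refine Fin.addCases (fun j => ?_) (fun j => ?_) j
  · by_cases h : j = i
    · subst h; simp
    · simp [h]
  · have h : Fin.natAdd p j ≠ Fin.castAdd q i := fun h => by
      have := congrArg Fin.val h
      simp only [Fin.val_natAdd, Fin.val_castAdd] at this
      omega
    simp [h]

theorem update_append_natAdd (u : Fin p → A) (v : Fin q → A) (i : Fin q) (c : A) :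
    Function.update (Fin.append u v) (Fin.natAdd p i) c = Fin.append u (Function.update v i c) := by
  funext j
  refine Fin.addCases (fun j => ?_) (fun j => ?_) j
  · have h : Fin.castAdd q j ≠ Fin.natAdd p i := fun h => by
      have := congrArg Fin.val h
      simp only [Fin.val_natAdd, Fin.val_castAdd] at this
      omega
    simp [h]
  · by_cases h : j = i
    · subst h; simp
    · simp [h]

end Append

variable {E : Type*} [NormedAddCommGroup E] [NormedSpace ℝ E] [FiniteDimensional ℝ E]
  {M : Type*} [TopologicalSpace M] [T2Space M] [ChartedSpace E M] [IsManifold 𝓘(ℝ, E) ∞ M]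

theorem append_field {p q : ℕ} (h : Fin p → VField E M) (v : Fin q → VField E M) (x : M) :
    (fun i => (Fin.append h v) i x) = Fin.append (fun i => h i x) fun i => v i x := by
  funext i
  refine Fin.addCases (fun i => ?_) (fun i => ?_) i <;> simp

theorem lieDerivApply_zero {m : ℕ} (η : DForm E M m) (Y : Fin m → VField E M) (x : M) :
    lieDerivApply (fun _ => 0) η Y x = 0 := by
  simpa using lieDerivApply_sum (X := fun _ : Empty => (fun _ => 0 : VField E M)) η Finset.univ
    (fun i => i.elim) Y x

theorem RegularFoliation.Section.ext_val {k : ℕ} {F : RegularFoliation E M k} {W W' : F.Section}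
    (h : ∀ x, W.val x = W'.val x) : W = W' := by
  cases W
  cases W'
  congr 1
  exact funext h

namespace CouplingStructure

/-- On one-dimensional leaves the bivector `P` vanishes, so every `P^♯ df`, its divergence, and
therefore `W` are zero. This is what the modular equation demands in degree one, where `i_P τ` would
have negative degree. -/
theorem IsLeafModular.field_eq_zero {F : RegularFoliation E M 1} {C : CouplingStructure F}
    {τ : F.LeafForm 1} {W : F.Section} (hW : C.IsLeafModular τ W) (x : M) : W.field x = 0 := by
  refine eq_of_forall_differential fun f hf => ?_
  have h0 : ∀ y, (C.sharpSection hf.isSmoothCovectorField).field y = 0 := fun y => by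
    obtain ⟨α, v, ε, h⟩ := C.exists_isAdaptedFrame y
    have h1 : (h.dualSection 0).field y = 0 := by
      refine (h.sharp_verCovector_eq_neg (ε (Sum.inr 0))).trans ?_
      rw [Fin.sum_univ_one, ← C.verCovector_of_mem (ε (Sum.inr 0)) ((h.dualSection 0).field_mem y),
        IsAdaptedFrame.dualSection, sharpSection_field, apply_sharp, bivector_self, zero_smul, neg_zero]
    refine (h.sharp_verCovector_eq (differential E f)).trans ?_
    rw [Fin.sum_univ_one, h1, smul_zero]
  rw [map_zero, ← hW f hf (fun _ => 0) (fun Y y => ?_) x]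
  rw [zero_mul, lieDerivApply_congr (X' := fun _ => 0) _ (Eventually.of_forall h0),
    lieDerivApply_zero]

variable {k : ℕ} {F : RegularFoliation E M k} {C : CouplingStructure F}

theorem IsLeafModular.isFoliatedModularVectorField {τ : F.LeafForm k} (hτ : F.IsLeafwiseVolume τ)
    {W : F.Section} (hW : C.IsLeafModular τ W) :
    F.IsFoliatedModularVectorField C.verBivector τ W := by
  rcases k with _ | _ | n
  · trivial
  · intro x
    rw [show W.val x = 0 from Subtype.ext (hW.field_eq_zero x), map_zero]
  · exact hW.modularEquation_top hτ

theorem isFoliatedModularVectorField_unique {τ : F.LeafForm k} (hτ : F.IsLeafwiseVolume τ)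
    {P : (x : M) → Bivector (F.tangent x)} {W W' : F.Section}
    (hW : F.IsFoliatedModularVectorField P τ W) (hW' : F.IsFoliatedModularVectorField P τ W') :
    W = W' := by
  refine RegularFoliation.Section.ext_val fun x => ?_
  rw [← sub_eq_zero]
  rcases k with _ | _ | n
  · have := Module.finrank_zero_iff.1 (F.finrank_eq x)
    exact Subsingleton.elim _ _
  · refine eq_zero_of_curryLeft_eq_zero (F.finrank_eq x) (hτ.2 x) ?_
    rw [map_sub, show _ = _ from hW x, show _ = _ from hW' x, sub_zero]
  · refine eq_zero_of_curryLeft_eq_zero (F.finrank_eq x) (hτ.2 x) (AlternatingMap.ext fun w => ?_)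
    choose Y hY using fun i => F.exists_section_eq (w i)
    have h := (hW Y x).trans (hW' Y x).symm
    simp only [hY] at h
    rw [map_sub, AlternatingMap.sub_apply, h, sub_self, AlternatingMap.zero_apply]

variable (C)

/-- The Leibniz rule for `σ^l ∧ τ_γ`. -/
theorem lieDerivApply_volume {τ : F.LeafForm k} (hτ : F.IsLeafwiseVolume τ) (X : VField E M)
    {h : Fin (2 * C.halfRank) → VField E M} (hh : ∀ i, IsSmoothVField (h i))
    (hH : ∀ i y, h i y ∈ C.horizontal y) (v : Fin k → F.Section) (x : M) :
    lieDerivApply X (C.volume τ) (Fin.append h fun j => (v j).field) x =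
      lieDerivApply X C.transversalForm h x * C.extendForm τ x (fun j => (v j).field x) +
        C.transversalForm x (fun i => h i x) *
          lieDerivApply X (C.extendForm τ) (fun j => (v j).field) x := by
  have h1 : (fun y => C.volume τ y fun i => (Fin.append h fun j => (v j).field) i y) =
      fun y => C.transversalForm y (fun i => h i y) * C.extendForm τ y fun j => (v j).field y :=
    funext fun y => by rw [append_field, C.volume_append τ _ fun i => hH i y]
  -- The brackets put in place of `c` need not be horizontal. Here the nontrivial shuffles die
  -- because `σ^l` vanishes on the leaf vectors; in `h3` they die because `τ_γ` vanishes on the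
  -- horizontal ones.
  have h2 : ∀ i c, C.volume τ x (Function.update (fun i => (Fin.append h fun j => (v j).field) i x)
      (Fin.castAdd k i) c) = C.transversalForm x (Function.update (fun i => h i x) i c) *
        C.extendForm τ x fun j => (v j).field x := fun i c => by
    rw [append_field, update_append_castAdd]
    exact wedge_append_of_left _ _ _ _ fun w i j hij =>
      C.transversalForm_eq_zero (i := i) (hij ▸ (v j).field_mem x)
  have h3 : ∀ i c, C.volume τ x (Function.update (fun i => (Fin.append h fun j => (v j).field) i x)
      (Fin.natAdd (2 * C.halfRank) i) c) = C.transversalForm x (fun i => h i x) *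
        C.extendForm τ x (Function.update (fun j => (v j).field x) i c) := fun i c => by
    rw [append_field, update_append_natAdd, C.volume_append τ _ fun i => hH i x]
  rw [lieDerivApply, h1, differential_mul ((C.smooth_transversalForm h hh).at x)
    ((C.smooth_extendForm hτ.1 _ fun j => (v j).smooth_field).at x), Fin.sum_univ_add]
  simp only [h2, h3, Fin.append_left, Fin.append_right]
  rw [← Finset.sum_mul, ← Finset.mul_sum, lieDerivApply, lieDerivApply]
  ring

variable {C}

/-- The modular vector field of a coupling Poisson structure. -/
theorem IsDivergenceForm.isModularVectorField {τ : F.LeafForm k} (hτ : F.IsLeafwiseVolume τ)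
    {θ : CovectorField E M} (hθ : C.IsDivergenceForm τ θ) {W : F.Section}
    (hW : C.IsLeafModular τ W) :
    IsModularVectorField C.bivector (C.volume τ)
      fun x => - sharp (C.bivector x) (θ x) + W.field x := by
  refine ⟨((C.smooth_sharpField hθ.smooth).neg).add W.smooth_field, fun f hf Y hY x => ?_⟩
  obtain ⟨α, v, ε, hfr⟩ := C.exists_isAdaptedFrame x
  obtain ⟨B, hB, -⟩ := hfr.frame.exists_basis
  have hs := fun i => C.smooth_sharpField (hfr.smooth i)
  have hsH := fun i y => C.sharp_mem_horizontal (hfr.conormal i y)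
  have hdf := hf.isSmoothCovectorField (E := E)
  have hX : IsSmoothVField (hamiltonian C.bivector f) := C.smooth_sharpField hdf
  obtain ⟨L, hL⟩ := exists_lieDeriv (C.isVolumeForm_volume hτ).1 hX x
  rw [hL Y hY]
  suffices h : L = differential E f x (- sharp (C.bivector x) (θ x) + W.field x) • C.volume τ x by
    rw [h, AlternatingMap.smul_apply, smul_eq_mul]
  have hb : ⇑(B.reindex finSumFinEquiv) = fun i =>
      (Fin.append (fun i => C.sharpField (α i)) fun j => (v j).field) i x := by
    funext i
    rw [Module.Basis.reindex_apply, hB]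
    refine Fin.addCases (fun i => ?_) (fun i => ?_) i <;> simp
  -- Both sides are forms of top degree, so one adapted basis is enough, and on it the Leibniz rule
  -- applies.
  refine ext_basis (B.reindex finSumFinEquiv) ?_
  have hap : ∀ i, IsSmoothVField
      ((Fin.append (fun i => C.sharpField (α i)) fun j => (v j).field) i) := fun i => by
    refine Fin.addCases (fun i => ?_) (fun i => ?_) i
    · rw [Fin.append_left]; exact hs i
    · rw [Fin.append_right]; exact (v i).smooth_field
  rw [hb, ← hL _ hap, C.lieDerivApply_volume hτ _ hs hsH,
    C.lieDerivApply_hamiltonian_transversalForm hf hfr.smooth hfr.conormal, zero_mul, zero_add,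
    AlternatingMap.smul_apply, append_field, C.volume_append τ _ fun i => hsH i x]
  -- The conormal part of `df`; it splits the Hamiltonian field into a horizontal and a leaf-tangent
  -- smooth field.
  set β : CovectorField E M := fun y => differential E f y + - C.verCovector (differential E f) y
    with hβ
  have hβs : IsSmoothCovectorField β := hdf.add (C.smooth_verCovector hdf).neg
  have hβc : ∀ y, β y ∈ (F.tangent y).dualAnnihilator := fun y =>
    (Submodule.mem_dualAnnihilator _).2 fun w hw => by
      rw [hβ, LinearMap.add_apply, LinearMap.neg_apply, C.verCovector_of_mem _ hw, add_neg_cancel]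
  have hsplit : ∀ y, hamiltonian C.bivector f y =
      C.sharpField β y + (C.sharpSection hdf).field y := fun y => by
    rw [sharpSection_field, sharpField, ← map_add, hβ, neg_add_cancel_right]
    rfl
  obtain ⟨δ, -, hδ⟩ := C.exists_isLeafDivergence hτ (C.sharpSection hdf).smooth_field
  -- Since `θ` vanishes on `𝕍`, it does not distinguish `Π^♯ β` from `Π^♯ df`; skew-symmetry of `Π`
  -- then exchanges `θ` and `df`.
  have hθX : θ x (C.sharpField β x) = - differential E f x (sharp (C.bivector x) (θ x)) := by
    have h1 : θ x (C.sharpField β x) = θ x (hamiltonian C.bivector f x) := by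
      rw [hsplit, map_add, hθ.apply_tangent x _ ((C.sharpSection hdf).field_mem x), add_zero]
    rw [h1, hamiltonian, apply_sharp, apply_sharp, bivector_swap]
  rw [lieDerivApply_congr _ (Eventually.of_forall hsplit), lieDerivApply_add _
    (C.smooth_sharpField hβs) (C.sharpSection hdf).smooth_field,
    hθ.lieDerivApply_eq hτ (C.smooth_sharpField hβs) fun y => C.sharp_mem_horizontal (hβc y), hδ,
    hW f hf δ hδ x, hθX, map_add, map_neg, smul_eq_mul]
  ring

end CouplingStructure

theorem IsModularVectorField.unique {n : ℕ} {B : BivectorField E M} {Ω : DForm E M n}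
    (hΩ : ∀ x, Ω x ≠ 0) {Z Z' : VField E M} (h : IsModularVectorField B Ω Z)
    (h' : IsModularVectorField B Ω Z') : Z = Z' := by
  funext x
  refine eq_of_forall_differential fun f hf => ?_
  obtain ⟨w, hw⟩ : ∃ w, Ω x w ≠ 0 := by
    by_contra! h0
    exact hΩ x (AlternatingMap.ext h0)
  choose Y hY hYx using fun i => exists_isSmoothVField_apply_eq (w i)
  have h1 := (h.2 f hf Y hY x).symm.trans (h'.2 f hf Y hY x)
  simp only [hYx] at h1
  exact mul_right_cancel₀ hw h1

end CouplingPoisson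

end

open CouplingPoisson in
theorem proposition4p1 {E : Type*} [NormedAddCommGroup E] [NormedSpace ℝ E]
    [FiniteDimensional ℝ E] {M : Type*} [TopologicalSpace M] [T2Space M]
    [SecondCountableTopology M] [ChartedSpace E M] [IsManifold 𝓘(ℝ, E) ∞ M] {k : ℕ}
    (F : RegularFoliation E M k) (C : CouplingStructure F)
    (τ : F.LeafForm k) (hτ : F.IsLeafwiseVolume τ) :
    IsVolumeForm (C.volume τ) ∧
    (∃! Z : VField E M, IsModularVectorField C.bivector (C.volume τ) Z) ∧
    (∃! θ : CovectorField E M, C.IsDivergenceForm τ θ) ∧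
    (∃! W : F.Section, F.IsFoliatedModularVectorField C.verBivector τ W) ∧
    (∃! Λ : CovectorField E M, C.IsReebForm Λ) ∧
    (∀ (Z : VField E M) (θ : CovectorField E M) (W : F.Section),
      IsModularVectorField C.bivector (C.volume τ) Z → C.IsDivergenceForm τ θ →
      F.IsFoliatedModularVectorField C.verBivector τ W →
        ∀ x, C.horProj x (Z x) = - sharp (C.bivector x) (θ x) ∧ C.conn x (Z x) = W.val x) ∧
    (∀ Λ : CovectorField E M, C.IsReebForm Λ → ∀ x,
      contract (C.horBivector x) (C.curvature x) =
        sharp (C.verBivector x) ((Λ x).domRestrict (F.tangent x))) := by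
  obtain ⟨θ, hθ⟩ := C.exists_isDivergenceForm hτ
  obtain ⟨W, hW⟩ := C.exists_isLeafModular hτ
  obtain ⟨Λ, hΛ⟩ := C.exists_isReebForm
  have hW' := hW.isFoliatedModularVectorField hτ
  have hZ := hθ.isModularVectorField hτ hW
  have hΩ := fun x => C.volume_ne_zero (hτ.2 x)
  refine ⟨C.isVolumeForm_volume hτ, ⟨_, hZ, fun Z' h => h.unique hΩ hZ⟩,
    ⟨θ, hθ, fun θ' h => h.unique hτ hθ⟩,
    ⟨W, hW', fun W' h => CouplingStructure.isFoliatedModularVectorField_unique hτ h hW'⟩,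
    ⟨Λ, hΛ, fun Λ' h => h.unique hΛ⟩, fun Z θ' W' h1 h2 h3 x => ?_,
    fun Λ' h x => h.contract_curvature x⟩
  obtain rfl := h1.unique hΩ hZ
  obtain rfl := h2.unique hτ hθ
  obtain rfl := CouplingStructure.isFoliatedModularVectorField_unique hτ h3 hW'
  have hH : sharp (C.bivector x) (θ' x) ∈ C.horizontal x :=
    C.sharp_mem_horizontal ((Submodule.mem_dualAnnihilator _).2 fun v hv => h2.apply_tangent x v hv)
  rw [map_add, map_add, map_neg, map_neg, C.horProj_of_mem hH, C.conn_of_mem_horizontal hH,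
    C.horProj_of_mem_tangent (W'.field_mem x), add_zero, neg_zero, zero_add]
  exact ⟨rfl, C.conn_of_mem _⟩
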